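/- **Setting.** Let $d>0$, $\Omega=\mathbb R\times(0,d)$ and, for $n\ge 1$, $$\mu_n=\frac{(2n-1)^2\pi^2}{4d^2},\qquad \chi_n^-(y)=\sqrt{\tfrac2d}\,\sin\frac{(2n-1)\pi y}{2d},\qquad \chi_n^+(y)=\sqrt{\tfrac2d}\,\cos\frac{(2n-1)\pi y}{2d}.$$ Fix $n_0\ge 1$. For real $k$ put $n_1(k)=\Big\lfloor \tfrac12+\sqrt{(n_0-\tfrac12)^2+d^2k^2/\pi^2}\Big\rfloor$, $k_n=\sqrt{\mu_{n_0}-\mu_n+k^2}$ for $n\le n_1(k)$ and $\kappa_n=\sqrt{\mu_n-\mu_{n_0}-k^2}$ for $n>n_1(k)$. Let $\mathcal H^{1/2}$ be the space of $g\in L^2(0,d)$ with $\sum_n n|(\chi_n^-,g)|^2<\infty$ and $\sum_n n|(\chi_n^+,g)|^2<\infty$. A *scattering wave* at momentum $k$ with coefficients $r_n,t_n\in\mathbb C$ ($n\ge1$) is the function $$f(k,x,y)=e^{ikx}\chi^-_{n_0}(y)+\sum_{l\le n_1(k)}r_l e^{-ik_lx}\chi_l^-(y)+\sum_{n>n_1(k)}r_ne^{\kappa_nx}\chi_n^-(y)\quad(x<0),$$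 $$f(k,x,y)=\sum_{l\le n_1(k)}t_l e^{ik_lx}\chi_l^+(y)+\sum_{n>n_1(k)}t_ne^{-\kappa_nx}\chi_n^+(y)\quad(x>0),$$ where $\sum_n n|r_n|^2<\infty$, $\sum_n n|t_n|^2<\infty$, and the two matching conditions at $x=0$ hold: $\chi^-_{n_0}+\sum_n r_n\chi_n^-=\sum_n t_n\chi^+_n$ in $L^2(0,d)$, and, as functionals on $\mathcal H^{1/2}$ (where $\sum_n c_n\chi_n^\pm$ acts by $g\mapsto\sum_n\overline{c_n}(\chi_n^\pm,g)$), $$ik\chi^-_{n_0}-i\sum_{l\le n_1(k)}k_lr_l\chi^-_l+\sum_{n>n_1(k)}\kappa_nr_n\chi_n^-=i\sum_{l\le n_1(k)}k_lt_l\chi_l^+-\sum_{n>n_1(k)}\kappa_nt_n\chi_n^+ .$$ **Theorem.** Let $k_0\in\mathbb R$ and let $\alpha,\beta$ satisfy $$\sqrt{\mu_{n_1(k_0)}-\mu_{n_0}}<\alpha<\beta<\sqrt{\mu_{n_1(k_0)+1}-\mu_{n_0}} .$$ Then for every $k\in[\alpha,\beta]$ there is exactly one family of coefficients $(r_n(k),t_n(k))_{n\ge1}$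 defining a scattering wave $f(k,\cdot,\cdot)$ at momentum $k$. Let $a\in C^1(\mathbb R;\mathbb C)$ with $\operatorname{supp}a\subset[\alpha,\beta]$, and put $$\psi(t,x,y)=\int_{\mathbb R}a(k)e^{-i(\mu_{n_0}+k^2)t}f(k,x,y)\,dk,\qquad \psi^-(t,x,y)=\int_{\mathbb R}a(k)e^{-i(\mu_{n_0}+k^2)t}e^{ikx}\chi^-_{n_0}(y)\,dk,$$ $$\psi^+(t,x,y)=\begin{cases}\displaystyle\int_{\mathbb R}a(k)e^{-i(\mu_{n_0}+k^2)t}\sum_{l\le n_1(k)}r_l(k)e^{-ik_lx}\chi_l^-(y)\,dk,&x<0,\\[2mm]\displaystyle\int_{\mathbb R}a(k)e^{-i(\mu_{n_0}+k^2)t}\sum_{l\le n_1(k)}t_l(k)e^{ik_lx}\chi_l^+(y)\,dk,&x>0.\end{cases}$$ Then the integral defining $\psi$ converges absolutely for all $t$, all $x\ne0$ and all $y\in(0,d)$; $\psi(t),\psi^-(t),\psi^+(t)\in L^2(\Omega)$ for every $t$; and $$\lim_{t\to-\infty}\|\psi(t)-\psi^-(t)\|_{L^2(\Omega)}=0,\qquad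 \lim_{t\to+\infty}\|\psi(t)-\psi^+(t)\|_{L^2(\Omega)}=0 .$$ Moreover there is a constant $C$ such that $\|\psi(t)-\psi^-(t)\|_{L^2(\Omega)}\le C|t|^{-1/2}$ for all $t<0$ and $\|\psi(t)-\psi^+(t)\|_{L^2(\Omega)}\le C|t|^{-1/2}$ for all $t>0$. -/

import Mathlib

open MeasureTheory Set Filter Topology

noncomputable section

namespace Waveguide

/-- Transversal eigenvalue `μ_n = (2n-1)² π² / (4d²)`, `n = 1, 2, …`. -/
def mu (d : ℝ) (n : ℕ+) : ℝ := (2 * (n : ℝ) - 1) ^ 2 * Real.pi ^ 2 / (4 * d ^ 2)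

/-- Transversal mode `χ⁻_n` (Dirichlet at `y = 0`, Neumann at `y = d`). -/
def chiMinus (d : ℝ) (n : ℕ+) (y : ℝ) : ℝ :=
  Real.sqrt (2 / d) * Real.sin ((2 * (n : ℝ) - 1) * (Real.pi * y / (2 * d)))

/-- Transversal mode `χ⁺_n` (Neumann at `y = 0`, Dirichlet at `y = d`). -/
def chiPlus (d : ℝ) (n : ℕ+) (y : ℝ) : ℝ :=
  Real.sqrt (2 / d) * Real.cos ((2 * (n : ℝ) - 1) * (Real.pi * y / (2 * d)))

theorem one_le_floor (d : ℝ) (n₀ : ℕ+) (k : ℝ) :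
    0 < ⌊1 / 2 + Real.sqrt (((n₀ : ℝ) - 1 / 2) ^ 2 + d ^ 2 / Real.pi ^ 2 * k ^ 2)⌋₊ := by
  rw [Nat.floor_pos]
  have h1 : (1 : ℝ) ≤ (n₀ : ℝ) := Nat.one_le_cast.mpr n₀.pos
  have h2 : (1 / 2 : ℝ) ≤
      Real.sqrt (((n₀ : ℝ) - 1 / 2) ^ 2 + d ^ 2 / Real.pi ^ 2 * k ^ 2) := by
    apply Real.le_sqrt_of_sq_le
    have h3 : 0 ≤ d ^ 2 / Real.pi ^ 2 * k ^ 2 := by positivity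
    nlinarith
  linarith

/-- Index `n₁(k)` of the highest mode that can be excited at momentum `k` in mode `n₀`. -/
def topMode (d : ℝ) (n₀ : ℕ+) (k : ℝ) : ℕ+ :=
  ⟨⌊1 / 2 + Real.sqrt (((n₀ : ℝ) - 1 / 2) ^ 2 + d ^ 2 / Real.pi ^ 2 * k ^ 2)⌋₊,
    one_le_floor d n₀ k⟩

/-- Longitudinal momentum `k_n` of the propagating modes `n ≤ n₁(k)`. -/
def momentum (d : ℝ) (n₀ : ℕ+) (k : ℝ) (n : ℕ+) : ℝ := Real.sqrt (mu d n₀ - mu d n + k ^ 2)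

/-- Decay rate `κ_n` of the evanescent modes `n > n₁(k)`. -/
def decay (d : ℝ) (n₀ : ℕ+) (k : ℝ) (n : ℕ+) : ℝ := Real.sqrt (mu d n - mu d n₀ - k ^ 2)

/-- The reflected propagating part `∑_{l ≤ n₁} r_l e^{-i k_l x} χ⁻_l(y)`. -/
def reflectedPart (d : ℝ) (n₀ : ℕ+) (k : ℝ) (r : ℕ+ → ℂ) (x y : ℝ) : ℂ :=
  ∑ l ∈ Finset.Icc 1 (topMode d n₀ k),
    r l * Complex.exp (-(Complex.I * (momentum d n₀ k l : ℂ) * (x : ℂ))) * (chiMinus d l y : ℂ)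

/-- The transmitted propagating part `∑_{l ≤ n₁} t_l e^{i k_l x} χ⁺_l(y)`. -/
def transmittedPart (d : ℝ) (n₀ : ℕ+) (k : ℝ) (tr : ℕ+ → ℂ) (x y : ℝ) : ℂ :=
  ∑ l ∈ Finset.Icc 1 (topMode d n₀ k),
    tr l * Complex.exp (Complex.I * (momentum d n₀ k l : ℂ) * (x : ℂ)) * (chiPlus d l y : ℂ)

/-- The incoming plane wave `e^{ikx} χ⁻_{n₀}(y)`. -/
def incomingPart (d : ℝ) (n₀ : ℕ+) (k : ℝ) (x y : ℝ) : ℂ :=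
  Complex.exp (Complex.I * (k : ℂ) * (x : ℂ)) * (chiMinus d n₀ y : ℂ)

/-- The stationary wave `f(k, x, y)` with reflection coefficients `r_n` and transmission
coefficients `t_n`. (On the null set `x = 0` the right-hand formula is used.) -/
def stationaryWave (d : ℝ) (n₀ : ℕ+) (k : ℝ) (r tr : ℕ+ → ℂ) (x y : ℝ) : ℂ :=
  if x < 0 then
    incomingPart d n₀ k x y + reflectedPart d n₀ k r x y +
      ∑' n : Set.Ioi (topMode d n₀ k),
        r n * (Real.exp (decay d n₀ k n * x) : ℂ) * (chiMinus d n y : ℂ)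
  else
    transmittedPart d n₀ k tr x y +
      ∑' n : Set.Ioi (topMode d n₀ k),
        tr n * (Real.exp (-(decay d n₀ k n * x)) : ℂ) * (chiPlus d n y : ℂ)

/-- `L²(0,d)` with complex values. -/
abbrev L2 (d : ℝ) : Type := Lp ℂ 2 (volume.restrict (Set.Ioo 0 d))

theorem memLp_chiMinus (d : ℝ) (n : ℕ+) :
    MemLp (fun y => (chiMinus d n y : ℂ)) 2 (volume.restrict (Set.Ioo 0 d)) := by
  have hc : Continuous (fun y => (chiMinus d n y : ℂ)) := by unfold chiMinus; fun_prop
  refine MemLp.of_bound hc.aestronglyMeasurable (Real.sqrt (2 / d)) (ae_of_all _ fun y => ?_)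
  rw [Complex.norm_real, chiMinus, norm_mul, Real.norm_of_nonneg (Real.sqrt_nonneg _)]
  exact mul_le_of_le_one_right (Real.sqrt_nonneg _) (Real.abs_sin_le_one _)

theorem memLp_chiPlus (d : ℝ) (n : ℕ+) :
    MemLp (fun y => (chiPlus d n y : ℂ)) 2 (volume.restrict (Set.Ioo 0 d)) := by
  have hc : Continuous (fun y => (chiPlus d n y : ℂ)) := by unfold chiPlus; fun_prop
  refine MemLp.of_bound hc.aestronglyMeasurable (Real.sqrt (2 / d)) (ae_of_all _ fun y => ?_)
  rw [Complex.norm_real, chiPlus, norm_mul, Real.norm_of_nonneg (Real.sqrt_nonneg _)]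
  exact mul_le_of_le_one_right (Real.sqrt_nonneg _) (Real.abs_cos_le_one _)

/-- `χ⁻_n` as an element of `L²(0,d)`. -/
def modeMinus (d : ℝ) (n : ℕ+) : L2 d := (memLp_chiMinus d n).toLp _

/-- `χ⁺_n` as an element of `L²(0,d)`. -/
def modePlus (d : ℝ) (n : ℕ+) : L2 d := (memLp_chiPlus d n).toLp _

/-- The space `𝓗^{1/2} = 𝓗₋^{1/2} ∩ 𝓗₊^{1/2}`: the `g ∈ L²(0,d)` whose expansion coefficients
`g_n` in the basis `χ⁻`, and also those in the basis `χ⁺`, satisfy `∑ n |g_n|² < ∞`. -/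
def HHalf (d : ℝ) : Set (L2 d) :=
  {g | Summable (fun n : ℕ+ => (n : ℝ) * ‖inner ℂ (modeMinus d n) g‖ ^ 2) ∧
    Summable (fun n : ℕ+ => (n : ℝ) * ‖inner ℂ (modePlus d n) g‖ ^ 2)}

/-- Coefficients in the basis `χ⁻` of the left trace `f_x(k, 0⁻, ·)`. -/
def derivCoeffMinus (d : ℝ) (n₀ : ℕ+) (k : ℝ) (r : ℕ+ → ℂ) (n : ℕ+) : ℂ :=
  (if n = n₀ then Complex.I * (k : ℂ) else 0) +
    if n ≤ topMode d n₀ k then -(Complex.I * (momentum d n₀ k n : ℂ) * r n)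
    else (decay d n₀ k n : ℂ) * r n

/-- Coefficients in the basis `χ⁺` of the right trace `f_x(k, 0⁺, ·)`. -/
def derivCoeffPlus (d : ℝ) (n₀ : ℕ+) (k : ℝ) (tr : ℕ+ → ℂ) (n : ℕ+) : ℂ :=
  if n ≤ topMode d n₀ k then Complex.I * (momentum d n₀ k n : ℂ) * tr n
  else -((decay d n₀ k n : ℂ) * tr n)

/-- The coefficients `(r_n)`, `(t_n)` define a stationary scattering wave at momentum `k`:
`∑ n |r_n|²` and `∑ n |t_n|²` are finite, the traces of `f(k,·,·)` from the left and from the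
right at `x = 0` are the same element `φ` of `L²(0,d)` (hence of `𝓗^{1/2}`), and the traces of
`∂f/∂x` from both sides agree in `𝓗^{-1/2}`, that is, as functionals
`g ↦ ∑ conj(c_n) g_n` on `𝓗^{1/2}`. -/
structure IsScattering (d : ℝ) (n₀ : ℕ+) (k : ℝ) (r tr : ℕ+ → ℂ) : Prop where
  summable_r : Summable (fun n : ℕ+ => (n : ℝ) * ‖r n‖ ^ 2)
  summable_tr : Summable (fun n : ℕ+ => (n : ℝ) * ‖tr n‖ ^ 2)
  trace_eq : ∃ φ : L2 d,
    HasSum (fun n : ℕ+ => r n • modeMinus d n) (φ - modeMinus d n₀) ∧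
    HasSum (fun n : ℕ+ => tr n • modePlus d n) φ
  deriv_trace_eq : ∀ g ∈ HHalf d,
    ∑' n : ℕ+, (starRingEnd ℂ) (derivCoeffMinus d n₀ k r n) * inner ℂ (modeMinus d n) g =
      ∑' n : ℕ+, (starRingEnd ℂ) (derivCoeffPlus d n₀ k tr n) * inner ℂ (modePlus d n) g

/-- The time factor `a(k) e^{-i(μ_{n₀} + k²)t}`. -/
def amplitude (d : ℝ) (n₀ : ℕ+) (a : ℝ → ℂ) (t k : ℝ) : ℂ :=
  a k * Complex.exp (-(Complex.I * ((mu d n₀ + k ^ 2 : ℝ) : ℂ) * (t : ℂ)))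

/-- The wave packet `ψ(t)`. -/
def psi (d : ℝ) (n₀ : ℕ+) (a : ℝ → ℂ) (r tr : ℝ → ℕ+ → ℂ) (t : ℝ) (p : ℝ × ℝ) : ℂ :=
  ∫ k : ℝ, amplitude d n₀ a t k * stationaryWave d n₀ k (r k) (tr k) p.1 p.2

/-- The free incoming packet `ψ⁻(t)`. -/
def psiMinus (d : ℝ) (n₀ : ℕ+) (a : ℝ → ℂ) (t : ℝ) (p : ℝ × ℝ) : ℂ :=
  ∫ k : ℝ, amplitude d n₀ a t k * incomingPart d n₀ k p.1 p.2

/-- The reflected packet `ψ_DN(t)`. -/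
def psiDN (d : ℝ) (n₀ : ℕ+) (a : ℝ → ℂ) (r : ℝ → ℕ+ → ℂ) (t : ℝ) (p : ℝ × ℝ) : ℂ :=
  ∫ k : ℝ, amplitude d n₀ a t k * reflectedPart d n₀ k (r k) p.1 p.2

/-- The transmitted packet `ψ_ND(t)`. -/
def psiND (d : ℝ) (n₀ : ℕ+) (a : ℝ → ℂ) (tr : ℝ → ℕ+ → ℂ) (t : ℝ) (p : ℝ × ℝ) : ℂ :=
  ∫ k : ℝ, amplitude d n₀ a t k * transmittedPart d n₀ k (tr k) p.1 p.2

/-- The outgoing state `ψ⁺(t)`: reflected packet for `x < 0`, transmitted packet for `x > 0`. -/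
def psiPlus (d : ℝ) (n₀ : ℕ+) (a : ℝ → ℂ) (r tr : ℝ → ℕ+ → ℂ) (t : ℝ) (p : ℝ × ℝ) : ℂ :=
  if p.1 < 0 then psiDN d n₀ a r t p else psiND d n₀ a tr t p

/-- Lebesgue measure on the waveguide `Ω = ℝ × (0,d)`. -/
def volOmega (d : ℝ) : Measure (ℝ × ℝ) := volume.restrict (Set.univ ×ˢ Set.Ioo 0 d)

end Waveguide

end

open MeasureTheory Set Filter Topology

noncomputable section

namespace Waveguide

open scoped ENNReal

/-! Matching. The trace φ of a scattering wave at x = 0 has coefficients r_n + δ_{n,n₀} in the basis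
χ⁻ and t_n in the basis χ⁺. After weighting by √n, such pairs of sequences form a Hilbert space,
`traceSpace`: the pairs in ℓ² × ℓ² that represent one vector of L²(0,d). Let σ_n = -i k_n for the
propagating modes and σ_n = κ_n for the evanescent ones. Equality of the x-derivatives, tested on
𝓗^{1/2}, is then a variational equation on `traceSpace` for the diagonal form with entries σ_n / n,
acting on both components, with a source proportional to k. On [α, β] the number N of propagating
modes is constant and k stays away from all thresholds, so k_n and κ_n are comparable to n uniformly
in k and n. Hence Re - Im of every σ_n / n is at least some c > 0, the form is coercive after a
rotation, and Lax–Milgram gives exactly one solution (`isUnit_formOp`, `existsUnique_isScattering`).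
The multiplier k ↦ (σ_n / n) is C¹ into ℓ^∞ and inversion of operators is smooth, so the weighted
coefficients are C¹ in k with values in ℓ² (`exists_deriv_solution`).

Decay. Each propagating packet is an oscillatory integral with phase -(μ_{n₀} + k²)t ± k_l x. Where
the two terms of the k-derivative have the same sign there is no stationary point, the derivative is
at least a multiple of |t| + |x|, and one integration by parts gives the bound C / (|t| + |x|)
(`exists_norm_integral_phase_le`). Its L² norm in x is O(|t|^{-1/2}). The free packets left over in
ψ - ψ⁻ for t < 0, and in ψ - ψ⁺ for t > 0, are exactly those in this regime.

The evanescent remainder is bounded by B(x) = |x|^{-1/4} e^{-c|x|}, which is square integrable, and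
so is its k-derivative (`exists_hasC1_evan`). Integration by parts in k against e^{-ik²t} yields the
second bound B(x) / |t|. The geometric mean of the two is B(x) |t|^{-1/2}, valid for all t ≠ 0
(`exists_eLpNorm_le`). -/

/-! ### Orthonormality of the transversal modes -/

theorem integral_cos_int {d : ℝ} (hd : 0 < d) (j : ℤ) :
    ∫ y in (0 : ℝ)..d, Real.cos (j * (Real.pi * y / d)) = if j = 0 then d else 0 := by
  split_ifs with hj
  · simp [hj]
  · have hc : (j : ℝ) * Real.pi / d ≠ 0 := by
      have : (j : ℝ) ≠ 0 := by exact_mod_cast hj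
      positivity
    have h1 : ∀ y : ℝ, Real.cos (j * (Real.pi * y / d)) = Real.cos (j * Real.pi / d * y) := by
      intro y; congr 1; ring
    simp_rw [h1]
    rw [intervalIntegral.integral_comp_mul_left (fun y => Real.cos y) hc]
    have h2 : (j : ℝ) * Real.pi / d * d = j * Real.pi := by field_simp
    simp [h2, Real.sin_int_mul_pi]

theorem continuous_chiMinus (d : ℝ) (n : ℕ+) : Continuous (chiMinus d n) := by
  unfold chiMinus; fun_prop

theorem continuous_chiPlus (d : ℝ) (n : ℕ+) : Continuous (chiPlus d n) := by
  unfold chiPlus; fun_prop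

theorem abs_chiMinus_le (d : ℝ) (n : ℕ+) (y : ℝ) : |chiMinus d n y| ≤ Real.sqrt (2 / d) := by
  rw [chiMinus, abs_mul, abs_of_nonneg (Real.sqrt_nonneg _)]
  exact mul_le_of_le_one_right (Real.sqrt_nonneg _) (Real.abs_sin_le_one _)

theorem abs_chiPlus_le (d : ℝ) (n : ℕ+) (y : ℝ) : |chiPlus d n y| ≤ Real.sqrt (2 / d) := by
  rw [chiPlus, abs_mul, abs_of_nonneg (Real.sqrt_nonneg _)]
  exact mul_le_of_le_one_right (Real.sqrt_nonneg _) (Real.abs_cos_le_one _)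

theorem chiMinus_mul_chiMinus {d : ℝ} (hd : 0 < d) (n m : ℕ+) (y : ℝ) :
    chiMinus d n y * chiMinus d m y =
      1 / d * (Real.cos (((n : ℤ) - m : ℤ) * (Real.pi * y / d)) -
        Real.cos (((n : ℤ) + m - 1 : ℤ) * (Real.pi * y / d))) := by
  have h : Real.sqrt (2 / d) * Real.sqrt (2 / d) = 2 / d := Real.mul_self_sqrt (by positivity)
  have h1 : (((n : ℤ) - m : ℤ) : ℝ) * (Real.pi * y / d) =
      (2 * (n : ℝ) - 1) * (Real.pi * y / (2 * d)) - (2 * (m : ℝ) - 1) * (Real.pi * y / (2 * d)) := by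
    push_cast; field_simp; ring
  have h2 : (((n : ℤ) + m - 1 : ℤ) : ℝ) * (Real.pi * y / d) =
      (2 * (n : ℝ) - 1) * (Real.pi * y / (2 * d)) + (2 * (m : ℝ) - 1) * (Real.pi * y / (2 * d)) := by
    push_cast; field_simp; ring
  rw [h1, h2, Real.cos_sub, Real.cos_add, chiMinus, chiMinus]
  linear_combination (Real.sin ((2 * (n : ℝ) - 1) * (Real.pi * y / (2 * d))) *
    Real.sin ((2 * (m : ℝ) - 1) * (Real.pi * y / (2 * d)))) * h

theorem chiPlus_mul_chiPlus {d : ℝ} (hd : 0 < d) (n m : ℕ+) (y : ℝ) :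
    chiPlus d n y * chiPlus d m y =
      1 / d * (Real.cos (((n : ℤ) - m : ℤ) * (Real.pi * y / d)) +
        Real.cos (((n : ℤ) + m - 1 : ℤ) * (Real.pi * y / d))) := by
  have h : Real.sqrt (2 / d) * Real.sqrt (2 / d) = 2 / d := Real.mul_self_sqrt (by positivity)
  have h1 : (((n : ℤ) - m : ℤ) : ℝ) * (Real.pi * y / d) =
      (2 * (n : ℝ) - 1) * (Real.pi * y / (2 * d)) - (2 * (m : ℝ) - 1) * (Real.pi * y / (2 * d)) := by
    push_cast; field_simp; ring
  have h2 : (((n : ℤ) + m - 1 : ℤ) : ℝ) * (Real.pi * y / d) =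
      (2 * (n : ℝ) - 1) * (Real.pi * y / (2 * d)) + (2 * (m : ℝ) - 1) * (Real.pi * y / (2 * d)) := by
    push_cast; field_simp; ring
  rw [h1, h2, Real.cos_sub, Real.cos_add, chiPlus, chiPlus]
  linear_combination (Real.cos ((2 * (n : ℝ) - 1) * (Real.pi * y / (2 * d))) *
    Real.cos ((2 * (m : ℝ) - 1) * (Real.pi * y / (2 * d)))) * h

theorem integral_chiMinus_mul {d : ℝ} (hd : 0 < d) (n m : ℕ+) :
    ∫ y in Ioo 0 d, chiMinus d n y * chiMinus d m y = if n = m then 1 else 0 := by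
  rw [← integral_Ioc_eq_integral_Ioo, ← intervalIntegral.integral_of_le hd.le]
  simp_rw [chiMinus_mul_chiMinus hd]
  rw [intervalIntegral.integral_const_mul, intervalIntegral.integral_sub
    (Continuous.intervalIntegrable (by fun_prop) _ _)
    (Continuous.intervalIntegrable (by fun_prop) _ _), integral_cos_int hd, integral_cos_int hd]
  have hn := n.pos
  have hm := m.pos
  have h2 : ((n : ℤ) + m - 1) ≠ 0 := by omega
  rw [if_neg h2]
  by_cases h : n = m
  · simp [h, hd.ne']
  · have h' : ((n : ℤ) - m) ≠ 0 := by
      intro h'; apply h; apply PNat.eq; omega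
    simp [h, h']

theorem integral_chiPlus_mul {d : ℝ} (hd : 0 < d) (n m : ℕ+) :
    ∫ y in Ioo 0 d, chiPlus d n y * chiPlus d m y = if n = m then 1 else 0 := by
  rw [← integral_Ioc_eq_integral_Ioo, ← intervalIntegral.integral_of_le hd.le]
  simp_rw [chiPlus_mul_chiPlus hd]
  rw [intervalIntegral.integral_const_mul, intervalIntegral.integral_add
    (Continuous.intervalIntegrable (by fun_prop) _ _)
    (Continuous.intervalIntegrable (by fun_prop) _ _), integral_cos_int hd, integral_cos_int hd]
  have hn := n.pos
  have hm := m.pos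
  have h2 : ((n : ℤ) + m - 1) ≠ 0 := by omega
  rw [if_neg h2]
  by_cases h : n = m
  · simp [h, hd.ne']
  · have h' : ((n : ℤ) - m) ≠ 0 := by
      intro h'; apply h; apply PNat.eq; omega
    simp [h, h']

theorem inner_modeMinus (d : ℝ) (n : ℕ+) (g : L2 d) :
    inner ℂ (modeMinus d n) g = ∫ y in Ioo 0 d, (chiMinus d n y : ℂ) * g y := by
  rw [L2.inner_def]
  refine integral_congr_ae ?_
  filter_upwards [(memLp_chiMinus d n).coeFn_toLp] with y hy
  rw [modeMinus, hy, RCLike.inner_apply, Complex.conj_ofReal, mul_comm]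

theorem inner_modePlus (d : ℝ) (n : ℕ+) (g : L2 d) :
    inner ℂ (modePlus d n) g = ∫ y in Ioo 0 d, (chiPlus d n y : ℂ) * g y := by
  rw [L2.inner_def]
  refine integral_congr_ae ?_
  filter_upwards [(memLp_chiPlus d n).coeFn_toLp] with y hy
  rw [modePlus, hy, RCLike.inner_apply, Complex.conj_ofReal, mul_comm]

theorem orthonormal_modeMinus {d : ℝ} (hd : 0 < d) : Orthonormal ℂ (modeMinus d) := by
  rw [orthonormal_iff_ite]
  intro n m
  rw [inner_modeMinus]
  have : ∫ y in Ioo 0 d, (chiMinus d n y : ℂ) * (modeMinus d m) y =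
      ∫ y in Ioo 0 d, ((chiMinus d n y * chiMinus d m y : ℝ) : ℂ) := by
    refine integral_congr_ae ?_
    filter_upwards [(memLp_chiMinus d m).coeFn_toLp] with y hy
    rw [modeMinus, hy]; push_cast; rfl
  rw [this, integral_complex_ofReal, integral_chiMinus_mul hd]
  split_ifs <;> simp

theorem orthonormal_modePlus {d : ℝ} (hd : 0 < d) : Orthonormal ℂ (modePlus d) := by
  rw [orthonormal_iff_ite]
  intro n m
  rw [inner_modePlus]
  have : ∫ y in Ioo 0 d, (chiPlus d n y : ℂ) * (modePlus d m) y =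
      ∫ y in Ioo 0 d, ((chiPlus d n y * chiPlus d m y : ℝ) : ℂ) := by
    refine integral_congr_ae ?_
    filter_upwards [(memLp_chiPlus d m).coeFn_toLp] with y hy
    rw [modePlus, hy]; push_cast; rfl
  rw [this, integral_complex_ofReal, integral_chiPlus_mul hd]
  split_ifs <;> simp

/-! ### Completeness of the transversal modes -/

theorem integrable_continuous_mul {d : ℝ} {w : ℝ → ℂ} (hw : IntegrableOn w (Ioo 0 d))
    {F : ℝ → ℝ} (hF : Continuous F) :
    Integrable (fun y => (F y : ℂ) * w y) (volume.restrict (Ioo 0 d)) := by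
  obtain ⟨C, hC⟩ := (isCompact_Icc (a := (0 : ℝ)) (b := d)).exists_bound_of_continuousOn
    hF.continuousOn
  refine Integrable.bdd_mul (c := C) hw
    (Continuous.aestronglyMeasurable (by fun_prop)) ?_
  filter_upwards [ae_restrict_mem measurableSet_Ioo] with y hy
  rw [Complex.norm_real]
  exact hC y (Ioo_subset_Icc_self hy)

/-- On [0, d] the function cos(πy/d) is a homeomorphism onto [-1, 1], so by Weierstrass its
polynomials approximate every test function uniformly. -/
theorem ae_eq_zero_of_cos_moments {d : ℝ} (hd : 0 < d) {w : ℝ → ℂ}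
    (hw : IntegrableOn w (Ioo 0 d))
    (h : ∀ m : ℕ, ∫ y in Ioo 0 d, ((Real.cos (Real.pi * y / d) ^ m : ℝ) : ℂ) * w y = 0) :
    w =ᵐ[volume.restrict (Ioo 0 d)] 0 := by
  refine ae_eq_zero_of_integral_contDiff_smul_eq_zero (Integrable.locallyIntegrable hw) ?_
  intro g hg _
  have hpoly : ∀ p : Polynomial ℝ,
      ∫ y in Ioo 0 d, ((p.eval (Real.cos (Real.pi * y / d)) : ℝ) : ℂ) * w y = 0 := by
    intro p
    induction p using Polynomial.induction_on' with
    | add p q hp hq =>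
      simp only [Polynomial.eval_add, Complex.ofReal_add, add_mul]
      rw [integral_add, hp, hq, add_zero]
      · exact integrable_continuous_mul hw (F := fun y => p.eval (Real.cos (Real.pi * y / d)))
          (by fun_prop)
      · exact integrable_continuous_mul hw (F := fun y => q.eval (Real.cos (Real.pi * y / d)))
          (by fun_prop)
    | monomial m c =>
      simp only [Polynomial.eval_monomial, Complex.ofReal_mul, mul_assoc]
      rw [integral_const_mul, h, mul_zero]
  -- The test function read in the variable s = cos(πy/d).
  have hG : ContinuousOn (fun s => g (d / Real.pi * Real.arccos s)) (Icc (-1) 1) :=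
    (hg.continuous.comp (by fun_prop)).continuousOn
  have hI : 0 ≤ ∫ y in Ioo 0 d, ‖w y‖ := integral_nonneg fun _ => norm_nonneg _
  rw [← norm_le_zero_iff]
  refine le_of_forall_pos_le_add fun ε hε => ?_
  rw [zero_add]
  set I := ∫ y in Ioo 0 d, ‖w y‖ with hIdef
  -- The final error is ε I / (I + 1) ≤ ε; the added 1 covers I = 0.
  obtain ⟨p, hp⟩ := exists_polynomial_near_of_continuousOn (-1) 1 _ hG (ε / (I + 1)) (by positivity)
  have hgi : Integrable (fun y => (g y : ℂ) * w y) (volume.restrict (Ioo 0 d)) :=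
    integrable_continuous_mul hw hg.continuous
  have hpi : Integrable (fun y => ((p.eval (Real.cos (Real.pi * y / d)) : ℝ) : ℂ) * w y)
      (volume.restrict (Ioo 0 d)) :=
    integrable_continuous_mul hw (F := fun y => p.eval (Real.cos (Real.pi * y / d))) (by fun_prop)
  have h1 : ∫ y in Ioo 0 d, g y • w y =
      ∫ y in Ioo 0 d, ((g y : ℂ) * w y -
        ((p.eval (Real.cos (Real.pi * y / d)) : ℝ) : ℂ) * w y) := by
    rw [integral_sub hgi hpi, hpoly, sub_zero]
    simp only [Complex.real_smul]
  rw [h1]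
  calc _ ≤ ∫ y in Ioo 0 d, ε / (I + 1) * ‖w y‖ := by
        refine norm_integral_le_of_norm_le (hw.norm.const_mul _) ?_
        filter_upwards [ae_restrict_mem measurableSet_Ioo] with y hy
        rw [← sub_mul, norm_mul, ← Complex.ofReal_sub, Complex.norm_real]
        refine mul_le_mul_of_nonneg_right ?_ (norm_nonneg _)
        have h2 := hp (Real.cos (Real.pi * y / d)) ⟨Real.neg_one_le_cos _, Real.cos_le_one _⟩
        have h3 : d / Real.pi * Real.arccos (Real.cos (Real.pi * y / d)) = y := by
          rw [Real.arccos_cos]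
          · field_simp
          · have := hy.1; positivity
          · rw [div_le_iff₀ hd]
            exact mul_le_mul_of_nonneg_left hy.2.le Real.pi_pos.le
        rw [h3] at h2
        rw [Real.norm_eq_abs, abs_sub_comm]
        exact h2.le
    _ = ε * (I / (I + 1)) := by rw [integral_const_mul, ← hIdef]; ring
    _ ≤ ε := by
        refine mul_le_of_le_one_right hε.le ?_
        rw [div_le_one (by positivity)]; linarith

/-- Multiplication by cos(πy/d) maps the span of the e_n into itself, so orthogonality to all e_n
makes every cosine moment of e_n w vanish. One e_n without zeros can then be divided out. -/
theorem ae_eq_zero_of_recurrence {d : ℝ} (hd : 0 < d) {w : ℝ → ℂ}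
    (hw : IntegrableOn w (Ioo 0 d)) (e : ℤ → ℝ → ℝ) (he : ∀ n, Continuous (e n))
    (hrec : ∀ n y, e n y * Real.cos (Real.pi * y / d) = (e (n + 1) y + e (n - 1) y) / 2)
    (h0 : ∀ n, ∫ y in Ioo 0 d, (e n y : ℂ) * w y = 0)
    (n : ℤ) (hne : ∀ y ∈ Ioo 0 d, e n y ≠ 0) :
    w =ᵐ[volume.restrict (Ioo 0 d)] 0 := by
  have key : ∀ m : ℕ, ∀ n,
      ∫ y in Ioo 0 d, ((e n y * Real.cos (Real.pi * y / d) ^ m : ℝ) : ℂ) * w y = 0 := by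
    intro m
    induction m with
    | zero => simpa using h0
    | succ m ih =>
      intro n
      have h1 : ∀ y, ((e n y * Real.cos (Real.pi * y / d) ^ (m + 1) : ℝ) : ℂ) * w y =
          (1 / 2) * (((e (n + 1) y * Real.cos (Real.pi * y / d) ^ m : ℝ) : ℂ) * w y) +
          (1 / 2) * (((e (n - 1) y * Real.cos (Real.pi * y / d) ^ m : ℝ) : ℂ) * w y) := by
        intro y
        have : e n y * Real.cos (Real.pi * y / d) ^ (m + 1) =
            (e (n + 1) y + e (n - 1) y) / 2 * Real.cos (Real.pi * y / d) ^ m := by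
          rw [← hrec]; ring
        rw [this]; push_cast; ring
      simp_rw [h1]
      have hc : ∀ n, Continuous fun y => e n y * Real.cos (Real.pi * y / d) ^ m := fun n =>
        (he n).mul (by fun_prop)
      rw [integral_add ((integrable_continuous_mul hw (hc _)).const_mul _)
        ((integrable_continuous_mul hw (hc _)).const_mul _), integral_const_mul,
        integral_const_mul, ih, ih]
      simp
  have h2 := ae_eq_zero_of_cos_moments hd (w := fun y => (e n y : ℂ) * w y)
    (integrable_continuous_mul hw (he n)) (fun m => by
      rw [← key m n]
      refine integral_congr_ae (ae_of_all _ fun y => ?_)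
      simp only
      push_cast; ring)
  filter_upwards [h2, ae_restrict_mem measurableSet_Ioo] with y hy hy'
  simpa [hne y hy'] using hy

theorem integrableOn_L2 {d : ℝ} (g : L2 d) : IntegrableOn g (Ioo 0 d) :=
  (Lp.memLp g).integrable (by norm_num)

theorem half_angle_mem {d y : ℝ} (hd : 0 < d) (hy : y ∈ Ioo 0 d) :
    0 < Real.pi * y / (2 * d) ∧ Real.pi * y / (2 * d) < Real.pi / 2 := by
  have := hy.1
  have hpi := Real.pi_pos
  refine ⟨by positivity, ?_⟩
  rw [div_lt_div_iff₀ (by positivity) (by positivity)]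
  nlinarith [mul_lt_mul_of_pos_left hy.2 hpi]

/-- The recurrence runs over all integer indices. The reflection n ↦ 1 - n changes the sign of 2n -
1, hence sends a sine mode to its negative and fixes a cosine mode, so nonpositive indices bring no
new functions. -/
theorem int_index_cases (n : ℤ) : (∃ m : ℕ+, n = m) ∨ ∃ m : ℕ+, n = 1 - (m : ℤ) := by
  rcases le_or_gt n 0 with h | h
  · right
    refine ⟨⟨(1 - n).toNat, by omega⟩, ?_⟩
    simp only [PNat.mk_coe]; omega
  · left
    refine ⟨⟨n.toNat, by omega⟩, ?_⟩
    simp only [PNat.mk_coe]; omega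

theorem eq_zero_of_inner_modeMinus {d : ℝ} (hd : 0 < d) (g : L2 d)
    (h : ∀ n, inner ℂ (modeMinus d n) g = 0) : g = 0 := by
  rw [Lp.eq_zero_iff_ae_eq_zero]
  -- Index 1 is the ground mode, which is positive on (0, d).
  refine ae_eq_zero_of_recurrence hd (integrableOn_L2 g)
    (fun n y => Real.sqrt (2 / d) * Real.sin ((2 * (n : ℝ) - 1) * (Real.pi * y / (2 * d))))
    (fun n => by fun_prop) ?_ ?_ 1 ?_
  · intro n y
    have h0 : Real.pi * y / d = 2 * (Real.pi * y / (2 * d)) := by field_simp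
    have h1 : (2 * ((n + 1 : ℤ) : ℝ) - 1) * (Real.pi * y / (2 * d)) =
      (2 * (n : ℝ) - 1) * (Real.pi * y / (2 * d)) + Real.pi * y / d := by
        rw [h0]; push_cast; ring
    have h2 : (2 * ((n - 1 : ℤ) : ℝ) - 1) * (Real.pi * y / (2 * d)) =
      (2 * (n : ℝ) - 1) * (Real.pi * y / (2 * d)) - Real.pi * y / d := by
        rw [h0]; push_cast; ring
    rw [h1, h2, Real.sin_add, Real.sin_sub]; ring
  · intro n
    rcases int_index_cases n with ⟨m, rfl⟩ | ⟨m, rfl⟩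
    · have := h m
      rw [inner_modeMinus] at this
      simpa [chiMinus] using this
    · have := h m
      rw [inner_modeMinus] at this
      have h1 : ∀ y, ((Real.sqrt (2 / d) * Real.sin ((2 * ((1 - (m : ℤ) : ℤ) : ℝ) - 1) *
          (Real.pi * y / (2 * d))) : ℝ) : ℂ) * g y = -((chiMinus d m y : ℂ) * g y) := by
        intro y
        have h2 : (2 * ((1 - (m : ℤ) : ℤ) : ℝ) - 1) * (Real.pi * y / (2 * d)) =
          -((2 * (m : ℝ) - 1) * (Real.pi * y / (2 * d))) := by push_cast; ring
        rw [h2, Real.sin_neg, chiMinus]; push_cast; ring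
      simp_rw [h1]
      rw [integral_neg, this, neg_zero]
  · intro y hy
    obtain ⟨h1, h2⟩ := half_angle_mem hd hy
    refine (mul_pos (Real.sqrt_pos.2 (by positivity)) (Real.sin_pos_of_pos_of_lt_pi ?_ ?_)).ne'
    · push_cast; linarith
    · push_cast; linarith

theorem eq_zero_of_inner_modePlus {d : ℝ} (hd : 0 < d) (g : L2 d)
    (h : ∀ n, inner ℂ (modePlus d n) g = 0) : g = 0 := by
  rw [Lp.eq_zero_iff_ae_eq_zero]
  refine ae_eq_zero_of_recurrence hd (integrableOn_L2 g)
    (fun n y => Real.sqrt (2 / d) * Real.cos ((2 * (n : ℝ) - 1) * (Real.pi * y / (2 * d))))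
    (fun n => by fun_prop) ?_ ?_ 1 ?_
  · intro n y
    have h0 : Real.pi * y / d = 2 * (Real.pi * y / (2 * d)) := by field_simp
    have h1 : (2 * ((n + 1 : ℤ) : ℝ) - 1) * (Real.pi * y / (2 * d)) =
      (2 * (n : ℝ) - 1) * (Real.pi * y / (2 * d)) + Real.pi * y / d := by
        rw [h0]; push_cast; ring
    have h2 : (2 * ((n - 1 : ℤ) : ℝ) - 1) * (Real.pi * y / (2 * d)) =
      (2 * (n : ℝ) - 1) * (Real.pi * y / (2 * d)) - Real.pi * y / d := by
        rw [h0]; push_cast; ring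
    rw [h1, h2, Real.cos_add, Real.cos_sub]; ring
  · intro n
    rcases int_index_cases n with ⟨m, rfl⟩ | ⟨m, rfl⟩
    · have := h m
      rw [inner_modePlus] at this
      simpa [chiPlus] using this
    · have := h m
      rw [inner_modePlus] at this
      have h1 : ∀ y, ((Real.sqrt (2 / d) * Real.cos ((2 * ((1 - (m : ℤ) : ℤ) : ℝ) - 1) *
          (Real.pi * y / (2 * d))) : ℝ) : ℂ) * g y = (chiPlus d m y : ℂ) * g y := by
        intro y
        have h2 : (2 * ((1 - (m : ℤ) : ℤ) : ℝ) - 1) * (Real.pi * y / (2 * d)) =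
          -((2 * (m : ℝ) - 1) * (Real.pi * y / (2 * d))) := by push_cast; ring
        rw [h2, Real.cos_neg, chiPlus]
      simp_rw [h1]
      rw [this]
  · intro y hy
    obtain ⟨h1, h2⟩ := half_angle_mem hd hy
    refine (mul_pos (Real.sqrt_pos.2 (by positivity)) (Real.cos_pos_of_mem_Ioo ⟨?_, ?_⟩)).ne'
    · push_cast; linarith
    · push_cast; linarith

theorem orthogonal_span_eq_bot {H : Type*} [NormedAddCommGroup H] [InnerProductSpace ℂ H]
    {ι : Type*} {v : ι → H} (h : ∀ g, (∀ n, inner ℂ (v n) g = 0) → g = 0) :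
    (Submodule.span ℂ (range v))ᗮ = ⊥ := by
  rw [Submodule.eq_bot_iff]
  intro g hg
  exact h g fun n => (Submodule.mem_orthogonal _ _).1 hg _ (Submodule.subset_span ⟨n, rfl⟩)

/-- The modes `χ⁻_n` as a Hilbert basis of `L²(0,d)`. -/
def basisMinus {d : ℝ} (hd : 0 < d) : HilbertBasis ℕ+ ℂ (L2 d) :=
  HilbertBasis.mkOfOrthogonalEqBot (orthonormal_modeMinus hd)
    (orthogonal_span_eq_bot (eq_zero_of_inner_modeMinus hd))

/-- The modes `χ⁺_n` as a Hilbert basis of `L²(0,d)`. -/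
def basisPlus {d : ℝ} (hd : 0 < d) : HilbertBasis ℕ+ ℂ (L2 d) :=
  HilbertBasis.mkOfOrthogonalEqBot (orthonormal_modePlus hd)
    (orthogonal_span_eq_bot (eq_zero_of_inner_modePlus hd))

theorem coe_basisMinus {d : ℝ} (hd : 0 < d) : ⇑(basisMinus hd) = modeMinus d :=
  HilbertBasis.coe_mkOfOrthogonalEqBot _ _

theorem coe_basisPlus {d : ℝ} (hd : 0 < d) : ⇑(basisPlus hd) = modePlus d :=
  HilbertBasis.coe_mkOfOrthogonalEqBot _ _

/-! ### Sequence spaces and bounded multipliers -/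

/-- Square-summable sequences indexed by the modes. -/
abbrev Seq : Type := lp (fun _ : ℕ+ => ℂ) 2

/-- Bounded sequences indexed by the modes. -/
abbrev BddSeq : Type := lp (fun _ : ℕ+ => ℂ) ∞

/-- The bounded multiplier with the given entries, and `0` if the entries are unbounded. -/
def mkBdd (f : ℕ+ → ℂ) : BddSeq :=
  open Classical in if h : Memℓp f ∞ then ⟨f, h⟩ else 0

theorem mkBdd_apply {f : ℕ+ → ℂ} {C : ℝ} (h : ∀ n, ‖f n‖ ≤ C) (n : ℕ+) : mkBdd f n = f n := by
  have : Memℓp f ∞ := memℓp_infty ⟨C, by rintro _ ⟨n, rfl⟩; exact h n⟩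
  simp [mkBdd, this]

/-- Entrywise derivatives with a common Lipschitz constant bound the Taylor remainder of every entry
by L |l - k|², so differentiability holds in the supremum norm. -/
theorem hasDerivWithinAt_mkBdd {f f' : ℝ → ℕ+ → ℂ} {s : Set ℝ} (hs : Convex ℝ s) {C L : ℝ}
    (hf : ∀ k ∈ s, ∀ n, ‖f k n‖ ≤ C) (hf' : ∀ k ∈ s, ∀ n, ‖f' k n‖ ≤ C)
    (hd : ∀ k ∈ s, ∀ n, HasDerivWithinAt (fun k => f k n) (f' k n) s k)
    (hL : ∀ k ∈ s, ∀ l ∈ s, ∀ n, ‖f' k n - f' l n‖ ≤ L * |k - l|) {k : ℝ} (hk : k ∈ s) :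
    HasDerivWithinAt (fun k => mkBdd (f k)) (mkBdd (f' k)) s k := by
  have hL0 : ∀ l ∈ s, 0 ≤ L * |k - l| := fun l hl => (norm_nonneg _).trans (hL k hk l hl 1)
  rw [hasDerivWithinAt_iff_isLittleO]
  have h1 : (fun l => mkBdd (f l) - mkBdd (f k) - (l - k) • mkBdd (f' k)) =O[𝓝[s] k]
      fun l => (l - k) * (l - k) := by
    refine Asymptotics.IsBigO.of_bound L ?_
    filter_upwards [self_mem_nhdsWithin] with l hl
    have h0 : L * ‖(l - k) * (l - k)‖ = (L * |k - l|) * |l - k| := by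
      rw [norm_mul, Real.norm_eq_abs, abs_sub_comm k l]; ring
    rw [h0]
    refine lp.norm_le_of_forall_le (mul_nonneg (hL0 l hl) (abs_nonneg _)) fun n => ?_
    have h2 : (mkBdd (f l) - mkBdd (f k) - (l - k) • mkBdd (f' k)) n =
        (f l n - l • f' k n) - (f k n - k • f' k n) := by
      simp only [lp.coeFn_sub, lp.coeFn_smul, Pi.sub_apply, Pi.smul_apply,
        mkBdd_apply (hf l hl), mkBdd_apply (hf k hk), mkBdd_apply (hf' k hk), sub_smul]
      abel
    rw [h2]
    have hsub : uIcc k l ⊆ s := by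
      rw [← segment_eq_uIcc]; exact hs.segment_subset hk hl
    have h3 := Convex.norm_image_sub_le_of_norm_hasDerivWithin_le
      (f := fun l => f l n - l • f' k n) (f' := fun l => f' l n - f' k n) (s := uIcc k l)
      (C := L * |k - l|) (x := k) (y := l)
      (fun x hx => by
        have hxs : x ∈ s := hsub hx
        have := ((hd x hxs n).mono hsub).sub
          ((hasDerivWithinAt_id x (uIcc k l)).smul_const (f' k n))
        simpa using! this)
      (fun x hx => by
        have hxs : x ∈ s := hsub hx
        refine (hL x hxs k hk n).trans ?_
        -- The sign of L is not assumed; L |k - l| ≥ 0 forces L ≥ 0 unless k = l.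
        have hL' : 0 ≤ L ∨ |k - l| = 0 := by
          by_contra hcon
          push Not at hcon
          have := hL0 l hl
          have h5 : 0 < |k - l| := lt_of_le_of_ne (abs_nonneg _) (Ne.symm hcon.2)
          nlinarith
        rcases hL' with h | h
        · refine mul_le_mul_of_nonneg_left ?_ h
          rw [abs_sub_comm x k]
          have := abs_sub_left_of_mem_uIcc hx
          rw [abs_sub_comm k x, abs_sub_comm k l]; exact this
        · have hkl : k = l := by linarith [abs_eq_zero.1 h]
          subst hkl
          simp at hx
          simp [hx])
      (convex_uIcc k l) left_mem_uIcc right_mem_uIcc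
    simpa using h3
  refine h1.trans_isLittleO ?_
  have h4 : (fun l : ℝ => l - k) =o[𝓝[s] k] fun _ => (1 : ℝ) := by
    rw [Asymptotics.isLittleO_one_iff]
    have : Tendsto (fun l : ℝ => l - k) (𝓝 k) (𝓝 (k - k)) :=
      (continuous_id.sub continuous_const).tendsto k
    rw [sub_self] at this
    exact this.mono_left nhdsWithin_le_nhds
  simpa using h4.mul_isBigO (Asymptotics.isBigO_refl (fun l : ℝ => l - k) _)

theorem continuousOn_mkBdd {f : ℝ → ℕ+ → ℂ} {s : Set ℝ} {C L : ℝ}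
    (hf : ∀ k ∈ s, ∀ n, ‖f k n‖ ≤ C)
    (hL : ∀ k ∈ s, ∀ l ∈ s, ∀ n, ‖f k n - f l n‖ ≤ L * |k - l|) :
    ContinuousOn (fun k => mkBdd (f k)) s := by
  refine LipschitzOnWith.continuousOn (K := L.toNNReal) (LipschitzOnWith.of_dist_le_mul ?_)
  intro k hk l hl
  have h0 : 0 ≤ L * |k - l| := (norm_nonneg _).trans (hL k hk l hl 1)
  rw [dist_eq_norm, Real.dist_eq]
  refine le_trans (lp.norm_le_of_forall_le h0 fun n => ?_)
    (mul_le_mul_of_nonneg_right (Real.le_coe_toNNReal L) (abs_nonneg _))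
  simp only [lp.coeFn_sub, Pi.sub_apply, mkBdd_apply (hf l hl), mkBdd_apply (hf k hk)]
  exact hL k hk l hl n

/-- Multiplication of square-summable sequences by bounded ones. -/
def diag : BddSeq →L[ℂ] Seq →L[ℂ] Seq :=
  lp.holderL 2 (fun _ : ℕ+ => ContinuousLinearMap.mul ℂ ℂ) (K := 1) (fun _ => by simp)

theorem diag_apply (m : BddSeq) (u : Seq) (n : ℕ+) : diag m u n = m n * u n := rfl

theorem memℓp_two_iff {f : ℕ+ → ℂ} : Memℓp f 2 ↔ Summable fun n => ‖f n‖ ^ 2 := by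
  rw [memℓp_gen_iff (by norm_num)]
  simp

theorem Seq.summable_sq (u : Seq) : Summable fun n => ‖u n‖ ^ 2 := memℓp_two_iff.1 u.2

theorem Seq.hasSum_norm_sq (u : Seq) : HasSum (fun n => ‖u n‖ ^ 2) (‖u‖ ^ 2) := by
  have h := lp.norm_rpow_eq_tsum (p := 2) (by norm_num) u
  simp only [ENNReal.toReal_ofNat, Real.rpow_ofNat] at h
  rw [h]
  exact (Seq.summable_sq u).hasSum

/-- The multiplier `n ↦ 1 / √n`. -/
def invSqrt : BddSeq := mkBdd fun n => (((Real.sqrt n)⁻¹ : ℝ) : ℂ)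

theorem one_le_sqrt (n : ℕ+) : 1 ≤ Real.sqrt n :=
  Real.one_le_sqrt.2 (Nat.one_le_cast.2 n.pos)

theorem sqrt_ne_zero (n : ℕ+) : ((Real.sqrt n : ℝ) : ℂ) ≠ 0 := by
  have := one_le_sqrt n
  exact_mod_cast (by linarith : Real.sqrt n ≠ 0)

theorem sqrt_mul_self (n : ℕ+) : ((Real.sqrt n : ℝ) : ℂ) * (Real.sqrt n : ℝ) = n := by
  rw [← Complex.ofReal_mul, Real.mul_self_sqrt (Nat.cast_nonneg _)]; simp

theorem invSqrt_apply (n : ℕ+) : invSqrt n = (((Real.sqrt n)⁻¹ : ℝ) : ℂ) := by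
  refine mkBdd_apply (C := 1) (fun n => ?_) n
  rw [Complex.norm_real, Real.norm_of_nonneg (by positivity)]
  exact inv_le_one_of_one_le₀ (one_le_sqrt n)

/-! ### Coercive diagonal forms -/

section Compression

variable {V : Type*} [NormedAddCommGroup V] [InnerProductSpace ℂ V] [CompleteSpace V]
  (J J' : V →L[ℂ] Seq)

/-- The compression `J† diag(m) J` of a diagonal operator, as a function of `m`. -/
def compress : BddSeq →L[ℂ] V →L[ℂ] V :=
  ((ContinuousLinearMap.compL ℂ V Seq V (ContinuousLinearMap.adjoint J)) ∘L
    ((ContinuousLinearMap.compL ℂ V Seq Seq).flip J)) ∘L diag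

/-- The form `w ↦ ∑ m_n (|u_n|² + |v_n|²)`, with `u = J w` and `v = J' w`, as an operator
depending linearly on `m`. -/
def formOp : BddSeq →L[ℂ] V →L[ℂ] V := compress J + compress J'

theorem inner_compress (m : BddSeq) (w g : V) :
    inner ℂ (compress J m w) g = inner ℂ (diag m (J w)) (J g) := by
  have : compress J m w = ContinuousLinearMap.adjoint J (diag m (J w)) := rfl
  rw [this, ContinuousLinearMap.adjoint_inner_left]

theorem inner_formOp (m : BddSeq) (w g : V) :
    inner ℂ (formOp J J' m w) g = inner ℂ (diag m (J w)) (J g) +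
      inner ℂ (diag m (J' w)) (J' g) := by
  have : formOp J J' m w = compress J m w + compress J' m w := rfl
  rw [this, inner_add_left, inner_compress, inner_compress]

/-- The inner product is conjugate linear in its first slot, so the entry conj(m_n) appears, and its
Re + Im is Re m_n - Im m_n. This combination is positive both for positive entries and for entries
in -i(0, ∞), the two kinds that occur. -/
theorem le_inner_diag {m : BddSeq} {c : ℝ} (hm : ∀ n, c ≤ (m n).re - (m n).im) (u : Seq) :
    c * ‖u‖ ^ 2 ≤ (inner ℂ (diag m u) u).re + (inner ℂ (diag m u) u).im := by
  have h1 := lp.hasSum_inner (𝕜 := ℂ) (diag m u) u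
  have h2 := (Complex.hasSum_re h1).add (Complex.hasSum_im h1)
  refine hasSum_le (fun n => ?_) ((Seq.hasSum_norm_sq u).mul_left c) h2
  have h3 : inner ℂ (diag m u n) (u n) = (starRingEnd ℂ) (m n) * ((‖u n‖ ^ 2 : ℝ) : ℂ) := by
    rw [diag_apply, RCLike.inner_apply, map_mul, mul_comm, mul_assoc, Complex.conj_mul']
    push_cast; rfl
  rw [h3, Complex.re_mul_ofReal, Complex.im_mul_ofReal, Complex.conj_re, Complex.conj_im]
  nlinarith [hm n, sq_nonneg ‖u n‖]

/-- Lax–Milgram. Since Re z + Im z ≤ 2‖z‖, the coercivity constant for the modulus of the form is c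
/ 2. -/
theorem isUnit_formOp (hJ : ∀ w, ‖w‖ ^ 2 = ‖J w‖ ^ 2 + ‖J' w‖ ^ 2) {m : BddSeq} {c : ℝ} (hc : 0 < c) (hm : ∀ n, c ≤ (m n).re - (m n).im) :
    IsUnit (formOp J J' m) := by
  refine ContinuousLinearMap.isUnit_of_forall_le_norm_inner_map _
    (c := (c / 2).toNNReal) (Real.toNNReal_pos.2 (half_pos hc)) fun w => ?_
  rw [inner_formOp, hJ]
  set z₁ := inner ℂ (diag m (J w)) (J w)
  set z₂ := inner ℂ (diag m (J' w)) (J' w)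
  have h1 : c * ‖J w‖ ^ 2 ≤ z₁.re + z₁.im := le_inner_diag hm _
  have h2 : c * ‖J' w‖ ^ 2 ≤ z₂.re + z₂.im := le_inner_diag hm _
  have h3 := Complex.re_le_norm (z₁ + z₂)
  have h4 := (le_abs_self _).trans (Complex.abs_im_le_norm (z₁ + z₂))
  simp only [Complex.add_re, Complex.add_im] at h3 h4
  rw [Real.coe_toNNReal _ (half_pos hc).le]
  linarith

end Compression

/-! ### The space of traces at the interface -/

section Form

variable {X : Type*} [NormedAddCommGroup X] [InnerProductSpace ℂ X]
  (b b' : HilbertBasis ℕ+ ℂ X)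

/-- The map `(u, v) ↦ ∑ (u_n / √n) b_n - ∑ (v_n / √n) b'_n`. -/
def traceDiff : WithLp 2 (Seq × Seq) →L[ℂ] X :=
  (b.repr.symm.toContinuousLinearEquiv : Seq →L[ℂ] X) ∘L diag invSqrt ∘L
      WithLp.fstL 2 ℂ Seq Seq -
    (b'.repr.symm.toContinuousLinearEquiv : Seq →L[ℂ] X) ∘L diag invSqrt ∘L
      WithLp.sndL 2 ℂ Seq Seq

/-- The space of pairs of weighted coefficient sequences, with respect to two bases, of the same
vector. -/
def traceSpace : Submodule ℂ (WithLp 2 (Seq × Seq)) :=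
  LinearMap.ker (traceDiff b b' : WithLp 2 (Seq × Seq) →ₗ[ℂ] X)

/-- Weighted coefficients in the first basis. -/
def coeffFst : traceSpace b b' →L[ℂ] Seq :=
  WithLp.fstL 2 ℂ Seq Seq ∘L (traceSpace b b').subtypeL

/-- Weighted coefficients in the second basis. -/
def coeffSnd : traceSpace b b' →L[ℂ] Seq :=
  WithLp.sndL 2 ℂ Seq Seq ∘L (traceSpace b b').subtypeL

theorem norm_sq_eq (w : traceSpace b b') :
    ‖w‖ ^ 2 = ‖coeffFst b b' w‖ ^ 2 + ‖coeffSnd b b' w‖ ^ 2 := by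
  exact WithLp.prod_norm_sq_eq_of_L2 (w : WithLp 2 (Seq × Seq))

instance : CompleteSpace (traceSpace b b') := by
  refine IsClosed.completeSpace_coe (hs := ?_)
  exact (traceDiff b b').isClosed_ker

end Form

/-! ### Dependence of the inverse operator on a parameter -/

section Inverse

variable {V : Type*} [NormedAddCommGroup V] [NormedSpace ℂ V] [CompleteSpace V]

theorem hasDerivWithinAt_inverse_apply {B B' : ℝ → V →L[ℂ] V} {s : Set ℝ} {k : ℝ}
    (hB : HasDerivWithinAt B (B' k) s k) (hu : IsUnit (B k)) (f : V) :
    HasDerivWithinAt (fun k => Ring.inverse (B k) f)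
      (-(Ring.inverse (B k) (B' k (Ring.inverse (B k) f)))) s k := by
  obtain ⟨U, hU⟩ := hu
  have h1 : HasFDerivAt Ring.inverse _ (B k) := hU ▸ hasFDerivAt_ringInverse (𝕜 := ℝ) U
  have h2 := h1.comp_hasDerivWithinAt k hB
  have h3 := ((ContinuousLinearMap.apply ℂ V f).restrictScalars ℝ).hasFDerivAt.comp_hasDerivWithinAt
    k h2
  refine h3.congr_deriv ?_
  rw [← hU, Ring.inverse_unit]
  rfl

theorem continuousOn_inverse {B : ℝ → V →L[ℂ] V} {s : Set ℝ}
    (hB : ContinuousOn B s) (hu : ∀ k ∈ s, IsUnit (B k)) :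
    ContinuousOn (fun k => Ring.inverse (B k)) s := by
  intro k hk
  obtain ⟨U, hU⟩ := hu k hk
  have h1 : ContinuousAt Ring.inverse (B k) := hU ▸ NormedRing.inverse_continuousAt U
  exact ContinuousAt.comp_continuousWithinAt h1 (hB k hk)

end Inverse

/-! ### Uniform estimates for the longitudinal rates -/

/-- The momentum window `[α, β]` lies strictly between the thresholds of the modes `N` and
`N + 1`. -/
structure Gap (d : ℝ) (n₀ N : ℕ+) (α β : ℝ) : Prop where
  d_pos : 0 < d
  le : n₀ ≤ N
  α_pos : 0 < α
  lt : α < β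
  lower : mu d N - mu d n₀ < α ^ 2
  upper : β ^ 2 < mu d (N + 1) - mu d n₀

/-- `k_n` for `n ≤ N` and `κ_n` for `n > N`. -/
def rate (d : ℝ) (n₀ N : ℕ+) (k : ℝ) (n : ℕ+) : ℝ :=
  if n ≤ N then momentum d n₀ k n else decay d n₀ k n

/-- `-i` for `n ≤ N` and `1` for `n > N`. -/
def modePhase (N n : ℕ+) : ℂ := if n ≤ N then -Complex.I else 1

/-- `1` for `n ≤ N` and `-1` for `n > N`. -/
def modeSign (N n : ℕ+) : ℝ := if n ≤ N then 1 else -1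

theorem rate_eq (d : ℝ) (n₀ N : ℕ+) (k : ℝ) (n : ℕ+) :
    rate d n₀ N k n = Real.sqrt (modeSign N n * (k ^ 2 - (mu d n - mu d n₀))) := by
  unfold rate modeSign momentum decay
  split_ifs <;> congr 1 <;> ring

theorem norm_modePhase (N n : ℕ+) : ‖modePhase N n‖ = 1 := by
  unfold modePhase; split_ifs <;> simp

theorem abs_modeSign (N n : ℕ+) : |modeSign N n| = 1 := by
  unfold modeSign; split_ifs <;> simp

theorem one_le_cast (n : ℕ+) : (1 : ℝ) ≤ (n : ℝ) := Nat.one_le_cast.2 n.pos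

theorem mu_eq (d : ℝ) (n : ℕ+) : mu d n = Real.pi ^ 2 / d ^ 2 * ((n : ℝ) - 1 / 2) ^ 2 := by
  unfold mu
  by_cases h : d = 0
  · simp [h]
  · field_simp; ring

theorem mu_mono (d : ℝ) {n m : ℕ+} (h : n ≤ m) : mu d n ≤ mu d m := by
  rw [mu_eq, mu_eq]
  have h1 : (n : ℝ) ≤ m := by exact_mod_cast h
  have := one_le_cast n
  refine mul_le_mul_of_nonneg_left ?_ (by positivity)
  exact pow_le_pow_left₀ (by linarith) (by linarith) 2

theorem mu_nonneg (d : ℝ) (n : ℕ+) : 0 ≤ mu d n := by rw [mu_eq]; positivity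

/-- The set of propagating modes does not change over the window. Multiplying the two floor
inequalities by π²/d² turns them into the threshold inequalities of `Gap`. -/
theorem topMode_eq {d : ℝ} {n₀ N : ℕ+} {α β : ℝ} (h : Gap d n₀ N α β) {k : ℝ}
    (hk : k ∈ Icc α β) : topMode d n₀ k = N := by
  apply PNat.eq
  have hd := h.d_pos
  have hα := h.α_pos
  have hpi := Real.pi_pos
  have hN := one_le_cast N
  change ⌊_⌋₊ = (N : ℕ)
  have h1 := h.lower
  have h2 := h.upper
  rw [mu_eq, mu_eq] at h1 h2
  have h3 : α ^ 2 ≤ k ^ 2 := pow_le_pow_left₀ hα.le hk.1 2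
  have h4 : k ^ 2 ≤ β ^ 2 := pow_le_pow_left₀ (hα.le.trans hk.1) hk.2 2
  have hq : 0 < Real.pi ^ 2 / d ^ 2 := by positivity
  have e : k ^ 2 = Real.pi ^ 2 / d ^ 2 * (d ^ 2 / Real.pi ^ 2 * k ^ 2) := by field_simp
  rw [Nat.floor_eq_iff (by positivity)]
  constructor
  · have : (N : ℝ) - 1 / 2 ≤ Real.sqrt (((n₀ : ℝ) - 1 / 2) ^ 2 + d ^ 2 / Real.pi ^ 2 * k ^ 2) := by
      apply Real.le_sqrt_of_sq_le
      refine le_of_mul_le_mul_left ?_ hq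
      rw [mul_add, ← e]; linarith
    linarith
  · have : Real.sqrt (((n₀ : ℝ) - 1 / 2) ^ 2 + d ^ 2 / Real.pi ^ 2 * k ^ 2) < (N : ℝ) + 1 / 2 := by
      rw [Real.sqrt_lt' (by positivity)]
      refine lt_of_mul_lt_mul_left ?_ hq.le
      rw [mul_add, ← e]
      have : (((N + 1 : ℕ+) : ℕ) : ℝ) - 1 / 2 = (N : ℝ) + 1 / 2 := by push_cast; ring
      rw [this] at h2
      linarith
    linarith

/-- The worst propagating mode is N, whose gap to α² gives c₁. For n > N the quantity A = μ_{n₀} +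
β² is at most the fraction A / μ_{N+1} < 1 of μ_n, and n - 1/2 ≥ n/2 makes μ_n quadratic in n; this
gives c₂. -/
theorem exists_mul_sq_le {d : ℝ} {n₀ N : ℕ+} {α β : ℝ} (h : Gap d n₀ N α β) :
    ∃ c > 0, ∀ k ∈ Icc α β, ∀ n : ℕ+,
      (c * n) ^ 2 ≤ modeSign N n * (k ^ 2 - (mu d n - mu d n₀)) := by
  have hd := h.d_pos
  have hα := h.α_pos
  have hpi := Real.pi_pos
  have hβ : 0 < β := hα.trans h.lt
  have hN := one_le_cast N
  set A := mu d n₀ + β ^ 2 with hA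
  have hA0 : 0 < A := by have := mu_nonneg d n₀; positivity
  have hA1 : A < mu d (N + 1) := by have := h.upper; linarith
  set c₁ := (α ^ 2 - (mu d N - mu d n₀)) / (N : ℝ) ^ 2
  have hc₁ : 0 < c₁ := div_pos (by have := h.lower; linarith) (by positivity)
  set c₂ := Real.pi ^ 2 / d ^ 2 / 4 * (1 - A / mu d (N + 1))
  have hc₂ : 0 < c₂ := by
    refine mul_pos (by positivity) (sub_pos.2 ?_)
    rwa [div_lt_one (hA0.trans hA1)]
  refine ⟨Real.sqrt (min c₁ c₂), Real.sqrt_pos.2 (lt_min hc₁ hc₂), fun k hk n => ?_⟩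
  have h3 : α ^ 2 ≤ k ^ 2 := pow_le_pow_left₀ hα.le hk.1 2
  have h4 : k ^ 2 ≤ β ^ 2 := pow_le_pow_left₀ (hα.le.trans hk.1) hk.2 2
  have hn := one_le_cast n
  rw [mul_pow, Real.sq_sqrt (lt_min hc₁ hc₂).le]
  unfold modeSign
  split_ifs with hnN
  · have h5 := mu_mono d hnN
    have h6 : (n : ℝ) ^ 2 ≤ (N : ℝ) ^ 2 :=
      pow_le_pow_left₀ (by positivity) (by exact_mod_cast hnN) 2
    calc min c₁ c₂ * (n : ℝ) ^ 2 ≤ c₁ * (N : ℝ) ^ 2 := by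
          gcongr
          exact min_le_left _ _
      _ = α ^ 2 - (mu d N - mu d n₀) := by simp only [c₁]; field_simp
      _ ≤ _ := by linarith
  · have h5 : mu d (N + 1) ≤ mu d n := mu_mono d (by
      rw [PNat.add_one_le_iff]; exact not_le.1 hnN)
    have h6 : A ≤ A / mu d (N + 1) * mu d n := by
      rw [div_mul_eq_mul_div, le_div_iff₀ (hA0.trans hA1)]
      exact mul_le_mul_of_nonneg_left h5 hA0.le
    have h7 : Real.pi ^ 2 / d ^ 2 / 4 * (n : ℝ) ^ 2 ≤ mu d n := by
      rw [mu_eq, div_mul_eq_mul_div _ (4 : ℝ), mul_div_assoc]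
      refine mul_le_mul_of_nonneg_left ?_ (by positivity)
      nlinarith
    calc min c₁ c₂ * (n : ℝ) ^ 2 ≤ c₂ * (n : ℝ) ^ 2 := by
          gcongr
          exact min_le_right _ _
      _ = Real.pi ^ 2 / d ^ 2 / 4 * (n : ℝ) ^ 2 * (1 - A / mu d (N + 1)) := by
          simp only [c₂]; ring
      _ ≤ mu d n * (1 - A / mu d (N + 1)) := by
          refine mul_le_mul_of_nonneg_right h7 (sub_nonneg.2 ?_)
          rw [div_le_one (hA0.trans hA1)]; exact hA1.le
      _ ≤ _ := by nlinarith

theorem exists_le_rate {d : ℝ} {n₀ N : ℕ+} {α β : ℝ} (h : Gap d n₀ N α β) :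
    ∃ c > 0, ∀ k ∈ Icc α β, ∀ n : ℕ+, c * n ≤ rate d n₀ N k n := by
  obtain ⟨c, hc, H⟩ := exists_mul_sq_le h
  refine ⟨c, hc, fun k hk n => ?_⟩
  rw [rate_eq]
  exact Real.le_sqrt_of_sq_le (H k hk n)

theorem exists_rate_le {d : ℝ} {n₀ N : ℕ+} {α β : ℝ} (h : Gap d n₀ N α β) :
    ∃ C, ∀ k ∈ Icc α β, ∀ n : ℕ+, rate d n₀ N k n ≤ C * n := by
  refine ⟨Real.sqrt (β ^ 2 + Real.pi ^ 2 / d ^ 2 + mu d n₀), fun k hk n => ?_⟩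
  have hα := h.α_pos
  have h4 : k ^ 2 ≤ β ^ 2 := pow_le_pow_left₀ (hα.le.trans hk.1) hk.2 2
  have hn := one_le_cast n
  have h0 := mu_nonneg d n₀
  have h1 : mu d n ≤ Real.pi ^ 2 / d ^ 2 * (n : ℝ) ^ 2 := by
    rw [mu_eq]
    refine mul_le_mul_of_nonneg_left ?_ (by positivity)
    nlinarith
  have h2 : (1 : ℝ) ≤ (n : ℝ) ^ 2 := one_le_pow₀ hn
  have h3 : (n : ℝ) = Real.sqrt ((n : ℝ) ^ 2) := (Real.sqrt_sq (by positivity)).symm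
  rw [rate_eq]
  conv_rhs => rw [h3]
  rw [← Real.sqrt_mul (by positivity)]
  refine Real.sqrt_le_sqrt ((le_abs_self _).trans ?_)
  rw [abs_mul, abs_modeSign, one_mul]
  have h5 := mu_nonneg d n
  have h6 : 0 ≤ Real.pi ^ 2 / d ^ 2 := by positivity
  rw [abs_le]
  constructor <;> nlinarith [sq_nonneg k, mul_le_mul_of_nonneg_left h2 (sq_nonneg β),
    mul_le_mul_of_nonneg_left h2 h0]

theorem hasDerivAt_rate {d : ℝ} {n₀ N : ℕ+} {k : ℝ} {n : ℕ+} (hr : 0 < rate d n₀ N k n) :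
    HasDerivAt (fun k => rate d n₀ N k n) (modeSign N n * (k / rate d n₀ N k n)) k := by
  have h1 : modeSign N n * (k ^ 2 - (mu d n - mu d n₀)) ≠ 0 := by
    rw [rate_eq, Real.sqrt_pos] at hr
    exact hr.ne'
  have h2 : HasDerivAt (fun k : ℝ => modeSign N n * (k ^ 2 - (mu d n - mu d n₀)))
      (modeSign N n * (2 * k)) k := by
    simpa using (((hasDerivAt_id k).pow 2).sub_const (mu d n - mu d n₀)).const_mul (modeSign N n)
  have h3 := h2.sqrt h1
  simp_rw [← rate_eq] at h3
  refine h3.congr_deriv ?_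
  field_simp

theorem hasDerivAt_div_rate {d : ℝ} {n₀ N : ℕ+} {k : ℝ} {n : ℕ+} (hr : 0 < rate d n₀ N k n) :
    HasDerivAt (fun k => k / rate d n₀ N k n)
      (1 / rate d n₀ N k n - modeSign N n * (k ^ 2 / rate d n₀ N k n ^ 3)) k := by
  refine ((hasDerivAt_id k).div (hasDerivAt_rate hr) hr.ne').congr_deriv ?_
  simp only [id]
  field_simp

theorem continuous_rate (d : ℝ) (n₀ N : ℕ+) (n : ℕ+) : Continuous fun k => rate d n₀ N k n := by
  simp_rw [rate_eq]; fun_prop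

/-- The bound is independent of n. It controls both the Lipschitz constant of the differentiated
multiplier and the second derivative of the phase of a packet. -/
theorem abs_deriv_div_rate_le {d : ℝ} {n₀ N : ℕ+} {α β c : ℝ} (h : Gap d n₀ N α β) (hc : 0 < c)
    (hr : ∀ k ∈ Icc α β, ∀ n : ℕ+, c * n ≤ rate d n₀ N k n) {k : ℝ} (hk : k ∈ Icc α β) (n : ℕ+) :
    |1 / rate d n₀ N k n - modeSign N n * (k ^ 2 / rate d n₀ N k n ^ 3)| ≤
      1 / c + β ^ 2 / c ^ 3 := by
  have hα := h.α_pos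
  have h4 : k ^ 2 ≤ β ^ 2 := pow_le_pow_left₀ (hα.le.trans hk.1) hk.2 2
  have h1 : c ≤ rate d n₀ N k n :=
    (le_mul_of_one_le_right hc.le (one_le_cast n)).trans (hr k hk n)
  have h2 : 0 < rate d n₀ N k n := hc.trans_le h1
  refine (abs_sub _ _).trans ?_
  rw [abs_mul, abs_modeSign, one_mul, abs_of_nonneg (by positivity), abs_of_nonneg (by positivity)]
  gcongr

/-! ### The multiplier of the matching condition -/

section Multiplier

variable (d : ℝ) (n₀ N : ℕ+)

/-- The multiplier `n ↦ σ_n / n`, with `σ_n = -i k_n` for `n ≤ N` and `σ_n = κ_n` for `n > N`. -/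
def mult (k : ℝ) (n : ℕ+) : ℂ := modePhase N n * ((rate d n₀ N k n / n : ℝ) : ℂ)

/-- The derivative of `mult` with respect to `k`. -/
def multDeriv (k : ℝ) (n : ℕ+) : ℂ :=
  modePhase N n * ((modeSign N n * (k / rate d n₀ N k n) / n : ℝ) : ℂ)

end Multiplier

section MultiplierBounds

variable {d : ℝ} {n₀ N : ℕ+} {α β : ℝ}

theorem exists_norm_mult_le (h : Gap d n₀ N α β) :
    ∃ C, ∀ k ∈ Icc α β, ∀ n : ℕ+, ‖mult d n₀ N k n‖ ≤ C := by
  obtain ⟨C, hC⟩ := exists_rate_le h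
  obtain ⟨c, hc, H⟩ := exists_le_rate h
  refine ⟨C, fun k hk n => ?_⟩
  have hn := one_le_cast n
  have h1 : 0 ≤ rate d n₀ N k n := (by positivity : 0 ≤ c * (n : ℝ)).trans (H k hk n)
  rw [mult, norm_mul, norm_modePhase, one_mul, Complex.norm_real, Real.norm_of_nonneg
    (by positivity), div_le_iff₀ (by positivity)]
  exact hC k hk n

theorem exists_norm_multDeriv_le (h : Gap d n₀ N α β) :
    ∃ C, ∀ k ∈ Icc α β, ∀ n : ℕ+, ‖multDeriv d n₀ N k n‖ ≤ C := by
  obtain ⟨c, hc, H⟩ := exists_le_rate h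
  refine ⟨β / c, fun k hk n => ?_⟩
  have hα := h.α_pos
  have hk0 : 0 < k := hα.trans_le hk.1
  have hn := one_le_cast n
  have h1 : c ≤ rate d n₀ N k n := (le_mul_of_one_le_right hc.le hn).trans (H k hk n)
  have h2 : 0 < rate d n₀ N k n := hc.trans_le h1
  rw [multDeriv, norm_mul, norm_modePhase, one_mul, Complex.norm_real, Real.norm_eq_abs,
    abs_div, abs_mul, abs_modeSign, one_mul, abs_of_nonneg (by positivity : 0 ≤ k / _),
    abs_of_nonneg (by positivity : (0 : ℝ) ≤ n)]
  refine (div_le_self (by positivity) hn).trans ?_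
  exact div_le_div₀ (hk0.le.trans hk.2) hk.2 hc h1

theorem exists_lipschitz_multDeriv (h : Gap d n₀ N α β) :
    ∃ L, ∀ k ∈ Icc α β, ∀ l ∈ Icc α β, ∀ n : ℕ+,
      ‖multDeriv d n₀ N k n - multDeriv d n₀ N l n‖ ≤ L * |k - l| := by
  obtain ⟨c, hc, H⟩ := exists_le_rate h
  refine ⟨1 / c + β ^ 2 / c ^ 3, fun k hk l hl n => ?_⟩
  have hn := one_le_cast n
  have hpos : ∀ x ∈ Icc α β, 0 < rate d n₀ N x n := fun x hx =>
    (by positivity : 0 < c * (n : ℝ)).trans_le (H x hx n)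
  have h1 := Convex.norm_image_sub_le_of_norm_hasDerivWithin_le
    (f := fun k => k / rate d n₀ N k n) (x := l) (y := k)
    (fun x hx => (hasDerivAt_div_rate (hpos x hx)).hasDerivWithinAt)
    (fun x hx => abs_deriv_div_rate_le h hc H hx n) (convex_Icc α β) hl hk
  rw [multDeriv, multDeriv, ← mul_sub, norm_mul, norm_modePhase, one_mul, ← Complex.ofReal_sub,
    Complex.norm_real, ← sub_div, ← mul_sub, Real.norm_eq_abs, abs_div, abs_mul, abs_modeSign,
    one_mul, abs_of_nonneg (by positivity : (0 : ℝ) ≤ n)]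
  exact (div_le_self (abs_nonneg _) hn).trans h1

theorem hasDerivAt_mult {k : ℝ} {n : ℕ+} (hr : 0 < rate d n₀ N k n) :
    HasDerivAt (fun k => mult d n₀ N k n) (multDeriv d n₀ N k n) k :=
  (((hasDerivAt_rate hr).div_const (n : ℝ)).ofReal_comp).const_mul _

theorem exists_le_mult (h : Gap d n₀ N α β) :
    ∃ c > 0, ∀ k ∈ Icc α β, ∀ n : ℕ+, c ≤ (mult d n₀ N k n).re - (mult d n₀ N k n).im := by
  obtain ⟨c, hc, H⟩ := exists_le_rate h
  refine ⟨c, hc, fun k hk n => ?_⟩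
  have hn := one_le_cast n
  have h1 : c ≤ rate d n₀ N k n / n := by
    rw [le_div_iff₀ (by positivity)]; exact H k hk n
  unfold mult modePhase
  rw [Complex.re_mul_ofReal, Complex.im_mul_ofReal]
  split_ifs <;> simpa using h1

/-- The multiplier as a bounded sequence is continuously differentiable in `k`. -/
theorem hasDerivWithinAt_mkBdd_mult (h : Gap d n₀ N α β) {k : ℝ} (hk : k ∈ Icc α β) :
    HasDerivWithinAt (fun k => mkBdd (mult d n₀ N k)) (mkBdd (multDeriv d n₀ N k))
      (Icc α β) k := by
  obtain ⟨C, hC⟩ := exists_norm_mult_le h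
  obtain ⟨C', hC'⟩ := exists_norm_multDeriv_le h
  obtain ⟨L, hL⟩ := exists_lipschitz_multDeriv h
  obtain ⟨c, hc, H⟩ := exists_le_rate h
  exact hasDerivWithinAt_mkBdd (convex_Icc α β) (C := max C C')
    (fun k hk n => (hC k hk n).trans (le_max_left _ _))
    (fun k hk n => (hC' k hk n).trans (le_max_right _ _))
    (fun k hk n => (hasDerivAt_mult ((mul_pos hc (by
      have := one_le_cast n; positivity)).trans_le (H k hk n))).hasDerivWithinAt) hL hk

theorem continuousOn_mkBdd_multDeriv (h : Gap d n₀ N α β) :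
    ContinuousOn (fun k => mkBdd (multDeriv d n₀ N k)) (Icc α β) := by
  obtain ⟨C', hC'⟩ := exists_norm_multDeriv_le h
  obtain ⟨L, hL⟩ := exists_lipschitz_multDeriv h
  exact continuousOn_mkBdd hC' hL

theorem mkBdd_mult_apply (h : Gap d n₀ N α β) {k : ℝ} (hk : k ∈ Icc α β) (n : ℕ+) :
    mkBdd (mult d n₀ N k) n = mult d n₀ N k n := by
  obtain ⟨C, hC⟩ := exists_norm_mult_le h
  exact mkBdd_apply (hC k hk) n

end MultiplierBounds

/-! ### The variational problem and its smooth dependence on momentum -/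

section Solution

variable {V : Type*} [NormedAddCommGroup V] [InnerProductSpace ℂ V] [CompleteSpace V]
  (J J' : V →L[ℂ] Seq) (d : ℝ) (n₀ N : ℕ+)

/-- The operator of the matching condition at momentum `k`. -/
def matchOp (k : ℝ) : V →L[ℂ] V := formOp J J' (mkBdd (mult d n₀ N k))

/-- The right-hand side of the matching condition, divided by `k`. -/
def source : V := ContinuousLinearMap.adjoint J
  (lp.single 2 n₀ (-(2 * Complex.I) * (((Real.sqrt n₀)⁻¹ : ℝ) : ℂ)))

/-- The solution of the matching condition. -/
def solution (k : ℝ) : V := k • Ring.inverse (matchOp J J' d n₀ N k) (source J n₀)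

variable {d n₀ N} {α β : ℝ}

theorem isUnit_matchOp (hJ : ∀ w, ‖w‖ ^ 2 = ‖J w‖ ^ 2 + ‖J' w‖ ^ 2) (h : Gap d n₀ N α β)
    {k : ℝ} (hk : k ∈ Icc α β) : IsUnit (matchOp J J' d n₀ N k) := by
  obtain ⟨c, hc, H⟩ := exists_le_mult h
  refine isUnit_formOp J J' hJ hc fun n => ?_
  rw [mkBdd_mult_apply h hk]
  exact H k hk n

theorem matchOp_eq_iff (hJ : ∀ w, ‖w‖ ^ 2 = ‖J w‖ ^ 2 + ‖J' w‖ ^ 2) (h : Gap d n₀ N α β)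
    {k : ℝ} (hk : k ∈ Icc α β) (w : V) :
    matchOp J J' d n₀ N k w = k • source J n₀ ↔ w = solution J J' d n₀ N k := by
  have hu := isUnit_matchOp J J' hJ h hk
  have h1 := Ring.inverse_mul_cancel _ hu
  have h2 := Ring.mul_inverse_cancel _ hu
  constructor
  · intro hw
    have : Ring.inverse (matchOp J J' d n₀ N k) (matchOp J J' d n₀ N k w) = w := by
      rw [← mul_apply_eq_comp, h1]; rfl
    rw [← this, hw, solution]
    exact ((Ring.inverse (matchOp J J' d n₀ N k)).restrictScalars ℝ).map_smul k _
  · rintro rfl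
    rw [solution]
    have : matchOp J J' d n₀ N k (Ring.inverse (matchOp J J' d n₀ N k) (source J n₀)) =
        source J n₀ := by
      rw [← mul_apply_eq_comp, h2]; rfl
    exact (((matchOp J J' d n₀ N k).restrictScalars ℝ).map_smul k _).trans
      (congrArg (k • ·) this)

/-- The operator depends linearly and continuously on a multiplier that is C¹ in ℓ^∞, and coercivity
keeps it invertible on the whole window. The derivative of the inverse is -B⁻¹ B' B⁻¹. -/
theorem exists_deriv_solution (hJ : ∀ w, ‖w‖ ^ 2 = ‖J w‖ ^ 2 + ‖J' w‖ ^ 2)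
    (h : Gap d n₀ N α β) : ∃ w' : ℝ → V, ContinuousOn w' (Icc α β) ∧
      ∀ k ∈ Icc α β, HasDerivWithinAt (solution J J' d n₀ N) (w' k) (Icc α β) k := by
  set B' : ℝ → V →L[ℂ] V := fun k => formOp J J' (mkBdd (multDeriv d n₀ N k)) with hB'
  have hB : ∀ k ∈ Icc α β, HasDerivWithinAt (matchOp J J' d n₀ N) (B' k) (Icc α β) k := by
    intro k hk
    exact ((formOp J J').restrictScalars ℝ).hasFDerivAt.comp_hasDerivWithinAt k
      (hasDerivWithinAt_mkBdd_mult h hk)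
  have hB'c : ContinuousOn B' (Icc α β) :=
    (formOp J J').continuous.comp_continuousOn (continuousOn_mkBdd_multDeriv h)
  have hu : ∀ k ∈ Icc α β, IsUnit (matchOp J J' d n₀ N k) := fun k hk =>
    isUnit_matchOp J J' hJ h hk
  have hinv : ContinuousOn (fun k => Ring.inverse (matchOp J J' d n₀ N k)) (Icc α β) :=
    continuousOn_inverse (fun k hk => (hB k hk).continuousWithinAt) hu
  have hv : ContinuousOn (fun k => Ring.inverse (matchOp J J' d n₀ N k) (source J n₀))
      (Icc α β) := hinv.clm_apply continuousOn_const
  refine ⟨_, ?_, fun k hk => (hasDerivWithinAt_id k _).smul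
    (hasDerivWithinAt_inverse_apply (hB k hk) (hu k hk) (source J n₀))⟩
  exact (continuousOn_id.smul (hinv.clm_apply (hB'c.clm_apply hv)).neg).add
    (continuousOn_const.smul hv)

theorem inner_source (k : ℝ) (g : V) : inner ℂ (k • source J n₀) g =
    k * inner ℂ (lp.single 2 n₀ (-(2 * Complex.I) * (((Real.sqrt n₀)⁻¹ : ℝ) : ℂ)) : Seq) (J g) := by
  have : k • source J n₀ = (k : ℂ) • source J n₀ := (Complex.coe_smul k _).symm
  rw [this, inner_smul_left, Complex.conj_ofReal, source, ContinuousLinearMap.adjoint_inner_left]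

/-- The weak form, in which the derivative matching condition will appear. -/
theorem eq_solution_iff (hJ : ∀ w, ‖w‖ ^ 2 = ‖J w‖ ^ 2 + ‖J' w‖ ^ 2) (h : Gap d n₀ N α β)
    {k : ℝ} (hk : k ∈ Icc α β) (w : V) :
    w = solution J J' d n₀ N k ↔ ∀ g,
      inner ℂ (diag (mkBdd (mult d n₀ N k)) (J w)) (J g) +
        inner ℂ (diag (mkBdd (mult d n₀ N k)) (J' w)) (J' g) =
      k * inner ℂ (lp.single 2 n₀ (-(2 * Complex.I) * (((Real.sqrt n₀)⁻¹ : ℝ) : ℂ)) : Seq)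
        (J g) := by
  rw [← matchOp_eq_iff J J' hJ h hk]
  simp only [← inner_source, ← inner_formOp]
  exact ⟨fun hw g => congrArg (fun x => inner ℂ x g) hw, fun hw => ext_inner_right ℂ hw⟩

theorem exists_deriv_coeff_solution (hJ : ∀ w, ‖w‖ ^ 2 = ‖J w‖ ^ 2 + ‖J' w‖ ^ 2)
    (h : Gap d n₀ N α β) (P : V →L[ℂ] Seq) :
    ContinuousOn (fun k => P (solution J J' d n₀ N k)) (Icc α β) ∧
    ∃ u' : ℝ → Seq, ContinuousOn u' (Icc α β) ∧ ∀ k ∈ Icc α β, ∀ n,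
      HasDerivWithinAt (fun k => P (solution J J' d n₀ N k) n) (u' k n) (Icc α β) k := by
  obtain ⟨w', hw', H⟩ := exists_deriv_solution J J' hJ h
  refine ⟨P.continuous.comp_continuousOn fun k hk => (H k hk).continuousWithinAt,
    fun k => P (w' k), P.continuous.comp_continuousOn hw', fun k hk n => ?_⟩
  have h1 := ((lp.evalCLM ℂ (fun _ : ℕ+ => ℂ) 2 n ∘L P).restrictScalars
    ℝ).hasFDerivAt.comp_hasDerivWithinAt k (H k hk)
  exact h1

end Solution

/-! ### Equivalence of the matching conditions with the variational problem -/

theorem inner_of_hasSum {X ι : Type*} [NormedAddCommGroup X] [InnerProductSpace ℂ X] {e : ι → X}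
    (he : Orthonormal ℂ e) {c : ι → ℂ} {x : X} (h : HasSum (fun n => c n • e n) x) (n : ι) :
    inner ℂ (e n) x = c n := by
  classical
  have h1 := (innerSL ℂ (e n)).hasSum h
  have h2 : (fun m => innerSL ℂ (e n) (c m • e m)) = fun m => if m = n then c n else 0 := by
    funext m
    rw [innerSL_apply_apply, inner_smul_right, orthonormal_iff_ite.1 he]
    by_cases hm : m = n
    · simp [hm]
    · simp [hm, Ne.symm hm]
  rw [h2] at h1
  exact h1.unique (hasSum_ite_eq n (c n))

/-- The sequence `√n c_n`. -/
def weighted (c : ℕ+ → ℂ) (hc : Summable fun n : ℕ+ => (n : ℝ) * ‖c n‖ ^ 2) : Seq :=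
  ⟨fun n => ((Real.sqrt n : ℝ) : ℂ) * c n, memℓp_two_iff.2 (by
    refine hc.congr fun n => ?_
    rw [norm_mul, mul_pow, Complex.norm_real, Real.norm_of_nonneg (Real.sqrt_nonneg _),
      Real.sq_sqrt (Nat.cast_nonneg _)])⟩

theorem weighted_apply (c : ℕ+ → ℂ) (hc : Summable fun n : ℕ+ => (n : ℝ) * ‖c n‖ ^ 2) (n : ℕ+) :
    weighted c hc n = ((Real.sqrt n : ℝ) : ℂ) * c n := rfl

theorem Seq.summable_weighted (u : Seq) {c : ℕ+ → ℂ}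
    (hc : ∀ n, c n = (((Real.sqrt n)⁻¹ : ℝ) : ℂ) * u n) :
    Summable fun n : ℕ+ => (n : ℝ) * ‖c n‖ ^ 2 := by
  refine u.summable_sq.congr fun n => ?_
  have := one_le_cast n
  rw [hc, norm_mul, mul_pow, Complex.norm_real, Real.norm_of_nonneg (by positivity), inv_pow,
    Real.sq_sqrt (Nat.cast_nonneg _)]
  field_simp

section TraceSpace

variable {X : Type*} [NormedAddCommGroup X] [InnerProductSpace ℂ X]
  (b b' : HilbertBasis ℕ+ ℂ X)

/-- Together with `exists_trace` this identifies `traceSpace` with the vectors whose coefficients in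
both bases are square summable with weight n; for the bases χ⁻ and χ⁺ these form 𝓗^{1/2}. -/
theorem exists_traceSpace {φ : X} {u v : Seq}
    (hu : ∀ n, u n = ((Real.sqrt n : ℝ) : ℂ) * inner ℂ (b n) φ)
    (hv : ∀ n, v n = ((Real.sqrt n : ℝ) : ℂ) * inner ℂ (b' n) φ) :
    ∃ w : traceSpace b b', coeffFst b b' w = u ∧ coeffSnd b b' w = v := by
  have h1 : diag invSqrt u = b.repr φ := by
    ext n
    rw [diag_apply, invSqrt_apply, hu, ← HilbertBasis.repr_apply_apply]
    have := sqrt_ne_zero n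
    push_cast; field_simp
  have h2 : diag invSqrt v = b'.repr φ := by
    ext n
    rw [diag_apply, invSqrt_apply, hv, ← HilbertBasis.repr_apply_apply]
    have := sqrt_ne_zero n
    push_cast; field_simp
  refine ⟨⟨WithLp.toLp 2 (u, v), ?_⟩, rfl, rfl⟩
  change b.repr.symm (diag invSqrt u) - b'.repr.symm (diag invSqrt v) = 0
  rw [h1, h2]; simp

theorem exists_trace (w : traceSpace b b') :
    ∃ φ : X, (∀ n, inner ℂ (b n) φ = (((Real.sqrt n)⁻¹ : ℝ) : ℂ) * coeffFst b b' w n) ∧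
      ∀ n, inner ℂ (b' n) φ = (((Real.sqrt n)⁻¹ : ℝ) : ℂ) * coeffSnd b b' w n := by
  refine ⟨b.repr.symm (diag invSqrt (coeffFst b b' w)), fun n => ?_, fun n => ?_⟩
  · rw [← HilbertBasis.repr_apply_apply, LinearIsometryEquiv.apply_symm_apply, diag_apply,
      invSqrt_apply]
  · have h : b.repr.symm (diag invSqrt (coeffFst b b' w)) -
      b'.repr.symm (diag invSqrt (coeffSnd b b' w)) = 0 := w.2
    rw [sub_eq_zero] at h
    rw [h, ← HilbertBasis.repr_apply_apply, LinearIsometryEquiv.apply_symm_apply, diag_apply,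
      invSqrt_apply]

end TraceSpace

section Scattering

variable {d : ℝ} {n₀ N : ℕ+} {α β : ℝ}

theorem momentum_self {k : ℝ} (hk : 0 < k) : momentum d n₀ k n₀ = k := by
  rw [momentum, sub_self, zero_add, Real.sqrt_sq hk.le]

/-- The unknown is the trace coefficient r_n + δ_{n,n₀}, not r_n. Since k_{n₀} = k, the incoming
term ik equals -ik + 2ik: the first part is absorbed by the shift and 2ik remains as the source. -/
theorem derivCoeffMinus_eq (h : Gap d n₀ N α β) {k : ℝ} (hk : k ∈ Icc α β) (r : ℕ+ → ℂ) (n : ℕ+) :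
    derivCoeffMinus d n₀ k r n = (n : ℂ) * mult d n₀ N k n * (r n + if n = n₀ then 1 else 0) +
      if n = n₀ then 2 * Complex.I * k else 0 := by
  have hn : (n : ℂ) ≠ 0 := by exact_mod_cast n.ne_zero
  have hk0 : 0 < k := h.α_pos.trans_le hk.1
  rw [derivCoeffMinus, topMode_eq h hk, mult, modePhase, rate]
  by_cases h0 : n = n₀
  · subst h0
    simp only [h.le, if_true, momentum_self hk0]
    push_cast; field_simp; ring
  · simp only [h0, if_false]
    split_ifs <;> (push_cast; field_simp; ring)

/-- Outgoing and decaying waves reverse direction across the interface, hence the sign opposite to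
the left side. Taking this term to the other side gives a sum of two coercive forms. -/
theorem derivCoeffPlus_eq (h : Gap d n₀ N α β) {k : ℝ} (hk : k ∈ Icc α β) (c : ℕ+ → ℂ) (n : ℕ+) :
    derivCoeffPlus d n₀ k c n = -((n : ℂ) * mult d n₀ N k n * c n) := by
  have hn : (n : ℂ) ≠ 0 := by exact_mod_cast n.ne_zero
  rw [derivCoeffPlus, topMode_eq h hk, mult, modePhase, rate]
  split_ifs <;> (push_cast; field_simp)

/-- The weight n carried by the x-derivative splits as √n · √n, one factor for the trace and one for
the test vector. -/
theorem conj_weight_mul (m c g : ℂ) (n : ℕ+) :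
    (starRingEnd ℂ) ((n : ℂ) * m * c) * ((((Real.sqrt n)⁻¹ : ℝ) : ℂ) * g) =
      inner ℂ (m * (((Real.sqrt n : ℝ) : ℂ) * c)) g := by
  have h1 := sqrt_ne_zero n
  rw [RCLike.inner_apply, map_mul, map_mul, map_mul, map_mul, Complex.conj_ofReal,
    map_natCast, ← sqrt_mul_self n]
  push_cast; field_simp

theorem hasSum_derivCoeffPlus (h : Gap d n₀ N α β) {k : ℝ} (hk : k ∈ Icc α β) {c : ℕ+ → ℂ}
    {v g : Seq} (hv : ∀ n, v n = ((Real.sqrt n : ℝ) : ℂ) * c n) {γ : ℕ+ → ℂ}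
    (hγ : ∀ n, γ n = (((Real.sqrt n)⁻¹ : ℝ) : ℂ) * g n) :
    HasSum (fun n => (starRingEnd ℂ) (derivCoeffPlus d n₀ k c n) * γ n)
      (-inner ℂ (diag (mkBdd (mult d n₀ N k)) v) g) := by
  refine (lp.hasSum_inner (𝕜 := ℂ) (diag (mkBdd (mult d n₀ N k)) v) g).neg.congr_fun ?_
  intro n
  rw [derivCoeffPlus_eq h hk, map_neg, neg_mul, hγ, conj_weight_mul, diag_apply,
    mkBdd_mult_apply h hk, hv]

theorem hasSum_derivCoeffMinus (h : Gap d n₀ N α β) {k : ℝ} (hk : k ∈ Icc α β) {r : ℕ+ → ℂ}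
    {u g : Seq} (hu : ∀ n, u n = ((Real.sqrt n : ℝ) : ℂ) * (r n + if n = n₀ then 1 else 0))
    {γ : ℕ+ → ℂ} (hγ : ∀ n, γ n = (((Real.sqrt n)⁻¹ : ℝ) : ℂ) * g n) :
    HasSum (fun n => (starRingEnd ℂ) (derivCoeffMinus d n₀ k r n) * γ n)
      (inner ℂ (diag (mkBdd (mult d n₀ N k)) u) g -
        k * inner ℂ (lp.single 2 n₀ (-(2 * Complex.I) * (((Real.sqrt n₀)⁻¹ : ℝ) : ℂ)) : Seq) g) := by
  have h1 := lp.hasSum_inner (𝕜 := ℂ) (diag (mkBdd (mult d n₀ N k)) u) g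
  have h2 := hasSum_ite_eq n₀
    ((k : ℂ) * inner ℂ (lp.single 2 n₀ (-(2 * Complex.I) * (((Real.sqrt n₀)⁻¹ : ℝ) : ℂ)) : Seq) g)
  refine (h1.sub h2).congr_fun ?_
  intro n
  rw [derivCoeffMinus_eq h hk, map_add, add_mul, hγ, conj_weight_mul, diag_apply,
    mkBdd_mult_apply h hk, hu, sub_eq_add_neg]
  congr 1
  by_cases h0 : n = n₀
  · subst h0
    simp only [if_true]
    rw [lp.inner_single_left, RCLike.inner_apply]
    simp only [map_mul, map_neg, Complex.conj_I, Complex.conj_ofReal, map_ofNat]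
    ring
  · simp [h0]

variable (n₀ N) in
/-- The weighted coefficients of the trace at `x = 0` of the stationary wave at momentum `k`. -/
def waveTrace (hd : 0 < d) (k : ℝ) : traceSpace (basisMinus hd) (basisPlus hd) :=
  solution (coeffFst (basisMinus hd) (basisPlus hd)) (coeffSnd (basisMinus hd) (basisPlus hd))
    d n₀ N k

/-- Uniqueness. Every element of `traceSpace` comes from some G in 𝓗^{1/2}, so the derivative
condition may be tested on all of that space and becomes the variational equation. -/
theorem eq_waveTrace_of_isScattering (h : Gap d n₀ N α β) {k : ℝ} (hk : k ∈ Icc α β)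
    {r c : ℕ+ → ℂ} (hs : IsScattering d n₀ k r c) :
    (∀ n, r n = (((Real.sqrt n)⁻¹ : ℝ) : ℂ) *
        coeffFst _ _ (waveTrace n₀ N h.d_pos k) n - if n = n₀ then 1 else 0) ∧
      ∀ n, c n = (((Real.sqrt n)⁻¹ : ℝ) : ℂ) * coeffSnd _ _ (waveTrace n₀ N h.d_pos k) n := by
  have hd := h.d_pos
  obtain ⟨φ, h1, h2⟩ := hs.trace_eq
  have ho := orthonormal_modeMinus hd
  have hr : ∀ n, inner ℂ (modeMinus d n) φ = r n + if n = n₀ then 1 else 0 := by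
    intro n
    have h3 := inner_of_hasSum ho h1 n
    rw [inner_sub_right, orthonormal_iff_ite.1 ho] at h3
    linear_combination h3
  have hc := inner_of_hasSum (orthonormal_modePlus hd) h2
  -- The added entry √n₀ is the weighted coefficient of the incoming mode.
  set u : Seq := weighted r hs.summable_r + lp.single 2 n₀ ((Real.sqrt n₀ : ℝ) : ℂ) with hu
  have hun : ∀ n, u n = ((Real.sqrt n : ℝ) : ℂ) * (r n + if n = n₀ then 1 else 0) := by
    intro n
    rw [hu, lp.coeFn_add, Pi.add_apply, weighted_apply, lp.single_apply, mul_add]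
    by_cases h0 : n = n₀
    · subst h0; simp
    · simp [h0]
  obtain ⟨w, hw1, hw2⟩ := exists_traceSpace (basisMinus hd) (basisPlus hd) (φ := φ) (u := u)
    (v := weighted c hs.summable_tr) (fun n => by rw [hun, coe_basisMinus, hr])
    (fun n => by rw [weighted_apply, coe_basisPlus, hc])
  have hw : w = waveTrace n₀ N h.d_pos k := by
    refine (eq_solution_iff _ _ (norm_sq_eq _ _) h hk w).2 fun g => ?_
    obtain ⟨G, hG1, hG2⟩ := exists_trace _ _ g
    rw [coe_basisMinus] at hG1
    rw [coe_basisPlus] at hG2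
    have h4 := hs.deriv_trace_eq G ⟨Seq.summable_weighted _ hG1, Seq.summable_weighted _ hG2⟩
    rw [(hasSum_derivCoeffMinus h hk hun hG1).tsum_eq,
      (hasSum_derivCoeffPlus h hk (weighted_apply c hs.summable_tr) hG2).tsum_eq] at h4
    rw [hw1, hw2]
    linear_combination h4
  rw [← hw, hw1, hw2]
  refine ⟨fun n => ?_, fun n => ?_⟩
  · rw [hun]
    have := sqrt_ne_zero n
    push_cast; field_simp; ring
  · rw [weighted_apply]
    have := sqrt_ne_zero n
    push_cast; field_simp

/-- Existence: every test vector of 𝓗^{1/2} lifts to `traceSpace`, where the solution satisfies the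
weak equation. -/
theorem isScattering_waveTrace (h : Gap d n₀ N α β) {k : ℝ} (hk : k ∈ Icc α β) :
    IsScattering d n₀ k
      (fun n => (((Real.sqrt n)⁻¹ : ℝ) : ℂ) *
        coeffFst _ _ (waveTrace n₀ N h.d_pos k) n - if n = n₀ then 1 else 0)
      (fun n => (((Real.sqrt n)⁻¹ : ℝ) : ℂ) * coeffSnd _ _ (waveTrace n₀ N h.d_pos k) n) := by
  have hd := h.d_pos
  set w := waveTrace n₀ N h.d_pos k with hw
  have hmatch := (eq_solution_iff _ _ (norm_sq_eq (basisMinus hd) (basisPlus hd)) h hk w).1 hw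
  obtain ⟨φ, hφ1, hφ2⟩ := exists_trace _ _ w
  rw [coe_basisMinus] at hφ1
  rw [coe_basisPlus] at hφ2
  have hdiff : ∀ n : ℕ+, (((Real.sqrt n)⁻¹ : ℝ) : ℂ) * coeffFst _ _ w n - (if n = n₀ then 1 else 0) =
      inner ℂ (modeMinus d n) (φ - modeMinus d n₀) := by
    intro n
    rw [inner_sub_right, orthonormal_iff_ite.1 (orthonormal_modeMinus hd), hφ1]
  have hu : ∀ n, coeffFst _ _ w n = ((Real.sqrt n : ℝ) : ℂ) *
      (((((Real.sqrt n)⁻¹ : ℝ) : ℂ) * coeffFst _ _ w n - (if n = n₀ then 1 else 0)) +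
        if n = n₀ then 1 else 0) := by
    intro n
    have := sqrt_ne_zero n
    push_cast; field_simp; ring
  have hv : ∀ n, coeffSnd _ _ w n = ((Real.sqrt n : ℝ) : ℂ) *
      ((((Real.sqrt n)⁻¹ : ℝ) : ℂ) * coeffSnd _ _ w n) := by
    intro n
    have := sqrt_ne_zero n
    push_cast; field_simp
  refine ⟨?_, Seq.summable_weighted _ fun n => rfl, ⟨φ, ?_, ?_⟩, ?_⟩
  · refine Seq.summable_weighted
      (coeffFst _ _ w - lp.single 2 n₀ ((Real.sqrt n₀ : ℝ) : ℂ)) fun n => ?_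
    rw [lp.coeFn_sub, Pi.sub_apply, lp.single_apply, mul_sub]
    congr 1
    by_cases h0 : n = n₀
    · subst h0
      have := sqrt_ne_zero n
      simp
    · simp [h0]
  · have := (basisMinus hd).hasSum_repr (φ - modeMinus d n₀)
    simp only [HilbertBasis.repr_apply_apply, coe_basisMinus] at this
    simp only [hdiff]
    exact this
  · have := (basisPlus hd).hasSum_repr φ
    simp only [HilbertBasis.repr_apply_apply, coe_basisPlus] at this
    simp only [← hφ2]
    exact this
  · intro G hG
    obtain ⟨g, hg1, hg2⟩ := exists_traceSpace (basisMinus hd) (basisPlus hd) (φ := G)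
      (u := weighted _ hG.1) (v := weighted _ hG.2)
      (fun n => by rw [weighted_apply, coe_basisMinus])
      (fun n => by rw [weighted_apply, coe_basisPlus])
    have hγ1 : ∀ n, inner ℂ (modeMinus d n) G =
        (((Real.sqrt n)⁻¹ : ℝ) : ℂ) * coeffFst (basisMinus hd) (basisPlus hd) g n := by
      intro n
      rw [hg1, weighted_apply]
      have := sqrt_ne_zero n
      push_cast; field_simp
    have hγ2 : ∀ n, inner ℂ (modePlus d n) G =
        (((Real.sqrt n)⁻¹ : ℝ) : ℂ) * coeffSnd (basisMinus hd) (basisPlus hd) g n := by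
      intro n
      rw [hg2, weighted_apply]
      have := sqrt_ne_zero n
      push_cast; field_simp
    rw [(hasSum_derivCoeffMinus h hk hu hγ1).tsum_eq, (hasSum_derivCoeffPlus h hk hv hγ2).tsum_eq]
    linear_combination hmatch g

theorem existsUnique_isScattering (h : Gap d n₀ N α β) {k : ℝ} (hk : k ∈ Icc α β) :
    ∃! c : (ℕ+ → ℂ) × (ℕ+ → ℂ), IsScattering d n₀ k c.1 c.2 := by
  refine ⟨(_, _), isScattering_waveTrace h hk, fun c hc => ?_⟩
  obtain ⟨h1, h2⟩ := eq_waveTrace_of_isScattering h hk hc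
  exact Prod.ext (funext h1) (funext h2)

end Scattering

/-! ### Non-stationary phase -/

/-- `c` is continuously differentiable on `[α, β]` with derivative `c'`. -/
structure HasC1 (α β : ℝ) (c c' : ℝ → ℂ) : Prop where
  cont : ContinuousOn c (Icc α β)
  cont' : ContinuousOn c' (Icc α β)
  deriv : ∀ k ∈ Ioo α β, HasDerivAt c (c' k) k

theorem HasC1.mul {α β : ℝ} {a a' c c' : ℝ → ℂ} (ha : HasC1 α β a a') (hc : HasC1 α β c c') :
    HasC1 α β (fun k => a k * c k) (fun k => a' k * c k + a k * c' k) :=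
  ⟨ha.cont.mul hc.cont, (ha.cont'.mul hc.cont).add (ha.cont.mul hc.cont'),
    fun k hk => (ha.deriv k hk).mul (hc.deriv k hk)⟩

theorem HasC1.exists_bound {α β : ℝ} {c c' : ℝ → ℂ} (h : HasC1 α β c c') :
    ∃ M, 0 ≤ M ∧ ∀ k ∈ Icc α β, ‖c k‖ ≤ M ∧ ‖c' k‖ ≤ M := by
  obtain ⟨M₁, h₁⟩ := isCompact_Icc.exists_bound_of_continuousOn h.cont
  obtain ⟨M₂, h₂⟩ := isCompact_Icc.exists_bound_of_continuousOn h.cont'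
  exact ⟨max 0 (max M₁ M₂), le_max_left _ _, fun k hk =>
    ⟨(h₁ k hk).trans ((le_max_left _ _).trans (le_max_right _ _)),
      (h₂ k hk).trans ((le_max_right _ _).trans (le_max_right _ _))⟩⟩

/-- Non-stationary phase: a single integration by parts. -/
theorem norm_integral_mul_exp_le {α β : ℝ} (hαβ : α ≤ β) {b b' φ φ' φ'' : ℝ → ℂ} {M s K : ℝ}
    (hb : HasC1 α β b b') (hα : b α = 0) (hβ : b β = 0)
    (hM : ∀ k ∈ Icc α β, ‖b k‖ ≤ M ∧ ‖b' k‖ ≤ M)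
    (hφ : ∀ k ∈ Icc α β, HasDerivAt φ (φ' k) k) (hφ' : ∀ k ∈ Icc α β, HasDerivAt φ' (φ'' k) k)
    (hφ'' : ContinuousOn φ'' (Icc α β)) (hre : ∀ k ∈ Icc α β, (φ k).re ≤ 0)
    (hs : 0 < s) (hs' : ∀ k ∈ Icc α β, s ≤ ‖φ' k‖) (hK : ∀ k ∈ Icc α β, ‖φ'' k‖ ≤ K * s) :
    ‖∫ k in α..β, b k * Complex.exp (φ k)‖ ≤ (β - α) * (M * (1 + K) / s) := by
  have hne : ∀ k ∈ Icc α β, φ' k ≠ 0 := fun k hk => norm_pos_iff.1 (hs.trans_le (hs' k hk))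
  have hφc : ContinuousOn φ (Icc α β) := fun k hk => (hφ k hk).continuousAt.continuousWithinAt
  have hφ'c : ContinuousOn φ' (Icc α β) := fun k hk => (hφ' k hk).continuousAt.continuousWithinAt
  have hexp : ContinuousOn (fun k => Complex.exp (φ k)) (Icc α β) := hφc.cexp
  -- The derivative of b / φ', so that (b / φ') e^φ has derivative h' e^φ + b e^φ.
  set h' : ℝ → ℂ := fun k => (b' k * φ' k - b k * φ'' k) / φ' k ^ 2 with hh'
  have hh'c : ContinuousOn h' (Icc α β) :=
    ((hb.cont'.mul hφ'c).sub (hb.cont.mul hφ'')).div (hφ'c.pow 2) fun k hk => pow_ne_zero 2 (hne k hk)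
  have hderiv : ∀ k ∈ Ioo α β, HasDerivAt (fun k => b k / φ' k * Complex.exp (φ k))
      (h' k * Complex.exp (φ k) + b k * Complex.exp (φ k)) k := by
    intro k hk
    have hk' := Ioo_subset_Icc_self hk
    refine (((hb.deriv k hk).div (hφ' k hk') (hne k hk')).mul (hφ k hk').cexp).congr_deriv ?_
    have := hne k hk'
    simp only [hh', Pi.div_apply]
    field_simp
  have hi1 : IntervalIntegrable (fun k => h' k * Complex.exp (φ k)) volume α β :=
    ContinuousOn.intervalIntegrable (by rw [uIcc_of_le hαβ]; exact hh'c.mul hexp)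
  have hi2 : IntervalIntegrable (fun k => b k * Complex.exp (φ k)) volume α β :=
    ContinuousOn.intervalIntegrable (by rw [uIcc_of_le hαβ]; exact hb.cont.mul hexp)
  have h0 := intervalIntegral.integral_eq_sub_of_hasDerivAt_of_le hαβ
    ((hb.cont.div hφ'c hne).mul hexp) hderiv (hi1.add hi2)
  rw [intervalIntegral.integral_add hi1 hi2] at h0
  simp only [Pi.mul_apply, Pi.div_apply, hα, hβ, zero_div, zero_mul, sub_zero] at h0
  have h1 : ∫ k in α..β, b k * Complex.exp (φ k) = -∫ k in α..β, h' k * Complex.exp (φ k) := by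
    linear_combination h0
  rw [h1, norm_neg]
  have h2 := intervalIntegral.norm_integral_le_of_norm_le_const (a := α) (b := β)
    (f := fun k => h' k * Complex.exp (φ k)) (C := M * (1 + K) / s) (fun k hk => by
      rw [uIoc_of_le hαβ] at hk
      have hk' := Ioc_subset_Icc_self hk
      obtain ⟨hM1, hM2⟩ := hM k hk'
      have hM0 : 0 ≤ M := (norm_nonneg _).trans hM1
      have hp : 0 < ‖φ' k‖ := hs.trans_le (hs' k hk')
      have he : ‖Complex.exp (φ k)‖ ≤ 1 := by
        rw [Complex.norm_exp]; exact Real.exp_le_one_iff.2 (hre k hk')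
      have h3 : ‖h' k‖ ≤ (M * ‖φ' k‖ + M * (K * s)) / ‖φ' k‖ ^ 2 := by
        simp only [hh']
        rw [norm_div, norm_pow]
        gcongr
        refine (norm_sub_le _ _).trans ?_
        rw [norm_mul, norm_mul]
        gcongr
        exact hK k hk'
      have hKs : 0 ≤ K * s := (norm_nonneg _).trans (hK k hk')
      have h4 : (M * ‖φ' k‖ + M * (K * s)) / ‖φ' k‖ ^ 2 ≤ M * (1 + K) / s := by
        have e1 : M / ‖φ' k‖ ≤ M / s := div_le_div_of_nonneg_left hM0 hs (hs' k hk')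
        have e2 : M * (K * s) / ‖φ' k‖ ^ 2 ≤ M * (K * s) / s ^ 2 :=
          div_le_div_of_nonneg_left (by positivity) (by positivity)
            (pow_le_pow_left₀ hs.le (hs' k hk') 2)
        have e3 : (M * ‖φ' k‖ + M * (K * s)) / ‖φ' k‖ ^ 2 =
          M / ‖φ' k‖ + M * (K * s) / ‖φ' k‖ ^ 2 := by field_simp
        have e4 : M * (1 + K) / s = M / s + M * (K * s) / s ^ 2 := by field_simp
        rw [e3, e4]; exact add_le_add e1 e2
      calc ‖h' k * Complex.exp (φ k)‖ ≤ ‖h' k‖ * 1 := by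
            rw [norm_mul]; gcongr
        _ ≤ _ := by rw [mul_one]; exact h3.trans h4)
  rw [abs_of_nonneg (sub_nonneg.2 hαβ), mul_comm] at h2
  exact h2

/-! ### Propagating wave packets -/

section Packets

variable {d : ℝ} {n₀ N : ℕ+} {α β : ℝ} {a : ℝ → ℂ}

theorem amplitude_eq_zero (ha : ∀ k ∉ Icc α β, a k = 0) (t : ℝ) {k : ℝ} (hk : k ∉ Icc α β) :
    amplitude d n₀ a t k = 0 := by rw [amplitude, ha k hk, zero_mul]

theorem integral_amplitude_mul (ha : ∀ k ∉ Icc α β, a k = 0) (t : ℝ) (f : ℝ → ℂ) :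
    ∫ k, amplitude d n₀ a t k * f k = ∫ k in Icc α β, amplitude d n₀ a t k * f k :=
  (setIntegral_eq_integral_of_forall_compl_eq_zero fun k hk => by
    rw [amplitude_eq_zero ha t hk, zero_mul]).symm

theorem integral_amplitude_mul' (hαβ : α ≤ β) (ha : ∀ k ∉ Icc α β, a k = 0) (t : ℝ) (f : ℝ → ℂ) :
    ∫ k, amplitude d n₀ a t k * f k = ∫ k in α..β, amplitude d n₀ a t k * f k := by
  rw [integral_amplitude_mul ha, integral_Icc_eq_integral_Ioc, intervalIntegral.integral_of_le hαβ]

/-- The wave packet of a single propagating mode with amplitude `c`. -/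
def modePacket (d : ℝ) (n₀ : ℕ+) (a c : ℝ → ℂ) (l : ℕ+) (t x : ℝ) : ℂ :=
  ∫ k : ℝ, amplitude d n₀ a t k *
    (c k * Complex.exp (Complex.I * (momentum d n₀ k l : ℂ) * (x : ℂ)))

theorem rate_of_le {l : ℕ+} (hl : l ≤ N) (k : ℝ) : rate d n₀ N k l = momentum d n₀ k l := by
  rw [rate, if_pos hl]

/-- Absence of stationary points: for t and x of opposite signs the two terms of the phase
derivative cannot cancel. -/
theorem abs_add_of_mul_nonpos {p q t x : ℝ} (hp : 0 ≤ p) (hq : 0 ≤ q) (h : t * x ≤ 0) :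
    |-(p * t) + q * x| = p * |t| + q * |x| := by
  rcases mul_nonpos_iff.1 h with ⟨ht, hx⟩ | ⟨ht, hx⟩
  · rw [abs_of_nonneg ht, abs_of_nonpos hx, abs_of_nonpos]
    · ring
    · nlinarith [mul_nonneg hp ht, mul_nonneg hq (neg_nonneg.2 hx)]
  · rw [abs_of_nonpos ht, abs_of_nonneg hx, abs_of_nonneg]
    · ring
    · nlinarith [mul_nonneg hp (neg_nonneg.2 ht), mul_nonneg hq hx]

/-- Decay of an oscillatory integral without stationary points, uniformly in the amplitude. -/
theorem exists_norm_integral_phase_le (h : Gap d n₀ N α β) {l : ℕ+} (hl : l ≤ N) :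
    ∃ C, 0 ≤ C ∧ ∀ b b' : ℝ → ℂ, ∀ M, HasC1 α β b b' → b α = 0 → b β = 0 →
      (∀ k ∈ Icc α β, ‖b k‖ ≤ M ∧ ‖b' k‖ ≤ M) → ∀ t x : ℝ, t * x ≤ 0 → 0 < |t| + |x| →
      ‖∫ k in α..β, b k * Complex.exp (Complex.I *
        ((-((mu d n₀ + k ^ 2) * t) + momentum d n₀ k l * x : ℝ) : ℂ))‖ ≤ C * M / (|t| + |x|) := by
  obtain ⟨c, hc, Hc⟩ := exists_le_rate h
  obtain ⟨Q, HQ⟩ := exists_rate_le h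
  have hα := h.α_pos
  have hαβ := h.lt
  have hβ : 0 < β := hα.trans hαβ
  have hl1 := one_le_cast l
  have hqpos : ∀ k ∈ Icc α β, 0 < rate d n₀ N k l := fun k hk =>
    (by positivity : 0 < c * (l : ℝ)).trans_le (Hc k hk l)
  have hQl : 0 < Q * l := (hqpos α (left_mem_Icc.2 hαβ.le)).trans_le
    (HQ α (left_mem_Icc.2 hαβ.le) l)
  -- The phase derivative is -2kt + (k / k_l)x, with 2k ≥ 2α and k / k_l ≥ α / (Q l). Its derivative
  -- is at most (2 + D)(|t| + |x|), which fixes K below.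
  set m := min (2 * α) (α / (Q * l)) with hm
  have hm0 : 0 < m := lt_min (by positivity) (by positivity)
  set D := 1 / c + β ^ 2 / c ^ 3 with hD
  have hD0 : 0 ≤ D := by positivity
  set K := (2 + D) / m with hK
  refine ⟨(β - α) * (1 + K) / m, by
    have : 0 ≤ β - α := by linarith
    positivity, fun b b' M hb hbα hbβ hM t x htx hpos => ?_⟩
  set s := m * (|t| + |x|) with hs
  have hs0 : 0 < s := mul_pos hm0 hpos
  simp_rw [← rate_of_le (d := d) (n₀ := n₀) hl]
  have hsign : modeSign N l = 1 := if_pos hl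
  have key := norm_integral_mul_exp_le hαβ.le (K := K) (s := s) hb hbα hbβ hM
    (φ := fun k => Complex.I *
      ((-((mu d n₀ + k ^ 2) * t) + rate d n₀ N k l * x : ℝ) : ℂ))
    (φ' := fun k => Complex.I * ((-((2 * k) * t) + k / rate d n₀ N k l * x : ℝ) : ℂ))
    (φ'' := fun k => Complex.I * ((-(2 * t) +
      (1 / rate d n₀ N k l - modeSign N l * (k ^ 2 / rate d n₀ N k l ^ 3)) * x : ℝ) : ℂ))
    (fun k hk => by
      refine HasDerivAt.const_mul _ (HasDerivAt.ofReal_comp ?_)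
      have h1 := hasDerivAt_rate (hqpos k hk)
      rw [hsign, one_mul] at h1
      have h2 : HasDerivAt (fun k : ℝ => mu d n₀ + k ^ 2) (2 * k) k := by
        simpa using ((hasDerivAt_id k).pow 2).const_add (mu d n₀)
      exact (h2.mul_const t).neg.add (h1.mul_const x))
    (fun k hk => by
      refine HasDerivAt.const_mul _ (HasDerivAt.ofReal_comp ?_)
      have h1 := hasDerivAt_div_rate (hqpos k hk)
      have h2 : HasDerivAt (fun k : ℝ => 2 * k) 2 k := by
        simpa using (hasDerivAt_id k).const_mul 2
      exact (h2.mul_const t).neg.add (h1.mul_const x))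
    (by
      refine continuousOn_const.mul (Complex.continuous_ofReal.comp_continuousOn ?_)
      have hr : ContinuousOn (fun k => rate d n₀ N k l) (Icc α β) :=
        (continuous_rate d n₀ N l).continuousOn
      refine continuousOn_const.add (ContinuousOn.mul (ContinuousOn.sub ?_ ?_) continuousOn_const)
      · exact continuousOn_const.div hr fun k hk => (hqpos k hk).ne'
      · exact continuousOn_const.mul ((continuousOn_id.pow 2).div (hr.pow 3) fun k hk =>
          pow_ne_zero 3 (hqpos k hk).ne'))
    (fun k hk => by
      rw [Complex.re_mul_ofReal]; simp)
    hs0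
    (fun k hk => by
      have hk0 : 0 < k := hα.trans_le hk.1
      rw [norm_mul, Complex.norm_I, one_mul, Complex.norm_real, Real.norm_eq_abs,
        abs_add_of_mul_nonpos (by positivity) (div_nonneg hk0.le (hqpos k hk).le) htx, hs, mul_add]
      have e1 : m ≤ 2 * k := (min_le_left _ _).trans (by linarith [hk.1])
      have e2 : m ≤ k / rate d n₀ N k l := (min_le_right _ _).trans
        (div_le_div₀ hk0.le hk.1 (hqpos k hk) (HQ k hk l))
      gcongr)
    (fun k hk => by
      rw [norm_mul, Complex.norm_I, one_mul, Complex.norm_real, Real.norm_eq_abs]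
      refine (abs_add_le _ _).trans ?_
      have e1 := abs_deriv_div_rate_le h hc Hc hk l
      rw [abs_neg, abs_mul, abs_mul, abs_two]
      have e2 : K * s = (2 + D) * (|t| + |x|) := by
        rw [hK, hs]; field_simp
      rw [e2]
      have e3 := mul_le_mul_of_nonneg_right e1 (abs_nonneg x)
      nlinarith [abs_nonneg t, abs_nonneg x, mul_nonneg hD0 (abs_nonneg t)])
  refine key.trans (le_of_eq ?_)
  rw [hs]
  field_simp

/-- Removes the boundary terms of the integration by parts: by continuity `a` also vanishes at the
two ends of the window. -/
theorem boundary_zero (hac : Continuous a) (ha : ∀ k ∉ Icc α β, a k = 0) :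
    a α = 0 ∧ a β = 0 := by
  have hcl : IsClosed {k | a k = 0} := isClosed_eq hac continuous_const
  have h1 : Iio α ⊆ {k | a k = 0} := fun k hk => ha k fun h => absurd h.1 (not_le.2 hk)
  have h2 : Ioi β ⊆ {k | a k = 0} := fun k hk => ha k fun h => absurd h.2 (not_le.2 hk)
  have h3 := closure_minimal h1 hcl
  have h4 := closure_minimal h2 hcl
  rw [closure_Iio] at h3
  rw [closure_Ioi] at h4
  exact ⟨h3 self_mem_Iic, h4 self_mem_Ici⟩

theorem hasC1_of_contDiff (ha : ContDiff ℝ 1 a) : HasC1 α β a (deriv a) :=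
  ⟨ha.continuous.continuousOn, (ha.continuous_deriv le_rfl).continuousOn,
    fun _ _ => ((ha.differentiable one_ne_zero) _).hasDerivAt⟩

theorem exists_norm_modePacket_le (h : Gap d n₀ N α β) {l : ℕ+} (hl : l ≤ N)
    (hac : ContDiff ℝ 1 a) (ha : ∀ k ∉ Icc α β, a k = 0) {c c' : ℝ → ℂ} (hc : HasC1 α β c c') :
    ∃ C, 0 ≤ C ∧ ∀ t x : ℝ, t * x ≤ 0 → 0 < |t| + |x| →
      ‖modePacket d n₀ a c l t x‖ ≤ C / (|t| + |x|) := by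
  obtain ⟨C, hC0, hC⟩ := exists_norm_integral_phase_le h hl
  have hb := (hasC1_of_contDiff (α := α) (β := β) hac).mul hc
  obtain ⟨M, hM0, hM⟩ := hb.exists_bound
  obtain ⟨h1, h2⟩ := boundary_zero hac.continuous ha
  refine ⟨C * M, by positivity, fun t x htx hpos => ?_⟩
  have key := hC _ _ M hb (by simp [h1]) (by simp [h2]) hM t x htx hpos
  refine le_trans (le_of_eq ?_) key
  rw [modePacket, integral_amplitude_mul' h.lt.le ha]
  congr 1
  refine intervalIntegral.integral_congr fun k _ => ?_
  simp only [amplitude]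
  have e : Complex.exp (Complex.I * ((-((mu d n₀ + k ^ 2) * t) + momentum d n₀ k l * x : ℝ) : ℂ)) =
      Complex.exp (-(Complex.I * ((mu d n₀ + k ^ 2 : ℝ) : ℂ) * (t : ℂ))) *
        Complex.exp (Complex.I * (momentum d n₀ k l : ℂ) * (x : ℂ)) := by
    rw [← Complex.exp_add]; congr 1; push_cast; ring
  rw [e]; ring

theorem hasC1_timeFactor (d : ℝ) (n₀ : ℕ+) (α β t : ℝ) : HasC1 α β
    (fun k => Complex.exp (-(Complex.I * ((mu d n₀ + k ^ 2 : ℝ) : ℂ) * (t : ℂ))))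
    (fun k => Complex.exp (-(Complex.I * ((mu d n₀ + k ^ 2 : ℝ) : ℂ) * (t : ℂ))) *
      -(Complex.I * ((2 * k : ℝ) : ℂ) * (t : ℂ))) := by
  refine ⟨Continuous.continuousOn (by fun_prop), Continuous.continuousOn (by fun_prop),
    fun k _ => HasDerivAt.cexp ?_⟩
  have h2 : HasDerivAt (fun k : ℝ => mu d n₀ + k ^ 2) (2 * k) k := by
    simpa using ((hasDerivAt_id k).pow 2).const_add (mu d n₀)
  exact ((h2.ofReal_comp.const_mul Complex.I).mul_const (t : ℂ)).neg

/-- At fixed t the time factor is put into the amplitude and the phase estimate is used at time 0,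
where it holds for both signs of x. The bound C M / |x| and the trivial bound combine to decay like
1 / (1 + |x|), enough for square integrability. -/
theorem exists_norm_modePacket_le_fixed (h : Gap d n₀ N α β) {l : ℕ+} (hl : l ≤ N)
    (hac : ContDiff ℝ 1 a) (ha : ∀ k ∉ Icc α β, a k = 0) {c c' : ℝ → ℂ} (hc : HasC1 α β c c')
    (t : ℝ) : ∃ C, 0 ≤ C ∧ ∀ x : ℝ, x ≠ 0 → ‖modePacket d n₀ a c l t x‖ ≤ C / (1 + |x|) := by
  obtain ⟨C, hC0, hC⟩ := exists_norm_integral_phase_le h hl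
  have hb := ((hasC1_of_contDiff (α := α) (β := β) hac).mul hc).mul (hasC1_timeFactor d n₀ α β t)
  obtain ⟨M, hM0, hM⟩ := hb.exists_bound
  obtain ⟨h1, h2⟩ := boundary_zero hac.continuous ha
  have hlen : 0 ≤ β - α := by linarith [h.lt]
  refine ⟨C * M + M * (β - α), by positivity, fun x hx => ?_⟩
  have hx0 : 0 < |x| := abs_pos.2 hx
  have e : modePacket d n₀ a c l t x = ∫ k in α..β, (a k * c k *
      Complex.exp (-(Complex.I * ((mu d n₀ + k ^ 2 : ℝ) : ℂ) * (t : ℂ)))) *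
      Complex.exp (Complex.I *
        ((-((mu d n₀ + k ^ 2) * 0) + momentum d n₀ k l * x : ℝ) : ℂ)) := by
    rw [modePacket, integral_amplitude_mul' h.lt.le ha]
    refine intervalIntegral.integral_congr fun k _ => ?_
    simp only [amplitude, mul_zero, neg_zero, zero_add, Complex.ofReal_mul, mul_assoc]
    ring
  have key := hC _ _ M hb (by simp [h1]) (by simp [h2]) hM 0 x (by simp) (by simpa using hx)
  rw [← e, abs_zero, zero_add, le_div_iff₀ hx0] at key
  have key2 : ‖modePacket d n₀ a c l t x‖ ≤ M * |β - α| := by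
    rw [e]
    refine intervalIntegral.norm_integral_le_of_norm_le_const fun k hk => ?_
    rw [uIoc_of_le h.lt.le] at hk
    rw [norm_mul, Complex.norm_exp_I_mul_ofReal, mul_one]
    exact (hM k (Ioc_subset_Icc_self hk)).1
  rw [abs_of_nonneg hlen] at key2
  rw [le_div_iff₀ (by positivity), mul_add, mul_one]
  linarith

theorem aestronglyMeasurable_modePacket (ha' : Continuous a) (ha : ∀ k ∉ Icc α β, a k = 0)
    {c : ℝ → ℂ} (hc : ContinuousOn c (Icc α β)) (l : ℕ+) (t : ℝ) {Y : Type*} [MeasurableSpace Y]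
    {ν : Measure Y} [SFinite ν] {g : Y → ℝ} (hg : Measurable g) :
    AEStronglyMeasurable (fun y => modePacket d n₀ a c l t (g y)) ν := by
  simp only [modePacket, integral_amplitude_mul ha]
  have h1 : AEStronglyMeasurable (fun z : Y × ℝ => c z.2) (ν.prod (volume.restrict (Icc α β))) :=
    (hc.aestronglyMeasurable measurableSet_Icc).comp_snd
  have hm : Continuous fun k => momentum d n₀ k l := by unfold momentum; fun_prop
  have h2 : AEStronglyMeasurable (fun z : Y × ℝ => amplitude d n₀ a t z.2)
      (ν.prod (volume.restrict (Icc α β))) := by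
    have : Continuous fun k => amplitude d n₀ a t k := by unfold amplitude; fun_prop
    exact (this.measurable.comp measurable_snd).aestronglyMeasurable
  have h3 : AEStronglyMeasurable (fun z : Y × ℝ =>
      Complex.exp (Complex.I * (momentum d n₀ z.2 l : ℂ) * (g z.1 : ℂ)))
      (ν.prod (volume.restrict (Icc α β))) := by
    have e1 : Measurable fun z : Y × ℝ => momentum d n₀ z.2 l := hm.measurable.comp measurable_snd
    have e2 : Measurable fun z : Y × ℝ => g z.1 := hg.comp measurable_fst
    exact Measurable.aestronglyMeasurable (by fun_prop)
  exact (h2.mul (h1.mul h3)).integral_prod_right'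

end Packets

/-! ### Evanescent modes -/

/-- `u` is continuously differentiable on `[α, β]`, coordinatewise, with derivative `u'`. -/
structure HasC1Seq (α β : ℝ) (u u' : ℝ → Seq) : Prop where
  cont : ContinuousOn u (Icc α β)
  cont' : ContinuousOn u' (Icc α β)
  deriv : ∀ k ∈ Icc α β, ∀ n, HasDerivWithinAt (fun k => u k n) (u' k n) (Icc α β) k

theorem Seq.continuous_apply (n : ℕ+) : Continuous fun u : Seq => u n :=
  (lp.evalCLM ℂ (fun _ : ℕ+ => ℂ) 2 n).continuous

theorem HasC1Seq.coord {α β : ℝ} {u u' : ℝ → Seq} (h : HasC1Seq α β u u') (n : ℕ+) :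
    HasC1 α β (fun k => u k n) (fun k => u' k n) :=
  ⟨(Seq.continuous_apply n).comp_continuousOn h.cont,
    (Seq.continuous_apply n).comp_continuousOn h.cont',
    fun k hk => (h.deriv k (Ioo_subset_Icc_self hk) n).hasDerivAt (Icc_mem_nhds hk.1 hk.2)⟩

theorem HasC1.const_mul {α β : ℝ} {c c' : ℝ → ℂ} (h : HasC1 α β c c') (z : ℂ) :
    HasC1 α β (fun k => z * c k) (fun k => z * c' k) :=
  ⟨continuousOn_const.mul h.cont, continuousOn_const.mul h.cont',
    fun k hk => (h.deriv k hk).const_mul z⟩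

theorem HasC1.sub_const {α β : ℝ} {c c' : ℝ → ℂ} (h : HasC1 α β c c') (z : ℂ) :
    HasC1 α β (fun k => c k - z) c' :=
  ⟨h.cont.sub continuousOn_const, h.cont', fun k hk => (h.deriv k hk).sub_const z⟩

theorem HasC1Seq.exists_bound {α β : ℝ} {u u' : ℝ → Seq} (h : HasC1Seq α β u u') :
    ∃ M, 0 ≤ M ∧ ∀ k ∈ Icc α β, ‖u k‖ ≤ M ∧ ‖u' k‖ ≤ M := by
  obtain ⟨M₁, h₁⟩ := isCompact_Icc.exists_bound_of_continuousOn h.cont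
  obtain ⟨M₂, h₂⟩ := isCompact_Icc.exists_bound_of_continuousOn h.cont'
  exact ⟨max 0 (max M₁ M₂), le_max_left _ _, fun k hk =>
    ⟨(h₁ k hk).trans ((le_max_left _ _).trans (le_max_right _ _)),
      (h₂ k hk).trans ((le_max_right _ _).trans (le_max_right _ _))⟩⟩

/-- Cauchy–Schwarz against the sequence `n^{-3/4}`. -/
theorem exists_tsum_weight_le : ∃ Z, 0 ≤ Z ∧ ∀ v : Seq,
    Summable (fun n : ℕ+ => ‖v n‖ * (n : ℝ) ^ (-(3 / 4) : ℝ)) ∧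
      ∑' n : ℕ+, ‖v n‖ * (n : ℝ) ^ (-(3 / 4) : ℝ) ≤ ‖v‖ * Z := by
  have hmem : Memℓp (fun n : ℕ+ => (((n : ℝ) ^ (-(3 / 4) : ℝ) : ℝ) : ℂ)) 2 := by
    rw [memℓp_two_iff]
    have h1 : Summable fun n : ℕ => (n : ℝ) ^ (-(3 / 2) : ℝ) :=
      Real.summable_nat_rpow.2 (by norm_num)
    refine (h1.comp_injective PNat.coe_injective).congr fun n => ?_
    rw [Complex.norm_real, Real.norm_of_nonneg (by positivity), Function.comp_apply,
      ← Real.rpow_natCast, ← Real.rpow_mul (Nat.cast_nonneg _)]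
    norm_num
  refine ⟨‖(⟨_, hmem⟩ : Seq)‖, norm_nonneg _, fun v => ?_⟩
  have h := lp.tsum_mul_le_mul_norm (p := 2) (q := 2)
    (by simpa using Real.HolderConjugate.two_two) v ⟨_, hmem⟩
  have e : ∀ n : ℕ+, ‖(((n : ℝ) ^ (-(3 / 4) : ℝ) : ℝ) : ℂ)‖ = (n : ℝ) ^ (-(3 / 4) : ℝ) := fun n => by
    rw [Complex.norm_real, Real.norm_of_nonneg (by positivity)]
  simp only [e] at h
  exact h

theorem exp_neg_le_rpow {z : ℝ} (hz : 0 < z) : Real.exp (-z) ≤ z ^ (-(1 / 4) : ℝ) := by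
  rw [Real.rpow_def_of_pos hz, Real.exp_le_exp]
  have := Real.log_le_sub_one_of_pos hz
  linarith

/-- Half of the exponent is traded for (nX)^{-1/4}. The power 1/4 serves two needs: n^{-1/2} becomes
n^{-3/4}, which lies in ℓ², and X^{-1/4} is still square integrable at 0. -/
theorem inv_sqrt_mul_exp_le {c X : ℝ} (hc : 0 < c) (hX : 0 < X) (n : ℕ+) :
    (Real.sqrt n)⁻¹ * Real.exp (-(c * n * X)) ≤
      (c / 2) ^ (-(1 / 4) : ℝ) * (X ^ (-(1 / 4) : ℝ) * Real.exp (-(c / 2 * X))) *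
        (n : ℝ) ^ (-(3 / 4) : ℝ) := by
  have hn := one_le_cast n
  have hn0 : (0 : ℝ) < n := by linarith
  have e1 : Real.exp (-(c * n * X)) = Real.exp (-(c / 2 * n * X)) * Real.exp (-(c / 2 * n * X)) := by
    rw [← Real.exp_add]; congr 1; ring
  have e2 : Real.exp (-(c / 2 * n * X)) ≤
      (c / 2) ^ (-(1 / 4) : ℝ) * (n : ℝ) ^ (-(1 / 4) : ℝ) * X ^ (-(1 / 4) : ℝ) := by
    rw [← Real.mul_rpow (by positivity) (by positivity), ← Real.mul_rpow (by positivity)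
      (by positivity)]
    exact exp_neg_le_rpow (by positivity)
  have e3 : Real.exp (-(c / 2 * n * X)) ≤ Real.exp (-(c / 2 * X)) := by
    rw [Real.exp_le_exp, neg_le_neg_iff]
    have : 0 < c / 2 * X := by positivity
    nlinarith
  have e4 : (n : ℝ) ^ (-(3 / 4) : ℝ) = (Real.sqrt n)⁻¹ * (n : ℝ) ^ (-(1 / 4) : ℝ) := by
    rw [Real.sqrt_eq_rpow, ← Real.rpow_neg hn0.le, ← Real.rpow_add hn0]; norm_num
  rw [e1, e4]
  calc (Real.sqrt n)⁻¹ * (Real.exp (-(c / 2 * n * X)) * Real.exp (-(c / 2 * n * X)))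
      ≤ (Real.sqrt n)⁻¹ * ((c / 2) ^ (-(1 / 4) : ℝ) * (n : ℝ) ^ (-(1 / 4) : ℝ) * X ^ (-(1 / 4) : ℝ) *
          Real.exp (-(c / 2 * X))) := by gcongr
    _ = _ := by ring

section Evanescent

variable (d : ℝ) (n₀ N : ℕ+)

/-- A summand of the evanescent part, at distance `X` from the interface. -/
def evanTerm (u : ℝ → Seq) (X : ℝ) (e : ℕ+ → ℝ) (n : ℕ+) (k : ℝ) : ℂ :=
  (((Real.sqrt n)⁻¹ : ℝ) : ℂ) * u k n * (Real.exp (-(decay d n₀ k n * X)) : ℂ) * (e n : ℂ)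

/-- The `k`-derivative of `evanTerm`. -/
def evanTermDeriv (u u' : ℝ → Seq) (X : ℝ) (e : ℕ+ → ℝ) (n : ℕ+) (k : ℝ) : ℂ :=
  ((((Real.sqrt n)⁻¹ : ℝ) : ℂ) * u' k n * (Real.exp (-(decay d n₀ k n * X)) : ℂ) +
    (((Real.sqrt n)⁻¹ : ℝ) : ℂ) * u k n *
      ((Real.exp (-(decay d n₀ k n * X)) * (k / decay d n₀ k n * X) : ℝ) : ℂ)) * (e n : ℂ)

/-- The evanescent part of the stationary wave, at distance `X` from the interface. -/
def evan (u : ℝ → Seq) (X : ℝ) (e : ℕ+ → ℝ) (k : ℝ) : ℂ :=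
  ∑' n : Ioi N, evanTerm d n₀ u X e n k

variable {d n₀ N} {α β : ℝ}

theorem rate_of_lt {n : ℕ+} (hn : N < n) (k : ℝ) : rate d n₀ N k n = decay d n₀ k n := by
  rw [rate, if_neg (not_le.2 hn)]

/-- Differentiating e^{-κX} in k produces the factor (k / κ)X. The rate is taken above 2cn so that
one copy of e^{-cnX} absorbs X and the other survives; the same majorant then serves the term and
its derivative. -/
theorem norm_evanTerm_le {c D : ℝ} (hc : 0 < c)
    (hr : ∀ k ∈ Icc α β, ∀ n : ℕ+, 2 * c * n ≤ rate d n₀ N k n) (u u' : ℝ → Seq) {X : ℝ}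
    (hX : 0 < X) {e : ℕ+ → ℝ} (he : ∀ n, |e n| ≤ D) {n : ℕ+} (hn : N < n) {k : ℝ}
    (hk : k ∈ Icc α β) (hα : 0 < α) :
    ‖evanTerm d n₀ u X e n k‖ ≤ (1 + β / c ^ 2) * D *
        ((‖u k n‖ + ‖u' k n‖) * ((Real.sqrt n)⁻¹ * Real.exp (-(c * n * X)))) ∧
      ‖evanTermDeriv d n₀ u u' X e n k‖ ≤ (1 + β / c ^ 2) * D *
        ((‖u k n‖ + ‖u' k n‖) * ((Real.sqrt n)⁻¹ * Real.exp (-(c * n * X)))) := by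
  have hn1 := one_le_cast n
  have hk0 : 0 < k := hα.trans_le hk.1
  have hβ0 : 0 < β := hk0.trans_le hk.2
  have hD : 0 ≤ D := (abs_nonneg _).trans (he n)
  have hdec := hr k hk n
  rw [rate_of_lt hn] at hdec
  set κ := decay d n₀ k n with hκ
  have hcn : c ≤ c * n := le_mul_of_one_le_right hc.le hn1
  have hcn0 : 0 < c * n := hc.trans_le hcn
  have hE : Real.exp (-(κ * X)) ≤ Real.exp (-(c * n * X)) := by
    rw [Real.exp_le_exp, neg_le_neg_iff]
    refine mul_le_mul_of_nonneg_right ?_ hX.le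
    linarith
  have hE2 : Real.exp (-(κ * X)) * (k / κ * X) ≤ β / c ^ 2 * Real.exp (-(c * n * X)) := by
    have h1 : Real.exp (-(κ * X)) ≤ Real.exp (-(c * n * X)) * Real.exp (-(c * n * X)) := by
      rw [← Real.exp_add, Real.exp_le_exp]
      nlinarith
    have h2 : Real.exp (-(c * n * X)) * (c * n * X) ≤ 1 := by
      have h3 := Real.add_one_le_exp (c * n * X)
      rw [Real.exp_neg, inv_mul_le_iff₀ (Real.exp_pos _)]
      linarith
    have h4 : k / κ ≤ β / c := by
      refine div_le_div₀ hβ0.le hk.2 hc ?_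
      linarith
    have h5 : Real.exp (-(c * n * X)) * X ≤ 1 / c := by
      rw [le_div_iff₀ hc]
      refine le_trans ?_ h2
      rw [mul_assoc]
      refine mul_le_mul_of_nonneg_left ?_ (Real.exp_pos _).le
      rw [mul_comm X c]
      exact mul_le_mul_of_nonneg_right hcn hX.le
    have h6 : 0 ≤ k / κ * X := by
      have : 0 < κ := by linarith
      positivity
    calc Real.exp (-(κ * X)) * (k / κ * X)
        ≤ (Real.exp (-(c * n * X)) * Real.exp (-(c * n * X))) * (β / c * X) := by gcongr
      _ = β / c * Real.exp (-(c * n * X)) * (Real.exp (-(c * n * X)) * X) := by ring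
      _ ≤ β / c * Real.exp (-(c * n * X)) * (1 / c) := by gcongr
      _ = β / c ^ 2 * Real.exp (-(c * n * X)) := by field_simp
  have hE2' : 0 ≤ Real.exp (-(κ * X)) * (k / κ * X) := by
    have : 0 < κ := by linarith
    positivity
  have hs : 0 ≤ (Real.sqrt n)⁻¹ := by positivity
  set q := Real.exp (-(c * n * X)) with hq
  have hq0 : 0 < q := Real.exp_pos _
  have hb : 0 ≤ β / c ^ 2 := by positivity
  set U := ‖u k n‖ with hU
  set U' := ‖u' k n‖ with hU'
  have hU0 : 0 ≤ U := norm_nonneg _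
  have hU0' : 0 ≤ U' := norm_nonneg _
  constructor
  · rw [evanTerm, norm_mul, norm_mul, norm_mul, Complex.norm_real, Complex.norm_real,
      Complex.norm_real, Real.norm_of_nonneg hs, Real.norm_of_nonneg (Real.exp_pos _).le,
      Real.norm_eq_abs]
    calc (Real.sqrt n)⁻¹ * U * Real.exp (-(κ * X)) * |e n|
        ≤ (Real.sqrt n)⁻¹ * U * q * D := by gcongr; exact he n
      _ = 1 * D * (U * ((Real.sqrt n)⁻¹ * q)) := by ring
      _ ≤ (1 + β / c ^ 2) * D * ((U + U') * ((Real.sqrt n)⁻¹ * q)) := by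
          gcongr <;> linarith
  · rw [evanTermDeriv, norm_mul, Complex.norm_real, Real.norm_eq_abs]
    have h1 : ‖(((Real.sqrt n)⁻¹ : ℝ) : ℂ) * u' k n * (Real.exp (-(κ * X)) : ℂ) +
        (((Real.sqrt n)⁻¹ : ℝ) : ℂ) * u k n *
          ((Real.exp (-(κ * X)) * (k / κ * X) : ℝ) : ℂ)‖ ≤
        (Real.sqrt n)⁻¹ * U' * q + (Real.sqrt n)⁻¹ * U * (β / c ^ 2 * q) := by
      refine (norm_add_le _ _).trans ?_
      rw [norm_mul, norm_mul, norm_mul, norm_mul, Complex.norm_real, Complex.norm_real,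
        Complex.norm_real, Real.norm_of_nonneg hs, Real.norm_of_nonneg (Real.exp_pos _).le,
        Real.norm_of_nonneg hE2']
      gcongr
    calc _ ≤ ((Real.sqrt n)⁻¹ * U' * q + (Real.sqrt n)⁻¹ * U * (β / c ^ 2 * q)) * D := by
          gcongr; exact he n
      _ = D * ((1 * U' + β / c ^ 2 * U) * ((Real.sqrt n)⁻¹ * q)) := by ring
      _ ≤ D * (((1 + β / c ^ 2) * (U + U')) * ((Real.sqrt n)⁻¹ * q)) := by
          gcongr
          nlinarith [mul_nonneg hb hU0']
      _ = _ := by ring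

theorem hasDerivAt_evanTerm {u u' : ℝ → Seq} (hu : HasC1Seq α β u u') (X : ℝ) (e : ℕ+ → ℝ)
    {n : ℕ+} (hn : N < n) {k : ℝ} (hk : k ∈ Ioo α β) (hr : 0 < rate d n₀ N k n) :
    HasDerivAt (evanTerm d n₀ u X e n) (evanTermDeriv d n₀ u u' X e n k) k := by
  have h1 := hasDerivAt_rate hr
  simp only [rate_of_lt hn, modeSign, if_neg (not_le.2 hn)] at h1
  have h2 := ((h1.mul_const X).neg.exp).ofReal_comp
  have h3 := (((((hu.coord n).deriv k hk).const_mul (((Real.sqrt n)⁻¹ : ℝ) : ℂ))).mul h2).mul_const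
    (e n : ℂ)
  refine h3.congr_deriv ?_
  simp only [evanTermDeriv, Pi.neg_apply]
  push_cast
  ring

theorem continuousOn_evanTerm {u u' : ℝ → Seq} (hu : HasC1Seq α β u u') (X : ℝ) (e : ℕ+ → ℝ)
    (n : ℕ+) : ContinuousOn (evanTerm d n₀ u X e n) (Icc α β) := by
  have h1 : Continuous fun k => decay d n₀ k n := by unfold decay; fun_prop
  have h2 : Continuous fun k => (Real.exp (-(decay d n₀ k n * X)) : ℂ) := by fun_prop
  exact ((continuousOn_const.mul (hu.coord n).cont).mul h2.continuousOn).mul continuousOn_const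

theorem continuousOn_evanTermDeriv {u u' : ℝ → Seq} (hu : HasC1Seq α β u u') (X : ℝ)
    (e : ℕ+ → ℝ) {n : ℕ+} (hn : N < n) (hr : ∀ k ∈ Icc α β, 0 < rate d n₀ N k n) :
    ContinuousOn (evanTermDeriv d n₀ u u' X e n) (Icc α β) := by
  have h1 : Continuous fun k => decay d n₀ k n := by unfold decay; fun_prop
  have h2 : Continuous fun k => (Real.exp (-(decay d n₀ k n * X)) : ℂ) := by fun_prop
  have h3 : ContinuousOn (fun k => ((Real.exp (-(decay d n₀ k n * X)) *
      (k / decay d n₀ k n * X) : ℝ) : ℂ)) (Icc α β) := by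
    refine Complex.continuous_ofReal.comp_continuousOn (ContinuousOn.mul
      (Continuous.continuousOn (by fun_prop)) (ContinuousOn.mul
        (continuousOn_id.div h1.continuousOn fun k hk => ?_) continuousOn_const))
    rw [← rate_of_lt hn]; exact (hr k hk).ne'
  exact (((continuousOn_const.mul (hu.coord n).cont').mul h2.continuousOn).add
    ((continuousOn_const.mul (hu.coord n).cont).mul h3)).mul continuousOn_const

theorem summable_exp_neg {c : ℝ} (hc : 0 < c) : Summable fun n : ℕ+ => Real.exp (-(c * n)) := by
  have h1 : Summable fun n : ℕ => Real.exp (n * (-c)) := Real.summable_exp_nat_mul_iff.2 (by linarith)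
  refine (h1.comp_injective PNat.coe_injective).congr fun n => ?_
  rw [Function.comp_apply]; congr 1; ring

/-- The evanescent part decays exponentially away from the interface, is square integrable up to
the interface, and is continuously differentiable in `k` with the same bounds. -/
theorem exists_hasC1_evan (h : Gap d n₀ N α β) {u u' : ℝ → Seq} (hu : HasC1Seq α β u u') {D : ℝ}
    (hD : 0 ≤ D) : ∃ C c, 0 ≤ C ∧ 0 < c ∧ ∀ X, 0 < X → ∀ e : ℕ+ → ℝ, (∀ n, |e n| ≤ D) →
      (∀ k ∈ Icc α β, Summable fun n : Ioi N => evanTerm d n₀ u X e n k) ∧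
      ∃ F', HasC1 α β (evan d n₀ N u X e) F' ∧ ∀ k ∈ Icc α β,
        ‖evan d n₀ N u X e k‖ ≤ C * (X ^ (-(1 / 4) : ℝ) * Real.exp (-(c * X))) ∧
        ‖F' k‖ ≤ C * (X ^ (-(1 / 4) : ℝ) * Real.exp (-(c * X))) := by
  obtain ⟨c₀, hc₀, hr₀⟩ := exists_le_rate h
  obtain ⟨K, hK0, hK⟩ := hu.exists_bound
  obtain ⟨Z, hZ0, hZ⟩ := exists_tsum_weight_le
  set c := c₀ / 2 with hc
  have hc0 : 0 < c := by positivity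
  have hr : ∀ k ∈ Icc α β, ∀ n : ℕ+, 2 * c * n ≤ rate d n₀ N k n := by
    intro k hk n
    have := hr₀ k hk n
    rwa [hc, mul_div_cancel₀ _ (two_ne_zero)]
  have hpos : ∀ k ∈ Icc α β, ∀ n : ℕ+, 0 < rate d n₀ N k n := fun k hk n =>
    (by have := one_le_cast n; positivity : 0 < 2 * c * (n : ℝ)).trans_le (hr k hk n)
  have hβ0 : 0 < β := h.α_pos.trans h.lt
  set C₁ := (1 + β / c ^ 2) * D with hC₁
  have hC₁0 : 0 ≤ C₁ := by positivity
  set C₂ := (c / 2) ^ (-(1 / 4) : ℝ) with hC₂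
  have hC₂0 : 0 ≤ C₂ := by positivity
  refine ⟨C₁ * (C₂ * (2 * (K * Z))), c / 2, by positivity, by positivity, fun X hX e he => ?_⟩
  have hbd := fun (n : Ioi N) (k : ℝ) (hk : k ∈ Icc α β) =>
    norm_evanTerm_le (d := d) (n₀ := n₀) hc0 hr u u' hX he n.2 hk h.α_pos
  set B := X ^ (-(1 / 4) : ℝ) * Real.exp (-(c / 2 * X)) with hB
  have hB0 : 0 ≤ B := by positivity
  -- Two majorants: T depends on k and sums, by Cauchy–Schwarz, to a multiple of B; U is cruder but
  -- independent of k, as needed for termwise continuity and differentiation at fixed X.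
  set T : ℝ → ℕ+ → ℝ := fun k n => C₁ *
    ((‖u k n‖ + ‖u' k n‖) * ((Real.sqrt n)⁻¹ * Real.exp (-(c * n * X)))) with hT
  set U : ℕ+ → ℝ := fun n => C₁ * (2 * K) * Real.exp (-(c * X * n)) with hU
  have hT0 : ∀ k n, 0 ≤ T k n := fun k n => by simp only [hT]; positivity
  have hTU : ∀ k ∈ Icc α β, ∀ n, T k n ≤ U n := by
    intro k hk n
    have h1 := (lp.norm_apply_le_norm two_ne_zero (u k) n).trans (hK k hk).1
    have h2 := (lp.norm_apply_le_norm two_ne_zero (u' k) n).trans (hK k hk).2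
    have h3 : (Real.sqrt n)⁻¹ ≤ 1 := inv_le_one_of_one_le₀ (one_le_sqrt n)
    simp only [hT, hU]
    calc C₁ * ((‖u k n‖ + ‖u' k n‖) * ((Real.sqrt n)⁻¹ * Real.exp (-(c * n * X))))
        ≤ C₁ * ((K + K) * (1 * Real.exp (-(c * n * X)))) := by gcongr
      _ = _ := by rw [mul_right_comm c X]; ring
  have hUs : Summable U := (summable_exp_neg (mul_pos hc0 hX)).mul_left _
  have hUs' : Summable fun n : Ioi N => U n := hUs.comp_injective Subtype.val_injective
  have hTs : ∀ k ∈ Icc α β, Summable (T k) := fun k hk =>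
    Summable.of_nonneg_of_le (hT0 k) (hTU k hk) hUs
  have hTsum : ∀ k ∈ Icc α β, ∑' n, T k n ≤ C₁ * (C₂ * (2 * (K * Z))) * B := by
    intro k hk
    obtain ⟨s1, l1⟩ := hZ (u k)
    obtain ⟨s2, l2⟩ := hZ (u' k)
    have l1' : ‖u k‖ * Z ≤ K * Z := mul_le_mul_of_nonneg_right (hK k hk).1 hZ0
    have l2' : ‖u' k‖ * Z ≤ K * Z := mul_le_mul_of_nonneg_right (hK k hk).2 hZ0
    calc ∑' n, T k n ≤ ∑' n : ℕ+, C₁ * (C₂ * B) * (‖u k n‖ * (n : ℝ) ^ (-(3 / 4) : ℝ) +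
          ‖u' k n‖ * (n : ℝ) ^ (-(3 / 4) : ℝ)) := by
          refine Summable.tsum_le_tsum (fun n => ?_) (hTs k hk) ((s1.add s2).mul_left _)
          calc T k n ≤ C₁ * ((‖u k n‖ + ‖u' k n‖) * (C₂ * B * (n : ℝ) ^ (-(3 / 4) : ℝ))) := by
                simp only [hT]
                exact mul_le_mul_of_nonneg_left (mul_le_mul_of_nonneg_left
                  (inv_sqrt_mul_exp_le hc0 hX n) (by positivity)) hC₁0
            _ = _ := by ring
      _ = C₁ * (C₂ * B) * (∑' n : ℕ+, ‖u k n‖ * (n : ℝ) ^ (-(3 / 4) : ℝ) +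
          ∑' n : ℕ+, ‖u' k n‖ * (n : ℝ) ^ (-(3 / 4) : ℝ)) := by
          rw [tsum_mul_left, s1.tsum_add s2]
      _ ≤ C₁ * (C₂ * B) * (K * Z + K * Z) := by gcongr <;> linarith
      _ = _ := by ring
  have hnorm : ∀ k ∈ Icc α β, ∀ f : Ioi N → ℂ, (∀ n, ‖f n‖ ≤ T k n) →
      ‖∑' n, f n‖ ≤ C₁ * (C₂ * (2 * (K * Z))) * B := by
    intro k hk f hf
    have s1 : Summable fun n : Ioi N => T k n := (hTs k hk).comp_injective Subtype.val_injective
    calc ‖∑' n, f n‖ ≤ ∑' n : Ioi N, T k n := tsum_of_norm_bounded s1.hasSum hf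
      _ ≤ ∑' n, T k n := Summable.tsum_subtype_le (T k) (Ioi N) (hT0 k) (hTs k hk)
      _ ≤ _ := hTsum k hk
  have hsum : ∀ k ∈ Icc α β, Summable fun n : Ioi N => evanTerm d n₀ u X e n k := fun k hk =>
    Summable.of_norm_bounded hUs' fun n => ((hbd n k hk).1).trans (hTU k hk n)
  have hmid : (α + β) / 2 ∈ Ioo α β := ⟨by linarith [h.lt], by linarith [h.lt]⟩
  refine ⟨hsum, fun k => ∑' n : Ioi N, evanTermDeriv d n₀ u u' X e n k, ⟨?_, ?_, ?_⟩, ?_⟩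
  · exact continuousOn_tsum (fun n => continuousOn_evanTerm hu X e n) hUs'
      fun n k hk => ((hbd n k hk).1).trans (hTU k hk n)
  · exact continuousOn_tsum (fun n => continuousOn_evanTermDeriv hu X e n.2 fun k hk =>
      hpos k hk n) hUs' fun n k hk => ((hbd n k hk).2).trans (hTU k hk n)
  · intro k hk
    exact hasDerivAt_tsum_of_isPreconnected hUs' isOpen_Ioo isPreconnected_Ioo
      (fun n k hk => hasDerivAt_evanTerm hu X e n.2 hk (hpos k (Ioo_subset_Icc_self hk) n))
      (fun n k hk => ((hbd n k (Ioo_subset_Icc_self hk)).2).trans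
        (hTU k (Ioo_subset_Icc_self hk) n)) hmid (hsum _ (Ioo_subset_Icc_self hmid)) hk
  · intro k hk
    exact ⟨hnorm k hk _ fun n => (hbd n k hk).1, hnorm k hk _ fun n => (hbd n k hk).2⟩

variable {a : ℝ → ℂ}

/-- The evanescent factor belongs to the amplitude, so the phase is -(μ_{n₀} + k²)t alone, with
derivative at least 2α|t| in modulus. -/
theorem exists_norm_integral_evan_le (h : Gap d n₀ N α β) (hac : ContDiff ℝ 1 a)
    (ha : ∀ k ∉ Icc α β, a k = 0) {u u' : ℝ → Seq} (hu : HasC1Seq α β u u') {D : ℝ}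
    (hD : 0 ≤ D) : ∃ C c, 0 ≤ C ∧ 0 < c ∧ ∀ X, 0 < X → ∀ e : ℕ+ → ℝ, (∀ n, |e n| ≤ D) → ∀ t : ℝ,
      ‖∫ k, amplitude d n₀ a t k * evan d n₀ N u X e k‖ ≤
        C * (X ^ (-(1 / 4) : ℝ) * Real.exp (-(c * X))) ∧
      (t ≠ 0 → ‖∫ k, amplitude d n₀ a t k * evan d n₀ N u X e k‖ ≤
        C * (X ^ (-(1 / 4) : ℝ) * Real.exp (-(c * X))) / |t|) := by
  obtain ⟨C, c, hC0, hc0, H⟩ := exists_hasC1_evan h hu hD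
  have haC1 := hasC1_of_contDiff (α := α) (β := β) hac
  obtain ⟨A, hA0, hA⟩ := haC1.exists_bound
  obtain ⟨h1, h2⟩ := boundary_zero hac.continuous ha
  have hα := h.α_pos
  have hlen : 0 ≤ β - α := by linarith [h.lt]
  -- The first entry is the trivial bound. The second is the integration by parts with M = 2A(CB)
  -- from the product rule, s = 2α|t| and K = 1/α, because |φ''| = 2|t|.
  set C' := max ((β - α) * (A * C)) ((β - α) * (2 * A * C * (1 + 1 / α) / (2 * α))) with hC'
  refine ⟨C', c, le_max_of_le_left (by positivity), hc0, fun X hX e he t => ?_⟩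
  obtain ⟨-, F', hF, hFb⟩ := H X hX e he
  set B := X ^ (-(1 / 4) : ℝ) * Real.exp (-(c * X)) with hB
  have hB0 : 0 ≤ B := by positivity
  rw [integral_amplitude_mul' h.lt.le ha]
  constructor
  · have h3 := intervalIntegral.norm_integral_le_of_norm_le_const (a := α) (b := β)
      (f := fun k => amplitude d n₀ a t k * evan d n₀ N u X e k) (C := A * (C * B)) (fun k hk => by
        rw [uIoc_of_le h.lt.le] at hk
        have hk' := Ioc_subset_Icc_self hk
        have e1 : ‖amplitude d n₀ a t k‖ ≤ A := by
          have : amplitude d n₀ a t k = a k *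
              Complex.exp (Complex.I * ((-((mu d n₀ + k ^ 2) * t) : ℝ) : ℂ)) := by
            rw [amplitude]; congr 2; push_cast; ring
          rw [this, norm_mul, Complex.norm_exp_I_mul_ofReal, mul_one]
          exact (hA k hk').1
        rw [norm_mul]
        exact mul_le_mul e1 (hFb k hk').1 (norm_nonneg _) hA0)
    rw [abs_of_nonneg hlen] at h3
    calc _ ≤ A * (C * B) * (β - α) := h3
      _ = (β - α) * (A * C) * B := by ring
      _ ≤ C' * B := mul_le_mul_of_nonneg_right (le_max_left _ _) hB0
  · intro ht
    have ht0 : 0 < |t| := abs_pos.2 ht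
    have key := norm_integral_mul_exp_le h.lt.le (M := 2 * A * (C * B)) (s := 2 * α * |t|)
      (K := 1 / α) (haC1.mul hF) (by simp [h1]) (by simp [h2])
      (φ := fun k => -(Complex.I * ((mu d n₀ + k ^ 2 : ℝ) : ℂ) * (t : ℂ)))
      (φ' := fun k => -(Complex.I * ((2 * k : ℝ) : ℂ) * (t : ℂ)))
      (φ'' := fun _ => -(Complex.I * ((2 : ℝ) : ℂ) * (t : ℂ)))
      (fun k hk => by
        obtain ⟨a1, a2⟩ := hA k hk
        obtain ⟨f1, f2⟩ := hFb k hk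
        constructor
        · rw [norm_mul]
          calc ‖a k‖ * ‖evan d n₀ N u X e k‖ ≤ A * (C * B) := mul_le_mul a1 f1 (norm_nonneg _) hA0
            _ ≤ 2 * A * (C * B) := by
              have : 0 ≤ A * (C * B) := by positivity
              linarith
        · refine (norm_add_le _ _).trans ?_
          rw [norm_mul, norm_mul]
          calc _ ≤ A * (C * B) + A * (C * B) := by gcongr
            _ = _ := by ring)
      (fun k _ => by
        have h2 : HasDerivAt (fun k : ℝ => mu d n₀ + k ^ 2) (2 * k) k := by
          simpa using ((hasDerivAt_id k).pow 2).const_add (mu d n₀)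
        exact ((h2.ofReal_comp.const_mul Complex.I).mul_const (t : ℂ)).neg)
      (fun k _ => by
        have h2 : HasDerivAt (fun k : ℝ => 2 * k) 2 k := by
          simpa using (hasDerivAt_id k).const_mul 2
        exact ((h2.ofReal_comp.const_mul Complex.I).mul_const (t : ℂ)).neg)
      continuousOn_const
      (fun k _ => by simp [Complex.mul_re, Complex.mul_im, pow_two])
      (by positivity)
      (fun k hk => by
        have hk0 : 0 < k := hα.trans_le hk.1
        rw [norm_neg, norm_mul, norm_mul, Complex.norm_I, one_mul, Complex.norm_real,
          Complex.norm_real, Real.norm_of_nonneg (by positivity), Real.norm_eq_abs]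
        gcongr
        exact hk.1)
      (fun k hk => by
        rw [norm_neg, norm_mul, norm_mul, Complex.norm_I, one_mul, Complex.norm_real,
          Complex.norm_real, Real.norm_of_nonneg (by positivity), Real.norm_eq_abs]
        apply le_of_eq; field_simp)
    have e1 : ∫ k in α..β, amplitude d n₀ a t k * evan d n₀ N u X e k =
        ∫ k in α..β, a k * evan d n₀ N u X e k *
          Complex.exp (-(Complex.I * ((mu d n₀ + k ^ 2 : ℝ) : ℂ) * (t : ℂ))) := by
      refine intervalIntegral.integral_congr fun k _ => ?_
      simp only [amplitude]; ring
    rw [e1]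
    refine key.trans ?_
    calc _ = (β - α) * (2 * A * C * (1 + 1 / α) / (2 * α)) * B / |t| := by field_simp
      _ ≤ _ := by
        gcongr
        exact le_max_right _ _

end Evanescent

/-! ### From pointwise bounds to norms on the waveguide -/

section Norms

theorem volOmega_eq (d : ℝ) :
    volOmega d = (volume : Measure ℝ).prod (volume.restrict (Ioo 0 d)) := by
  rw [volOmega, Measure.volume_eq_prod, ← Measure.prod_restrict, Measure.restrict_univ]

instance (d : ℝ) : SFinite (volOmega d) := by rw [volOmega_eq]; infer_instance

theorem ae_fst_ne_zero (d : ℝ) : ∀ᵐ p ∂volOmega d, p.1 ≠ 0 := by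
  rw [volOmega_eq]
  have h : ∀ᵐ x : ℝ, x ≠ 0 := by simp [ae_iff]
  exact Measure.quasiMeasurePreserving_fst.ae h

/-- The majorant depends on x only, so integration over y contributes the factor d; the line x = 0
is a null set. -/
theorem eLpNorm_le_sqrt_integral {d : ℝ} (hd : 0 < d) {f : ℝ × ℝ → ℂ} {g : ℝ → ℝ}
    (hg : Integrable g) (hg0 : ∀ x, 0 ≤ g x) (hf : ∀ p : ℝ × ℝ, p.1 ≠ 0 → ‖f p‖ ^ 2 ≤ g p.1) :
    eLpNorm f 2 (volOmega d) ≤ ENNReal.ofReal (Real.sqrt (d * ∫ x, g x)) := by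
  rw [eLpNorm_eq_lintegral_rpow_enorm_toReal two_ne_zero ENNReal.ofNat_ne_top, Real.sqrt_eq_rpow,
    ← ENNReal.ofReal_rpow_of_nonneg (mul_nonneg hd.le (integral_nonneg hg0)) (by norm_num)]
  simp only [ENNReal.toReal_ofNat, ENNReal.rpow_ofNat]
  refine ENNReal.rpow_le_rpow ?_ (by norm_num)
  have h1 : d * ∫ x, g x = ∫ p, g p.1 ∂(volOmega d) := by
    rw [volOmega_eq, integral_fun_fst]
    simp [hd.le]
  rw [h1, ofReal_integral_eq_lintegral_ofReal]
  · refine lintegral_mono_ae ?_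
    filter_upwards [ae_fst_ne_zero d] with p hp
    rw [← ofReal_norm, ← ENNReal.ofReal_pow (norm_nonneg _)]
    exact ENNReal.ofReal_le_ofReal (hf p hp)
  · rw [volOmega_eq]; exact hg.comp_fst _
  · exact ae_of_all _ fun p => hg0 p.1

theorem integrable_abs_rpow_mul_exp {c : ℝ} (hc : 0 < c) :
    Integrable fun x : ℝ => (|x| ^ (-(1 / 4) : ℝ) * Real.exp (-(c * |x|))) ^ 2 := by
  have h0 : IntegrableOn (fun x : ℝ => (|x| ^ (-(1 / 4) : ℝ) * Real.exp (-(c * |x|))) ^ 2)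
      (Ioi 0) := by
    have h1 := integrableOn_rpow_mul_exp_neg_mul_rpow (s := -(1 / 2)) (p := 1) (b := 2 * c)
      (by norm_num) (by norm_num) (by positivity)
    refine h1.congr_fun (fun x hx => ?_) measurableSet_Ioi
    have hx0 : (0 : ℝ) < x := hx
    simp only [Real.rpow_one]
    rw [abs_of_pos hx0, mul_pow, ← Real.rpow_natCast, ← Real.rpow_mul hx0.le, ← Real.exp_nat_mul]
    congr 2
    · norm_num
    · push_cast; ring
  rw [← integrableOn_univ, ← Iic_union_Ioi (a := (0 : ℝ)), integrableOn_union]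
  refine ⟨?_, h0⟩
  rw [integrableOn_Iic_iff_integrableOn_Iio]
  have h2 := h0.comp_neg
  simpa using h2

/-- The square root of an integrable profile bounds the norm of a function decaying like
`1 / (T + |x|)` up to an exponentially localized part. -/
theorem exists_eLpNorm_le {d : ℝ} (hd : 0 < d) {c : ℝ} (hc : 0 < c) (C₁ C₂ : ℝ) :
    ∃ C, 0 ≤ C ∧ ∀ T, 0 < T → ∀ f : ℝ × ℝ → ℂ,
      (∀ p : ℝ × ℝ, p.1 ≠ 0 → ∃ E, 0 ≤ E ∧ ‖f p‖ ≤ C₁ / (T + |p.1|) + E ∧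
        E ≤ C₂ * (|p.1| ^ (-(1 / 4) : ℝ) * Real.exp (-(c * |p.1|))) ∧
        E ≤ C₂ * (|p.1| ^ (-(1 / 4) : ℝ) * Real.exp (-(c * |p.1|))) / T) →
      eLpNorm f 2 (volOmega d) ≤ ENNReal.ofReal (C * T ^ (-(1 / 2) : ℝ)) := by
  set B : ℝ → ℝ := fun x => |x| ^ (-(1 / 4) : ℝ) * Real.exp (-(c * |x|)) with hB
  have hBi : Integrable fun x => B x ^ 2 := integrable_abs_rpow_mul_exp hc
  set J := 2 * C₁ ^ 2 * Real.pi + 2 * C₂ ^ 2 * ∫ x, B x ^ 2 with hJ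
  have hI : 0 ≤ ∫ x, B x ^ 2 := integral_nonneg fun x => sq_nonneg _
  have hJ0 : 0 ≤ J := by have := Real.pi_pos; positivity
  refine ⟨Real.sqrt (d * J), Real.sqrt_nonneg _, fun T hT f hf => ?_⟩
  -- Since (T + |x|)² ≥ T² + x², the free part is dominated by a Lorentzian of width T; both
  -- summands have integral of order 1 / T.
  set g : ℝ → ℝ := fun x => 2 * C₁ ^ 2 / T ^ 2 * (1 + (x / T) ^ 2)⁻¹ + 2 * C₂ ^ 2 / T * B x ^ 2
    with hg
  have hi1 : Integrable fun x : ℝ => (1 + (x / T) ^ 2)⁻¹ :=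
    integrable_inv_one_add_sq.comp_div hT.ne'
  have hgi : Integrable g := (hi1.const_mul _).add (hBi.const_mul _)
  have hint : ∫ x, g x = J / T := by
    rw [hg, integral_add (hi1.const_mul _) (hBi.const_mul _), integral_const_mul,
      integral_const_mul, Measure.integral_comp_div (fun x : ℝ => (1 + x ^ 2)⁻¹),
      integral_univ_inv_one_add_sq, abs_of_pos hT, smul_eq_mul, hJ]
    field_simp
  have key := eLpNorm_le_sqrt_integral hd hgi (fun x => by positivity) (f := f) (fun p hp => by
    obtain ⟨E, hE0, h1, h2, h3⟩ := hf p hp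
    have hx : 0 ≤ |p.1| := abs_nonneg _
    -- One factor E takes the bound without T and the other the bound with 1 / T. The resulting rate
    -- 1 / T holds for all T > 0, small T included.
    have h4 : E ^ 2 ≤ C₂ ^ 2 / T * B p.1 ^ 2 := by
      have h5 : E * E ≤ (C₂ * B p.1) * (C₂ * B p.1 / T) :=
        mul_le_mul h2 h3 hE0 (hE0.trans h2)
      calc E ^ 2 = E * E := sq E
        _ ≤ _ := h5
        _ = _ := by ring
    have h6 : (C₁ / (T + |p.1|)) ^ 2 ≤ C₁ ^ 2 / T ^ 2 * (1 + (p.1 / T) ^ 2)⁻¹ := by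
      have e : C₁ ^ 2 / T ^ 2 * (1 + (p.1 / T) ^ 2)⁻¹ = C₁ ^ 2 / (T ^ 2 + |p.1| ^ 2) := by
        rw [sq_abs]
        have : T ^ 2 + p.1 ^ 2 ≠ 0 := by positivity
        field_simp
      rw [e, div_pow]
      refine div_le_div_of_nonneg_left (sq_nonneg _) (by positivity) ?_
      nlinarith [mul_nonneg hT.le hx]
    calc ‖f p‖ ^ 2 ≤ (C₁ / (T + |p.1|) + E) ^ 2 := pow_le_pow_left₀ (norm_nonneg _) h1 2
      _ ≤ 2 * (C₁ / (T + |p.1|)) ^ 2 + 2 * E ^ 2 := by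
        nlinarith [sq_nonneg (C₁ / (T + |p.1|) - E)]
      _ ≤ 2 * (C₁ ^ 2 / T ^ 2 * (1 + (p.1 / T) ^ 2)⁻¹) + 2 * (C₂ ^ 2 / T * B p.1 ^ 2) := by
        gcongr
      _ = g p.1 := by simp only [hg]; ring)
  refine key.trans (le_of_eq ?_)
  rw [hint, ← mul_div_assoc, Real.sqrt_div (by positivity), Real.rpow_neg hT.le,
    ← Real.sqrt_eq_rpow, div_eq_mul_inv]

end Norms

/-! ### Decomposition of the wave packet -/

section Decomposition

variable {d : ℝ} {n₀ N : ℕ+} {α β : ℝ} {a : ℝ → ℂ}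

/-- On `[α, β]` the coefficients `r`, `tr` are given by continuously differentiable families of
weighted square-summable sequences. -/
structure SmoothCoeffs (n₀ : ℕ+) (α β : ℝ) (u u' v v' : ℝ → Seq) (r tr : ℝ → ℕ+ → ℂ) : Prop where
  hasC1_u : HasC1Seq α β u u'
  hasC1_v : HasC1Seq α β v v'
  r_eq : ∀ k ∈ Icc α β, ∀ n, r k n =
    (((Real.sqrt n)⁻¹ : ℝ) : ℂ) * u k n - if n = n₀ then 1 else 0
  tr_eq : ∀ k ∈ Icc α β, ∀ n, tr k n = (((Real.sqrt n)⁻¹ : ℝ) : ℂ) * v k n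

/-- By uniqueness any family of scattering coefficients coincides on [α, β] with the solution of the
variational problem, so its regularity in k comes for free. -/
theorem exists_smoothCoeffs (h : Gap d n₀ N α β) {r tr : ℝ → ℕ+ → ℂ}
    (hs : ∀ k ∈ Icc α β, IsScattering d n₀ k (r k) (tr k)) :
    ∃ u u' v v', SmoothCoeffs n₀ α β u u' v v' r tr := by
  have hd := h.d_pos
  obtain ⟨h1, u', h2, h3⟩ := exists_deriv_coeff_solution _ _
    (norm_sq_eq (basisMinus hd) (basisPlus hd)) h (coeffFst (basisMinus hd) (basisPlus hd))
  obtain ⟨h4, v', h5, h6⟩ := exists_deriv_coeff_solution _ _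
    (norm_sq_eq (basisMinus hd) (basisPlus hd)) h (coeffSnd (basisMinus hd) (basisPlus hd))
  exact ⟨_, u', _, v', ⟨h1, h2, h3⟩, ⟨h4, h5, h6⟩,
    fun k hk => (eq_waveTrace_of_isScattering h hk (hs k hk)).1,
    fun k hk => (eq_waveTrace_of_isScattering h hk (hs k hk)).2⟩

theorem HasC1.congr {c c₁ c' : ℝ → ℂ} (h : HasC1 α β c c') (he : ∀ k ∈ Icc α β, c₁ k = c k) :
    HasC1 α β c₁ c' :=
  ⟨h.cont.congr he, h.cont', fun k hk => (h.deriv k hk).congr_of_eventuallyEq (by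
    filter_upwards [Ioo_mem_nhds hk.1 hk.2] with l hl
    exact he l (Ioo_subset_Icc_self hl))⟩

variable {u u' v v' : ℝ → Seq} {r tr : ℝ → ℕ+ → ℂ}

theorem SmoothCoeffs.hasC1_r (hs : SmoothCoeffs n₀ α β u u' v v' r tr) (n : ℕ+) :
    HasC1 α β (fun k => r k n) (fun k => (((Real.sqrt n)⁻¹ : ℝ) : ℂ) * u' k n) :=
  (((hs.hasC1_u.coord n).const_mul _).sub_const _).congr fun k hk => hs.r_eq k hk n

theorem SmoothCoeffs.hasC1_tr (hs : SmoothCoeffs n₀ α β u u' v v' r tr) (n : ℕ+) :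
    HasC1 α β (fun k => tr k n) (fun k => (((Real.sqrt n)⁻¹ : ℝ) : ℂ) * v' k n) :=
  ((hs.hasC1_v.coord n).const_mul _).congr fun k hk => hs.tr_eq k hk n

theorem integrable_amplitude_mul (hac : Continuous a) (ha : ∀ k ∉ Icc α β, a k = 0) (t : ℝ)
    {f : ℝ → ℂ} (hf : ContinuousOn f (Icc α β)) :
    Integrable fun k => amplitude d n₀ a t k * f k := by
  have hc : Continuous fun k => amplitude d n₀ a t k := by unfold amplitude; fun_prop
  refine (integrableOn_iff_integrable_of_support_subset (s := Icc α β) ?_).1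
    ((hc.continuousOn.mul hf).integrableOn_Icc)
  intro k hk
  by_contra hk'
  exact hk (by simp [amplitude_eq_zero ha t hk'])

theorem integral_amplitude_congr (ha : ∀ k ∉ Icc α β, a k = 0) (t : ℝ) {f g : ℝ → ℂ}
    (hfg : ∀ k ∈ Icc α β, f k = g k) :
    (fun k => amplitude d n₀ a t k * f k) = fun k => amplitude d n₀ a t k * g k := by
  funext k
  by_cases hk : k ∈ Icc α β
  · rw [hfg k hk]
  · rw [amplitude_eq_zero ha t hk, zero_mul, zero_mul]

theorem continuousOn_mode {c : ℝ → ℂ} (hc : ContinuousOn c (Icc α β)) (l : ℕ+) (x : ℝ) :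
    ContinuousOn (fun k => c k * Complex.exp (Complex.I * (momentum d n₀ k l : ℂ) * (x : ℂ)))
      (Icc α β) := by
  have hm : Continuous fun k => momentum d n₀ k l := by unfold momentum; fun_prop
  exact hc.mul (Continuous.continuousOn (by fun_prop))

theorem integral_modeSum (hac : Continuous a) (ha : ∀ k ∉ Icc α β, a k = 0) (t x : ℝ)
    {c : ℝ → ℕ+ → ℂ} (hc : ∀ n, ContinuousOn (fun k => c k n) (Icc α β)) (e : ℕ+ → ℝ)
    (s : Finset ℕ+) :
    ∫ k, amplitude d n₀ a t k * (∑ l ∈ s, c k l *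
      Complex.exp (Complex.I * (momentum d n₀ k l : ℂ) * (x : ℂ)) * (e l : ℂ)) =
    ∑ l ∈ s, modePacket d n₀ a (fun k => c k l) l t x * (e l : ℂ) := by
  simp_rw [Finset.mul_sum]
  rw [integral_finsetSum]
  · refine Finset.sum_congr rfl fun l _ => ?_
    simp_rw [← mul_assoc]
    rw [integral_mul_const, modePacket]
    simp_rw [← mul_assoc]
  · intro l _
    exact integrable_amplitude_mul hac ha t ((continuousOn_mode (hc l) l x).mul continuousOn_const)

/-- Written as a one-term mode sum, which is possible because k > 0 gives k_{n₀} = k, so that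
incoming, reflected and transmitted packets share one estimate. -/
theorem incomingPart_eq (h : Gap d n₀ N α β) {k : ℝ} (hk : k ∈ Icc α β) (x y : ℝ) :
    incomingPart d n₀ k x y =
      ∑ l ∈ {n₀}, 1 * Complex.exp (Complex.I * (momentum d n₀ k l : ℂ) * (x : ℂ)) *
        (chiMinus d l y : ℂ) := by
  rw [Finset.sum_singleton, momentum_self (h.α_pos.trans_le hk.1), incomingPart, one_mul]

theorem reflectedPart_eq (h : Gap d n₀ N α β) {k : ℝ} (hk : k ∈ Icc α β) (c : ℕ+ → ℂ) (x y : ℝ) :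
    reflectedPart d n₀ k c x y = ∑ l ∈ Finset.Icc 1 N, c l *
      Complex.exp (Complex.I * (momentum d n₀ k l : ℂ) * ((-x : ℝ) : ℂ)) *
        (chiMinus d l y : ℂ) := by
  rw [reflectedPart, topMode_eq h hk]
  refine Finset.sum_congr rfl fun l _ => ?_
  congr 3
  push_cast; ring

theorem transmittedPart_eq (h : Gap d n₀ N α β) {k : ℝ} (hk : k ∈ Icc α β) (c : ℕ+ → ℂ)
    (x y : ℝ) : transmittedPart d n₀ k c x y = ∑ l ∈ Finset.Icc 1 N, c l *
      Complex.exp (Complex.I * (momentum d n₀ k l : ℂ) * (x : ℂ)) * (chiPlus d l y : ℂ) := by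
  rw [transmittedPart, topMode_eq h hk]

theorem psiMinus_eq (h : Gap d n₀ N α β) (hac : Continuous a) (ha : ∀ k ∉ Icc α β, a k = 0)
    (t : ℝ) (p : ℝ × ℝ) : psiMinus d n₀ a t p =
      ∑ l ∈ {n₀}, modePacket d n₀ a (fun _ => 1) l t p.1 * (chiMinus d l p.2 : ℂ) := by
  rw [psiMinus, integral_amplitude_congr ha t fun k hk => incomingPart_eq h hk p.1 p.2]
  exact integral_modeSum hac ha t p.1 (c := fun _ _ => 1) (fun _ => continuousOn_const)
    (fun l => chiMinus d l p.2) _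

theorem psiDN_eq (h : Gap d n₀ N α β) (hac : Continuous a) (ha : ∀ k ∉ Icc α β, a k = 0)
    (hs : SmoothCoeffs n₀ α β u u' v v' r tr) (t : ℝ) (p : ℝ × ℝ) : psiDN d n₀ a r t p =
      ∑ l ∈ Finset.Icc 1 N, modePacket d n₀ a (fun k => r k l) l t (-p.1) *
        (chiMinus d l p.2 : ℂ) := by
  rw [psiDN, integral_amplitude_congr ha t fun k hk => reflectedPart_eq h hk (r k) p.1 p.2]
  exact integral_modeSum hac ha t (-p.1) (fun n => (hs.hasC1_r n).cont)
    (fun l => chiMinus d l p.2) _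

theorem psiND_eq (h : Gap d n₀ N α β) (hac : Continuous a) (ha : ∀ k ∉ Icc α β, a k = 0)
    (hs : SmoothCoeffs n₀ α β u u' v v' r tr) (t : ℝ) (p : ℝ × ℝ) : psiND d n₀ a tr t p =
      ∑ l ∈ Finset.Icc 1 N, modePacket d n₀ a (fun k => tr k l) l t p.1 *
        (chiPlus d l p.2 : ℂ) := by
  rw [psiND, integral_amplitude_congr ha t fun k hk => transmittedPart_eq h hk (tr k) p.1 p.2]
  exact integral_modeSum hac ha t p.1 (fun n => (hs.hasC1_tr n).cont)
    (fun l => chiPlus d l p.2) _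

theorem stationaryWave_of_neg (h : Gap d n₀ N α β) (hs : SmoothCoeffs n₀ α β u u' v v' r tr)
    {k : ℝ} (hk : k ∈ Icc α β) {x : ℝ} (hx : x < 0) (y : ℝ) :
    stationaryWave d n₀ k (r k) (tr k) x y = incomingPart d n₀ k x y +
      reflectedPart d n₀ k (r k) x y + evan d n₀ N u |x| (fun n => chiMinus d n y) k := by
  rw [stationaryWave, if_pos hx, topMode_eq h hk, evan]
  congr 1
  refine tsum_congr fun n => ?_
  -- The correction δ_{n,n₀} is absent from the evanescent modes since n > N ≥ n₀.
  have hn : (n : ℕ+) ≠ n₀ := (h.le.trans_lt n.2).ne'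
  rw [hs.r_eq k hk, if_neg hn, sub_zero, evanTerm, abs_of_neg hx, mul_neg, neg_neg]

theorem stationaryWave_of_pos (h : Gap d n₀ N α β) (hs : SmoothCoeffs n₀ α β u u' v v' r tr)
    {k : ℝ} (hk : k ∈ Icc α β) {x : ℝ} (hx : 0 < x) (y : ℝ) :
    stationaryWave d n₀ k (r k) (tr k) x y =
      transmittedPart d n₀ k (tr k) x y + evan d n₀ N v |x| (fun n => chiPlus d n y) k := by
  rw [stationaryWave, if_neg (not_lt.2 hx.le), topMode_eq h hk, evan]
  congr 1
  refine tsum_congr fun n => ?_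
  rw [hs.tr_eq k hk, evanTerm, abs_of_pos hx]

/-- The evanescent part of the wave packet. -/
def evanPacket (d : ℝ) (n₀ N : ℕ+) (a : ℝ → ℂ) (u : ℝ → Seq) (e : ℕ+ → ℝ → ℝ) (t : ℝ)
    (p : ℝ × ℝ) : ℂ :=
  ∫ k : ℝ, amplitude d n₀ a t k * evan d n₀ N u |p.1| (fun n => e n p.2) k

theorem continuousOn_evan (h : Gap d n₀ N α β) (hu : HasC1Seq α β u u') {D : ℝ} {e : ℕ+ → ℝ}
    (he : ∀ n, |e n| ≤ D) {X : ℝ} (hX : 0 < X) : ContinuousOn (evan d n₀ N u X e) (Icc α β) := by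
  obtain ⟨_, _, _, _, H⟩ := exists_hasC1_evan h hu ((abs_nonneg _).trans (he 1))
  obtain ⟨_, _, hF, _⟩ := H X hX e he
  exact hF.cont

theorem continuousOn_incomingPart (x y : ℝ) :
    ContinuousOn (fun k => incomingPart d n₀ k x y) (Icc α β) := by
  unfold incomingPart; exact Continuous.continuousOn (by fun_prop)

theorem continuousOn_reflectedPart (h : Gap d n₀ N α β)
    (hs : SmoothCoeffs n₀ α β u u' v v' r tr) (x y : ℝ) :
    ContinuousOn (fun k => reflectedPart d n₀ k (r k) x y) (Icc α β) :=
  (continuousOn_finsetSum _ fun l _ => (continuousOn_mode (hs.hasC1_r l).cont l (-x)).mul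
    continuousOn_const).congr fun _ hk => reflectedPart_eq h hk _ x y

theorem continuousOn_transmittedPart (h : Gap d n₀ N α β)
    (hs : SmoothCoeffs n₀ α β u u' v v' r tr) (x y : ℝ) :
    ContinuousOn (fun k => transmittedPart d n₀ k (tr k) x y) (Icc α β) :=
  (continuousOn_finsetSum _ fun l _ => (continuousOn_mode (hs.hasC1_tr l).cont l x).mul
    continuousOn_const).congr fun _ hk => transmittedPart_eq h hk _ x y

theorem continuousOn_stationaryWave (h : Gap d n₀ N α β)
    (hs : SmoothCoeffs n₀ α β u u' v v' r tr) {x : ℝ} (hx : x ≠ 0) (y : ℝ) :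
    ContinuousOn (fun k => stationaryWave d n₀ k (r k) (tr k) x y) (Icc α β) := by
  rcases lt_or_gt_of_ne hx with hx' | hx'
  · exact (((continuousOn_incomingPart x y).add (continuousOn_reflectedPart h hs x y)).add
      (continuousOn_evan h hs.hasC1_u (fun n => abs_chiMinus_le d n y) (abs_pos.2 hx))).congr
      fun k hk => stationaryWave_of_neg h hs hk hx' y
  · exact ((continuousOn_transmittedPart h hs x y).add
      (continuousOn_evan h hs.hasC1_v (fun n => abs_chiPlus_le d n y) (abs_pos.2 hx))).congr
      fun k hk => stationaryWave_of_pos h hs hk hx' y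

theorem psi_of_neg (h : Gap d n₀ N α β) (hac : Continuous a) (ha : ∀ k ∉ Icc α β, a k = 0)
    (hs : SmoothCoeffs n₀ α β u u' v v' r tr) (t : ℝ) {p : ℝ × ℝ} (hp : p.1 < 0) :
    psi d n₀ a r tr t p = psiMinus d n₀ a t p + psiDN d n₀ a r t p +
      evanPacket d n₀ N a u (chiMinus d) t p := by
  rw [psi, integral_amplitude_congr ha t fun k hk => stationaryWave_of_neg h hs hk hp p.2]
  simp only [mul_add]
  have h1 := integrable_amplitude_mul (d := d) (n₀ := n₀) hac ha t
    (continuousOn_incomingPart (d := d) (n₀ := n₀) p.1 p.2)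
  have h2 := integrable_amplitude_mul (d := d) (n₀ := n₀) hac ha t
    (continuousOn_reflectedPart h hs p.1 p.2)
  have h3 := integrable_amplitude_mul (d := d) (n₀ := n₀) hac ha t
    (continuousOn_evan h hs.hasC1_u (fun n => abs_chiMinus_le d n p.2) (abs_pos.2 hp.ne))
  have h12 : Integrable fun k => amplitude d n₀ a t k * incomingPart d n₀ k p.1 p.2 +
      amplitude d n₀ a t k * reflectedPart d n₀ k (r k) p.1 p.2 := h1.add h2
  rw [integral_add h12 h3, integral_add h1 h2]
  rfl

theorem psi_of_pos (h : Gap d n₀ N α β) (hac : Continuous a) (ha : ∀ k ∉ Icc α β, a k = 0)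
    (hs : SmoothCoeffs n₀ α β u u' v v' r tr) (t : ℝ) {p : ℝ × ℝ} (hp : 0 < p.1) :
    psi d n₀ a r tr t p = psiND d n₀ a tr t p + evanPacket d n₀ N a v (chiPlus d) t p := by
  rw [psi, integral_amplitude_congr ha t fun k hk => stationaryWave_of_pos h hs hk hp p.2]
  simp only [mul_add]
  have h2 := integrable_amplitude_mul (d := d) (n₀ := n₀) hac ha t
    (continuousOn_transmittedPart h hs p.1 p.2)
  have h3 := integrable_amplitude_mul (d := d) (n₀ := n₀) hac ha t
    (continuousOn_evan h hs.hasC1_v (fun n => abs_chiPlus_le d n p.2) (abs_pos.2 hp.ne'))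
  rw [integral_add h2 h3]
  rfl

end Decomposition

/-! ### Measurability of the packets -/

section Measurability

variable {d : ℝ} {n₀ N : ℕ+} {α β : ℝ} {a : ℝ → ℂ}

theorem aestronglyMeasurable_modeSum (hac : Continuous a) (ha : ∀ k ∉ Icc α β, a k = 0)
    {c : ℝ → ℕ+ → ℂ} (hc : ∀ n, ContinuousOn (fun k => c k n) (Icc α β)) {e : ℕ+ → ℝ → ℝ}
    (he : ∀ n, Continuous (e n)) (s : Finset ℕ+) (t : ℝ) {g : ℝ × ℝ → ℝ} (hg : Measurable g) :
    AEStronglyMeasurable (fun p => ∑ l ∈ s, modePacket d n₀ a (fun k => c k l) l t (g p) *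
      (e l p.2 : ℂ)) (volOmega d) := by
  refine Finset.aestronglyMeasurable_fun_sum _ fun l _ => ?_
  refine (aestronglyMeasurable_modePacket hac ha (hc l) l t hg).mul ?_
  have := he l
  exact Continuous.aestronglyMeasurable (by fun_prop)

theorem aestronglyMeasurable_evanPacket (h : Gap d n₀ N α β) (hac : Continuous a)
    (ha : ∀ k ∉ Icc α β, a k = 0) {u u' : ℝ → Seq} (hu : HasC1Seq α β u u') {e : ℕ+ → ℝ → ℝ}
    (he : ∀ n, Continuous (e n)) {D : ℝ} (hD : ∀ n y, |e n y| ≤ D) (t : ℝ) :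
    AEStronglyMeasurable (evanPacket d n₀ N a u e t) (volOmega d) := by
  have e0 : evanPacket d n₀ N a u e t = fun p => ∫ k in Icc α β,
      amplitude d n₀ a t k * evan d n₀ N u |p.1| (fun n => e n p.2) k := by
    funext p; exact integral_amplitude_mul ha t _
  rw [e0]
  obtain ⟨_, _, _, _, H⟩ := exists_hasC1_evan h hu ((abs_nonneg _).trans (hD 1 0))
  have hA : AEStronglyMeasurable (fun z : (ℝ × ℝ) × ℝ => amplitude d n₀ a t z.2)
      ((volOmega d).prod (volume.restrict (Icc α β))) := by
    have : Continuous fun k => amplitude d n₀ a t k := by unfold amplitude; fun_prop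
    exact (this.measurable.comp measurable_snd).aestronglyMeasurable
  have hT : ∀ n : ℕ+, AEStronglyMeasurable (fun z : (ℝ × ℝ) × ℝ =>
      evanTerm d n₀ u |z.1.1| (fun n => e n z.1.2) n z.2)
      ((volOmega d).prod (volume.restrict (Icc α β))) := by
    intro n
    have h1 : AEStronglyMeasurable (fun z : (ℝ × ℝ) × ℝ => u z.2 n)
        ((volOmega d).prod (volume.restrict (Icc α β))) :=
      ((hu.coord n).cont.aestronglyMeasurable measurableSet_Icc).comp_snd
    have h2 : Continuous fun k => decay d n₀ k n := by unfold decay; fun_prop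
    have h3 := he n
    have h4 : Continuous fun z : (ℝ × ℝ) × ℝ =>
        (Real.exp (-(decay d n₀ z.2 n * |z.1.1|)) : ℂ) := by fun_prop
    have h5 : Continuous fun z : (ℝ × ℝ) × ℝ => (e n z.1.2 : ℂ) := by fun_prop
    exact ((h1.const_mul (((Real.sqrt n)⁻¹ : ℝ) : ℂ)).mul h4.aestronglyMeasurable).mul
      h5.aestronglyMeasurable
  have hE : AEStronglyMeasurable (fun z : (ℝ × ℝ) × ℝ =>
      evan d n₀ N u |z.1.1| (fun n => e n z.1.2) z.2)
      ((volOmega d).prod (volume.restrict (Icc α β))) := by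
    have hT' : ∀ s : Finset (Ioi N), AEStronglyMeasurable (fun z : (ℝ × ℝ) × ℝ =>
        ∑ n ∈ s, evanTerm d n₀ u |z.1.1| (fun n => e n z.1.2) n z.2)
        ((volOmega d).prod (volume.restrict (Icc α β))) := by
      intro s
      refine Finset.aestronglyMeasurable_fun_sum s fun n hn => ?_
      exact hT n
    -- The series converges for x ≠ 0 and k in the window, hence almost everywhere, so the
    -- measurability of the finite partial sums passes to it.
    refine aestronglyMeasurable_of_tendsto_ae (atTop : Filter (Finset (Ioi N))) hT' ?_
    have h1 : ∀ᵐ z ∂((volOmega d).prod (volume.restrict (Icc α β))), z.1.1 ≠ 0 :=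
      Measure.quasiMeasurePreserving_fst.ae (ae_fst_ne_zero d)
    have h2 : ∀ᵐ z ∂((volOmega d).prod (volume.restrict (Icc α β))), z.2 ∈ Icc α β :=
      Measure.quasiMeasurePreserving_snd.ae (ae_restrict_mem measurableSet_Icc)
    filter_upwards [h1, h2] with z hz1 hz2
    have h3 := (H |z.1.1| (abs_pos.2 hz1) (fun n => e n z.1.2) fun n => hD n _).1 z.2 hz2
    exact h3.hasSum
  exact (hA.mul hE).integral_prod_right'

end Measurability

/-! ### Bounds for finite sums of propagating packets -/

section Bounds

variable {d : ℝ} {n₀ N : ℕ+} {α β : ℝ} {a : ℝ → ℂ}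

theorem exists_norm_modeSum_le (h : Gap d n₀ N α β) (hac : ContDiff ℝ 1 a)
    (ha : ∀ k ∉ Icc α β, a k = 0) {c c' : ℝ → ℕ+ → ℂ}
    (hc : ∀ n, HasC1 α β (fun k => c k n) (fun k => c' k n)) {s : Finset ℕ+}
    (hsN : ∀ l ∈ s, l ≤ N) (D : ℝ) :
    ∃ C, 0 ≤ C ∧ ∀ e : ℕ+ → ℝ, (∀ n, |e n| ≤ D) → ∀ t x : ℝ, t * x ≤ 0 → x ≠ 0 →
      ‖∑ l ∈ s, modePacket d n₀ a (fun k => c k l) l t x * (e l : ℂ)‖ ≤ C / (|t| + |x|) := by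
  choose! C hC0 hC using fun l (hl : l ∈ s) =>
    exists_norm_modePacket_le h (hsN l hl) hac ha (hc l)
  refine ⟨∑ l ∈ s, |C l * D|, Finset.sum_nonneg fun _ _ => abs_nonneg _,
    fun e he t x htx hx => ?_⟩
  have hpos : 0 < |t| + |x| := by have := abs_pos.2 hx; positivity
  rw [Finset.sum_div]
  refine norm_sum_le_of_le _ fun l hl => ?_
  rw [norm_mul, Complex.norm_real, Real.norm_eq_abs]
  calc _ ≤ C l / (|t| + |x|) * D := mul_le_mul (hC l hl t x htx hpos) (he l) (abs_nonneg _)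
        (div_nonneg (hC0 l hl) hpos.le)
    _ = C l * D / (|t| + |x|) := by ring
    _ ≤ |C l * D| / (|t| + |x|) := by gcongr; exact le_abs_self _

theorem exists_norm_modeSum_le_fixed (h : Gap d n₀ N α β) (hac : ContDiff ℝ 1 a)
    (ha : ∀ k ∉ Icc α β, a k = 0) {c c' : ℝ → ℕ+ → ℂ}
    (hc : ∀ n, HasC1 α β (fun k => c k n) (fun k => c' k n)) {s : Finset ℕ+}
    (hsN : ∀ l ∈ s, l ≤ N) (D t : ℝ) :
    ∃ C, 0 ≤ C ∧ ∀ e : ℕ+ → ℝ, (∀ n, |e n| ≤ D) → ∀ x : ℝ, x ≠ 0 →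
      ‖∑ l ∈ s, modePacket d n₀ a (fun k => c k l) l t x * (e l : ℂ)‖ ≤ C / (1 + |x|) := by
  choose! C hC0 hC using fun l (hl : l ∈ s) =>
    exists_norm_modePacket_le_fixed h (hsN l hl) hac ha (hc l) t
  refine ⟨∑ l ∈ s, |C l * D|, Finset.sum_nonneg fun _ _ => abs_nonneg _, fun e he x hx => ?_⟩
  have hpos : 0 < 1 + |x| := by positivity
  rw [Finset.sum_div]
  refine norm_sum_le_of_le _ fun l hl => ?_
  rw [norm_mul, Complex.norm_real, Real.norm_eq_abs]
  calc _ ≤ C l / (1 + |x|) * D := mul_le_mul (hC l hl x hx) (he l) (abs_nonneg _)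
        (div_nonneg (hC0 l hl) hpos.le)
    _ = C l * D / (1 + |x|) := by ring
    _ ≤ |C l * D| / (1 + |x|) := by gcongr; exact le_abs_self _

end Bounds

theorem le_topMode (d : ℝ) (n₀ : ℕ+) (k : ℝ) : n₀ ≤ topMode d n₀ k := by
  have h1 := one_le_cast n₀
  change (n₀ : ℕ) ≤ ⌊_⌋₊
  refine Nat.le_floor ?_
  have h2 : (n₀ : ℝ) - 1 / 2 ≤
      Real.sqrt (((n₀ : ℝ) - 1 / 2) ^ 2 + d ^ 2 / Real.pi ^ 2 * k ^ 2) := by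
    apply Real.le_sqrt_of_sq_le
    have : 0 ≤ d ^ 2 / Real.pi ^ 2 * k ^ 2 := by positivity
    linarith
  linarith

theorem gap_topMode {d : ℝ} (hd : 0 < d) {n₀ : ℕ+} {k₀ α β : ℝ}
    (hα : Real.sqrt (mu d (topMode d n₀ k₀) - mu d n₀) < α) (hαβ : α < β)
    (hβ : β < Real.sqrt (mu d (topMode d n₀ k₀ + 1) - mu d n₀)) :
    Gap d n₀ (topMode d n₀ k₀) α β := by
  have hα0 : 0 < α := (Real.sqrt_nonneg _).trans_lt hα
  exact ⟨hd, le_topMode d n₀ k₀, hα0, hαβ, (Real.sqrt_lt' hα0).1 hα,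
    (Real.lt_sqrt (hα0.trans hαβ).le).1 hβ⟩

/-! ### Norm estimates for the full packets -/

section Packets

variable {d : ℝ} {n₀ N : ℕ+} {α β : ℝ} {a : ℝ → ℂ} {u u' v v' : ℝ → Seq} {r tr : ℝ → ℕ+ → ℂ}

theorem hasC1_const (α β : ℝ) (z : ℂ) : HasC1 α β (fun _ => z) (fun _ => 0) :=
  ⟨continuousOn_const, continuousOn_const, fun k _ => hasDerivAt_const k z⟩

/-- One pair of constants for both sides of the interface, as a single profile is needed on the
whole line. -/
theorem exists_norm_evanPacket_le (h : Gap d n₀ N α β) (hac : ContDiff ℝ 1 a)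
    (ha : ∀ k ∉ Icc α β, a k = 0) (hu : HasC1Seq α β u u') (hv : HasC1Seq α β v v') :
    ∃ C c, 0 ≤ C ∧ 0 < c ∧ ∀ w e, (w = u ∧ e = chiMinus d ∨ w = v ∧ e = chiPlus d) →
      ∀ (t : ℝ) (p : ℝ × ℝ), p.1 ≠ 0 →
        ‖evanPacket d n₀ N a w e t p‖ ≤
          C * (|p.1| ^ (-(1 / 4) : ℝ) * Real.exp (-(c * |p.1|))) ∧
        (t ≠ 0 → ‖evanPacket d n₀ N a w e t p‖ ≤
          C * (|p.1| ^ (-(1 / 4) : ℝ) * Real.exp (-(c * |p.1|))) / |t|) := by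
  obtain ⟨C₁, c₁, hC₁, hc₁, H₁⟩ := exists_norm_integral_evan_le h hac ha hu
    (Real.sqrt_nonneg (2 / d))
  obtain ⟨C₂, c₂, hC₂, hc₂, H₂⟩ := exists_norm_integral_evan_le h hac ha hv
    (Real.sqrt_nonneg (2 / d))
  have key : ∀ x : ℝ, ∀ C c : ℝ, 0 ≤ C → C ≤ max C₁ C₂ → min c₁ c₂ ≤ c →
      C * (|x| ^ (-(1 / 4) : ℝ) * Real.exp (-(c * |x|))) ≤
        max C₁ C₂ * (|x| ^ (-(1 / 4) : ℝ) * Real.exp (-(min c₁ c₂ * |x|))) := by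
    intro x C c hC hC' hc
    have := abs_nonneg x
    gcongr
  refine ⟨max C₁ C₂, min c₁ c₂, le_max_of_le_left hC₁, lt_min hc₁ hc₂, ?_⟩
  rintro w e (⟨rfl, rfl⟩ | ⟨rfl, rfl⟩) t p hp
  · obtain ⟨h1, h2⟩ := H₁ |p.1| (abs_pos.2 hp) (fun n => chiMinus d n p.2)
      (fun n => abs_chiMinus_le d n p.2) t
    have h3 := key p.1 C₁ c₁ hC₁ (le_max_left _ _) (min_le_left _ _)
    exact ⟨h1.trans h3, fun ht => (h2 ht).trans
      (div_le_div_of_nonneg_right h3 (abs_nonneg t))⟩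
  · obtain ⟨h1, h2⟩ := H₂ |p.1| (abs_pos.2 hp) (fun n => chiPlus d n p.2)
      (fun n => abs_chiPlus_le d n p.2) t
    have h3 := key p.1 C₂ c₂ hC₂ (le_max_right _ _) (min_le_right _ _)
    exact ⟨h1.trans h3, fun ht => (h2 ht).trans
      (div_le_div_of_nonneg_right h3 (abs_nonneg t))⟩

/-- The free packets decay like `1 / (|t| + |x|)` in the regions they are moving away from. -/
theorem exists_norm_free_le (h : Gap d n₀ N α β) (hac : ContDiff ℝ 1 a)
    (ha : ∀ k ∉ Icc α β, a k = 0) (hs : SmoothCoeffs n₀ α β u u' v v' r tr) :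
    ∃ C, 0 ≤ C ∧ ∀ (t : ℝ) (p : ℝ × ℝ), p.1 ≠ 0 →
      (t * p.1 ≤ 0 → ‖psiMinus d n₀ a t p‖ ≤ C / (|t| + |p.1|)) ∧
      (0 ≤ t * p.1 → ‖psiDN d n₀ a r t p‖ ≤ C / (|t| + |p.1|)) ∧
      (t * p.1 ≤ 0 → ‖psiND d n₀ a tr t p‖ ≤ C / (|t| + |p.1|)) := by
  obtain ⟨C₁, h₁, H₁⟩ := exists_norm_modeSum_le h hac ha (c := fun _ _ => 1) (c' := fun _ _ => 0)
    (fun _ => hasC1_const α β 1) (s := {n₀}) (by simpa using h.le) (Real.sqrt (2 / d))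
  obtain ⟨C₂, h₂, H₂⟩ := exists_norm_modeSum_le h hac ha (c := r) (fun n => hs.hasC1_r n)
    (s := Finset.Icc 1 N) (fun l hl => (Finset.mem_Icc.1 hl).2) (Real.sqrt (2 / d))
  obtain ⟨C₃, h₃, H₃⟩ := exists_norm_modeSum_le h hac ha (c := tr) (fun n => hs.hasC1_tr n)
    (s := Finset.Icc 1 N) (fun l hl => (Finset.mem_Icc.1 hl).2) (Real.sqrt (2 / d))
  refine ⟨C₁ + C₂ + C₃, by positivity, fun t p hp => ⟨fun ht => ?_, fun ht => ?_, fun ht => ?_⟩⟩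
  · rw [psiMinus_eq h hac.continuous ha]
    refine (H₁ _ (fun n => abs_chiMinus_le d n p.2) t p.1 ht hp).trans ?_
    gcongr; linarith
  · rw [psiDN_eq h hac.continuous ha hs]
    refine (H₂ _ (fun n => abs_chiMinus_le d n p.2) t (-p.1) (by linarith)
      (neg_ne_zero.2 hp)).trans ?_
    rw [abs_neg]
    gcongr; linarith
  · rw [psiND_eq h hac.continuous ha hs]
    refine (H₃ _ (fun n => abs_chiPlus_le d n p.2) t p.1 ht hp).trans ?_
    gcongr; linarith

theorem exists_norm_free_le_fixed (h : Gap d n₀ N α β) (hac : ContDiff ℝ 1 a)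
    (ha : ∀ k ∉ Icc α β, a k = 0) (hs : SmoothCoeffs n₀ α β u u' v v' r tr) (t : ℝ) :
    ∃ C, 0 ≤ C ∧ ∀ p : ℝ × ℝ, p.1 ≠ 0 →
      ‖psiMinus d n₀ a t p‖ ≤ C / (1 + |p.1|) ∧ ‖psiDN d n₀ a r t p‖ ≤ C / (1 + |p.1|) ∧
      ‖psiND d n₀ a tr t p‖ ≤ C / (1 + |p.1|) := by
  obtain ⟨C₁, h₁, H₁⟩ := exists_norm_modeSum_le_fixed h hac ha (c := fun _ _ => 1)
    (c' := fun _ _ => 0) (fun _ => hasC1_const α β 1) (s := {n₀}) (by simpa using h.le)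
    (Real.sqrt (2 / d)) t
  obtain ⟨C₂, h₂, H₂⟩ := exists_norm_modeSum_le_fixed h hac ha (c := r) (fun n => hs.hasC1_r n)
    (s := Finset.Icc 1 N) (fun l hl => (Finset.mem_Icc.1 hl).2) (Real.sqrt (2 / d)) t
  obtain ⟨C₃, h₃, H₃⟩ := exists_norm_modeSum_le_fixed h hac ha (c := tr) (fun n => hs.hasC1_tr n)
    (s := Finset.Icc 1 N) (fun l hl => (Finset.mem_Icc.1 hl).2) (Real.sqrt (2 / d)) t
  refine ⟨C₁ + C₂ + C₃, by positivity, fun p hp => ⟨?_, ?_, ?_⟩⟩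
  · rw [psiMinus_eq h hac.continuous ha]
    refine (H₁ _ (fun n => abs_chiMinus_le d n p.2) p.1 hp).trans ?_
    gcongr; linarith
  · rw [psiDN_eq h hac.continuous ha hs]
    refine (H₂ _ (fun n => abs_chiMinus_le d n p.2) (-p.1) (neg_ne_zero.2 hp)).trans ?_
    rw [abs_neg]
    gcongr; linarith
  · rw [psiND_eq h hac.continuous ha hs]
    refine (H₃ _ (fun n => abs_chiPlus_le d n p.2) p.1 hp).trans ?_
    gcongr; linarith

theorem aestronglyMeasurable_psiMinus (h : Gap d n₀ N α β) (hac : Continuous a)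
    (ha : ∀ k ∉ Icc α β, a k = 0) (t : ℝ) :
    AEStronglyMeasurable (psiMinus d n₀ a t) (volOmega d) := by
  rw [funext (psiMinus_eq h hac ha t)]
  exact aestronglyMeasurable_modeSum hac ha (c := fun _ _ => 1) (fun _ => continuousOn_const)
    (continuous_chiMinus d) _ t measurable_fst

theorem aestronglyMeasurable_psiDN (h : Gap d n₀ N α β) (hac : Continuous a)
    (ha : ∀ k ∉ Icc α β, a k = 0) (hs : SmoothCoeffs n₀ α β u u' v v' r tr) (t : ℝ) :
    AEStronglyMeasurable (psiDN d n₀ a r t) (volOmega d) := by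
  rw [funext (psiDN_eq h hac ha hs t)]
  exact aestronglyMeasurable_modeSum hac ha (fun n => (hs.hasC1_r n).cont)
    (continuous_chiMinus d) _ t measurable_fst.neg

theorem aestronglyMeasurable_psiND (h : Gap d n₀ N α β) (hac : Continuous a)
    (ha : ∀ k ∉ Icc α β, a k = 0) (hs : SmoothCoeffs n₀ α β u u' v v' r tr) (t : ℝ) :
    AEStronglyMeasurable (psiND d n₀ a tr t) (volOmega d) := by
  rw [funext (psiND_eq h hac ha hs t)]
  exact aestronglyMeasurable_modeSum hac ha (fun n => (hs.hasC1_tr n).cont)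
    (continuous_chiPlus d) _ t measurable_fst

theorem aestronglyMeasurable_ite_fst {f g : ℝ × ℝ → ℂ}
    (hf : AEStronglyMeasurable f (volOmega d)) (hg : AEStronglyMeasurable g (volOmega d)) :
    AEStronglyMeasurable (fun p => if p.1 < 0 then f p else g p) (volOmega d) := by
  have h1 : MeasurableSet {p : ℝ × ℝ | p.1 < 0} := measurableSet_lt measurable_fst measurable_const
  classical
  refine (AEStronglyMeasurable.piecewise h1 hf.restrict hg.restrict).congr
    (ae_of_all _ fun p => ?_)
  simp only [piecewise, mem_ofPred_eq]

theorem aestronglyMeasurable_psi (h : Gap d n₀ N α β) (hac : Continuous a)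
    (ha : ∀ k ∉ Icc α β, a k = 0) (hs : SmoothCoeffs n₀ α β u u' v v' r tr) (t : ℝ) :
    AEStronglyMeasurable (psi d n₀ a r tr t) (volOmega d) := by
  have h1 := aestronglyMeasurable_ite_fst
    (((aestronglyMeasurable_psiMinus h hac ha t).add
      (aestronglyMeasurable_psiDN h hac ha hs t)).add (aestronglyMeasurable_evanPacket h hac ha
        hs.hasC1_u (continuous_chiMinus d) (abs_chiMinus_le d) t))
    ((aestronglyMeasurable_psiND h hac ha hs t).add (aestronglyMeasurable_evanPacket h hac ha
        hs.hasC1_v (continuous_chiPlus d) (abs_chiPlus_le d) t))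
  refine h1.congr ?_
  filter_upwards [ae_fst_ne_zero d] with p hp
  rcases lt_or_gt_of_ne hp with hp' | hp'
  · rw [if_pos hp', psi_of_neg h hac ha hs t hp']; rfl
  · rw [if_neg (not_lt.2 hp'.le), psi_of_pos h hac ha hs t hp']; rfl

/-- The norm estimate at T = 1 with the fixed-time bounds; at this value its two conditions on the
evanescent part coincide. -/
theorem memLp_packets (h : Gap d n₀ N α β) (hac : ContDiff ℝ 1 a)
    (ha : ∀ k ∉ Icc α β, a k = 0) (hs : SmoothCoeffs n₀ α β u u' v v' r tr) (t : ℝ) :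
    MemLp (psi d n₀ a r tr t) 2 (volOmega d) ∧ MemLp (psiMinus d n₀ a t) 2 (volOmega d) ∧
      MemLp (psiPlus d n₀ a r tr t) 2 (volOmega d) := by
  have hc := hac.continuous
  obtain ⟨C₁, hC₁, H₁⟩ := exists_norm_free_le_fixed h hac ha hs t
  obtain ⟨C₂, c, hC₂, hc0, H₂⟩ := exists_norm_evanPacket_le h hac ha hs.hasC1_u hs.hasC1_v
  obtain ⟨C, -, H⟩ := exists_eLpNorm_le h.d_pos hc0 (2 * C₁) C₂
  have htop : ∀ f : ℝ × ℝ → ℂ, AEStronglyMeasurable f (volOmega d) →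
      (∀ p : ℝ × ℝ, p.1 ≠ 0 → ∃ E, 0 ≤ E ∧ ‖f p‖ ≤ 2 * C₁ / (1 + |p.1|) + E ∧
        E ≤ C₂ * (|p.1| ^ (-(1 / 4) : ℝ) * Real.exp (-(c * |p.1|)))) → MemLp f 2 (volOmega d) := by
    intro f hf hb
    refine ⟨hf, (H 1 one_pos f fun p hp => ?_).trans_lt ENNReal.ofReal_lt_top⟩
    obtain ⟨E, h0, h1, h2⟩ := hb p hp
    exact ⟨E, h0, h1, h2, by rwa [div_one]⟩
  have hle : ∀ x : ℝ, C₁ / (1 + |x|) ≤ 2 * C₁ / (1 + |x|) := fun x => by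
    have := abs_nonneg x
    gcongr; linarith
  have hE0 : ∀ x : ℝ, 0 ≤ C₂ * (|x| ^ (-(1 / 4) : ℝ) * Real.exp (-(c * |x|))) := fun x => by
    positivity
  refine ⟨htop _ (aestronglyMeasurable_psi h hc ha hs t) fun p hp => ?_,
    htop _ (aestronglyMeasurable_psiMinus h hc ha t) fun p hp => ?_,
    htop _ (aestronglyMeasurable_ite_fst (aestronglyMeasurable_psiDN h hc ha hs t)
      (aestronglyMeasurable_psiND h hc ha hs t)) fun p hp => ?_⟩
  · obtain ⟨b1, b2, b3⟩ := H₁ p hp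
    rcases lt_or_gt_of_ne hp with hp' | hp'
    · refine ⟨_, norm_nonneg _, ?_, (H₂ u (chiMinus d) (Or.inl ⟨rfl, rfl⟩) t p hp).1⟩
      rw [psi_of_neg h hc ha hs t hp']
      refine (norm_add_le _ _).trans (add_le_add_left ((norm_add_le _ _).trans ?_) _)
      calc _ ≤ C₁ / (1 + |p.1|) + C₁ / (1 + |p.1|) := add_le_add b1 b2
        _ = _ := by ring
    · refine ⟨_, norm_nonneg _, ?_, (H₂ v (chiPlus d) (Or.inr ⟨rfl, rfl⟩) t p hp).1⟩
      rw [psi_of_pos h hc ha hs t hp']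
      exact (norm_add_le _ _).trans (add_le_add_left (b3.trans (hle _)) _)
  · exact ⟨0, le_rfl, by rw [add_zero]; exact (H₁ p hp).1.trans (hle _), hE0 _⟩
  · refine ⟨0, le_rfl, ?_, hE0 _⟩
    rw [add_zero, psiPlus]
    split_ifs
    · exact (H₁ p hp).2.1.trans (hle _)
    · exact (H₁ p hp).2.2.trans (hle _)

/-- Apart from evanescent terms, the difference is the reflected packet for t < 0, x < 0, the
transmitted minus the incoming packet for t < 0, x > 0, the incoming packet for t > 0, x < 0, and
zero for t > 0, x > 0. Each packet is in the range without stationary points, and two of them occur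
at most, hence the constant 2C₁. -/
theorem exists_eLpNorm_psi_sub_le (h : Gap d n₀ N α β) (hac : ContDiff ℝ 1 a)
    (ha : ∀ k ∉ Icc α β, a k = 0) (hs : SmoothCoeffs n₀ α β u u' v v' r tr) :
    ∃ C : ℝ,
      (∀ t : ℝ, t < 0 → eLpNorm (fun p => psi d n₀ a r tr t p - psiMinus d n₀ a t p) 2
        (volOmega d) ≤ ENNReal.ofReal (C * |t| ^ (-(1 / 2) : ℝ))) ∧
      (∀ t : ℝ, 0 < t → eLpNorm (fun p => psi d n₀ a r tr t p - psiPlus d n₀ a r tr t p) 2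
        (volOmega d) ≤ ENNReal.ofReal (C * |t| ^ (-(1 / 2) : ℝ))) := by
  have hc := hac.continuous
  obtain ⟨C₁, hC₁, H₁⟩ := exists_norm_free_le h hac ha hs
  obtain ⟨C₂, c, hC₂, hc0, H₂⟩ := exists_norm_evanPacket_le h hac ha hs.hasC1_u hs.hasC1_v
  obtain ⟨C, -, H⟩ := exists_eLpNorm_le h.d_pos hc0 (2 * C₁) C₂
  have hle : ∀ t x : ℝ, C₁ / (|t| + |x|) ≤ 2 * C₁ / (|t| + |x|) := fun t x => by
    have := abs_nonneg x
    gcongr; linarith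
  refine ⟨C, fun t ht => H |t| (abs_pos.2 ht.ne) _ fun p hp => ?_,
    fun t ht => H |t| (abs_pos.2 ht.ne') _ fun p hp => ?_⟩
  · obtain ⟨b1, b2, b3⟩ := H₁ t p hp
    rcases lt_or_gt_of_ne hp with hp' | hp'
    · obtain ⟨e1, e2⟩ := H₂ u (chiMinus d) (Or.inl ⟨rfl, rfl⟩) t p hp
      refine ⟨_, norm_nonneg _, ?_, e1, e2 ht.ne⟩
      have e : psi d n₀ a r tr t p - psiMinus d n₀ a t p =
          psiDN d n₀ a r t p + evanPacket d n₀ N a u (chiMinus d) t p := by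
        rw [psi_of_neg h hc ha hs t hp']; ring
      rw [e]
      exact (norm_add_le _ _).trans
        (add_le_add_left ((b2 (mul_nonneg_of_nonpos_of_nonpos ht.le hp'.le)).trans (hle _ _)) _)
    · obtain ⟨e1, e2⟩ := H₂ v (chiPlus d) (Or.inr ⟨rfl, rfl⟩) t p hp
      refine ⟨_, norm_nonneg _, ?_, e1, e2 ht.ne⟩
      have e : psi d n₀ a r tr t p - psiMinus d n₀ a t p =
          (psiND d n₀ a tr t p - psiMinus d n₀ a t p) +
            evanPacket d n₀ N a v (chiPlus d) t p := by
        rw [psi_of_pos h hc ha hs t hp']; ring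
      have htp : t * p.1 ≤ 0 := mul_nonpos_of_nonpos_of_nonneg ht.le hp'.le
      rw [e]
      refine (norm_add_le _ _).trans (add_le_add_left ((norm_sub_le _ _).trans ?_) _)
      calc _ ≤ C₁ / (|t| + |p.1|) + C₁ / (|t| + |p.1|) := add_le_add (b3 htp) (b1 htp)
        _ = _ := by ring
  · obtain ⟨b1, b2, b3⟩ := H₁ t p hp
    rcases lt_or_gt_of_ne hp with hp' | hp'
    · obtain ⟨e1, e2⟩ := H₂ u (chiMinus d) (Or.inl ⟨rfl, rfl⟩) t p hp
      refine ⟨_, norm_nonneg _, ?_, e1, e2 ht.ne'⟩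
      have e : psi d n₀ a r tr t p - psiPlus d n₀ a r tr t p =
          psiMinus d n₀ a t p + evanPacket d n₀ N a u (chiMinus d) t p := by
        rw [psi_of_neg h hc ha hs t hp', psiPlus, if_pos hp']; ring
      rw [e]
      exact (norm_add_le _ _).trans
        (add_le_add_left ((b1 (mul_nonpos_of_nonneg_of_nonpos ht.le hp'.le)).trans (hle _ _)) _)
    · obtain ⟨e1, e2⟩ := H₂ v (chiPlus d) (Or.inr ⟨rfl, rfl⟩) t p hp
      refine ⟨_, norm_nonneg _, ?_, e1, e2 ht.ne'⟩
      have e : psi d n₀ a r tr t p - psiPlus d n₀ a r tr t p =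
          evanPacket d n₀ N a v (chiPlus d) t p := by
        rw [psi_of_pos h hc ha hs t hp', psiPlus, if_neg (not_lt.2 hp'.le)]; ring
      rw [e]
      have : 0 ≤ 2 * C₁ / (|t| + |p.1|) := by positivity
      linarith

end Packets

/-! ### Limits in time and conclusion -/

theorem tendsto_ofReal_rpow_abs {l : Filter ℝ} (hl : Tendsto (fun t : ℝ => |t|) l atTop) (C : ℝ) :
    Tendsto (fun t : ℝ => ENNReal.ofReal (C * |t| ^ (-(1 / 2) : ℝ))) l (𝓝 0) := by
  have h1 : Tendsto (fun t : ℝ => C * |t| ^ (-(1 / 2) : ℝ)) l (𝓝 (C * 0)) :=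
    ((tendsto_rpow_neg_atTop (by norm_num : (0 : ℝ) < 1 / 2)).comp hl).const_mul C
  rw [mul_zero] at h1
  simpa using ENNReal.tendsto_ofReal h1

end Waveguide

end

theorem mainTheorem4 (d : ℝ) (hd : 0 < d) (n₀ : ℕ+) (k₀ α β : ℝ)
    (hα : Real.sqrt (Waveguide.mu d (Waveguide.topMode d n₀ k₀) - Waveguide.mu d n₀) < α)
    (hαβ : α < β)
    (hβ : β < Real.sqrt (Waveguide.mu d (Waveguide.topMode d n₀ k₀ + 1) - Waveguide.mu d n₀))
    (a : ℝ → ℂ) (ha : ContDiff ℝ 1 a) (hsupp : tsupport a ⊆ Set.Icc α β) :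
    (∀ k ∈ Set.Icc α β,
      ∃! c : (ℕ+ → ℂ) × (ℕ+ → ℂ), Waveguide.IsScattering d n₀ k c.1 c.2) ∧
    ∀ r tr : ℝ → ℕ+ → ℂ,
      (∀ k ∈ Set.Icc α β, Waveguide.IsScattering d n₀ k (r k) (tr k)) →
      (∀ t x y : ℝ, x ≠ 0 → y ∈ Set.Ioo 0 d → Integrable (fun k : ℝ =>
        Waveguide.amplitude d n₀ a t k *
          Waveguide.stationaryWave d n₀ k (r k) (tr k) x y)) ∧
      (∀ t : ℝ,
        MemLp (Waveguide.psi d n₀ a r tr t) 2 (Waveguide.volOmega d) ∧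
        MemLp (Waveguide.psiMinus d n₀ a t) 2 (Waveguide.volOmega d) ∧
        MemLp (Waveguide.psiPlus d n₀ a r tr t) 2 (Waveguide.volOmega d)) ∧
      Tendsto (fun t : ℝ => eLpNorm
        (fun p => Waveguide.psi d n₀ a r tr t p - Waveguide.psiMinus d n₀ a t p) 2
        (Waveguide.volOmega d)) atBot (𝓝 0) ∧
      Tendsto (fun t : ℝ => eLpNorm
        (fun p => Waveguide.psi d n₀ a r tr t p - Waveguide.psiPlus d n₀ a r tr t p) 2
        (Waveguide.volOmega d)) atTop (𝓝 0) ∧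
      ∃ C : ℝ,
        (∀ t : ℝ, t < 0 → eLpNorm
          (fun p => Waveguide.psi d n₀ a r tr t p - Waveguide.psiMinus d n₀ a t p) 2
          (Waveguide.volOmega d) ≤ ENNReal.ofReal (C * |t| ^ (-(1 / 2) : ℝ))) ∧
        (∀ t : ℝ, 0 < t → eLpNorm
          (fun p => Waveguide.psi d n₀ a r tr t p - Waveguide.psiPlus d n₀ a r tr t p) 2
          (Waveguide.volOmega d) ≤ ENNReal.ofReal (C * |t| ^ (-(1 / 2) : ℝ))) := by
  have h := Waveguide.gap_topMode hd hα hαβ hβ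
  have ha0 : ∀ k ∉ Set.Icc α β, a k = 0 := fun k hk =>
    image_eq_zero_of_notMem_tsupport fun hk' => hk (hsupp hk')
  refine ⟨fun k hk => Waveguide.existsUnique_isScattering h hk, fun r tr hrt => ?_⟩
  obtain ⟨u, u', v, v', hs⟩ := Waveguide.exists_smoothCoeffs h hrt
  obtain ⟨C, hC1, hC2⟩ := Waveguide.exists_eLpNorm_psi_sub_le h ha ha0 hs
  refine ⟨fun t x y hx _ => Waveguide.integrable_amplitude_mul ha.continuous ha0 t
      (Waveguide.continuousOn_stationaryWave h hs hx y),
    fun t => Waveguide.memLp_packets h ha ha0 hs t, ?_, ?_, C, hC1, hC2⟩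
  · refine tendsto_of_tendsto_of_tendsto_of_le_of_le' tendsto_const_nhds
      (Waveguide.tendsto_ofReal_rpow_abs tendsto_abs_atBot_atTop C)
      (Eventually.of_forall fun _ => zero_le) ?_
    filter_upwards [eventually_lt_atBot 0] with t ht using hC1 t ht
  · refine tendsto_of_tendsto_of_tendsto_of_le_of_le' tendsto_const_nhds
      (Waveguide.tendsto_ofReal_rpow_abs tendsto_abs_atTop_atTop C)
      (Eventually.of_forall fun _ => zero_le) ?_
    filter_upwards [eventually_gt_atTop 0] with t ht using hC2 t ht
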